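/- Let $\xi_{std}=\ker(dz-y\,dx)$ be the standard contact structure on $\mathbb{R}^3$. A Legendrian $\theta$-graph consists of two vertices $a,b$ and three edges from $a$ to $b$, which are smoothly immersed curves tangent to $\xi_{std}$, which together are embedded, and no two of which have the same outward tangent direction at $a$ or at $b$. Say that it is in standard position near its vertices if, in the front projection (the projection to the $xz$-plane), the three edges leave $a$ to the right and arrive at $b$ from the left. In this case let $e_1,e_2,e_3$ be the edges that near $a$ are the top, the middle and the lower strand of the front, respectively, and let $\mathcal C_1$, $\mathcal C_2$, $\mathcal C_3$ be the oriented cycles that leave $a$ along $e_1,e_1,e_2$ and come back to $a$ along $e_2,e_3,e_3$, respectively. For an oriented cycle $\mathcal C$, the Thurston–Bennequin number $tb(\mathcal C)$ is the linking number of $\mathcal C$ with a small push-off in a direction transverse to $\xi_{std}$, and the rotation number $rot(\mathcal C)$ is the winding number of the oriented tangent vector of $\mathcal C$ (with corners at the vertices rounded in the contact plane, that is, turning there through an angle in $(-\pi,\pi)$) with respect to the frame $\frac{\partial}{\partial y},\ -y\frac{\partial}{\partial z}-\frac{\partial}{\partial x}$ of $\xi_{std}$. **Theorem.** Let $(tb_1,tb_2,tb_3)$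 and $(rot_1,rot_2,rot_3)$ be triples of integers such that, for $i=1,2,3$, $tb_i$ and $rot_i$ have different parities and $tb_i+|rot_i|\le -1$, and such that $rot_1-rot_2+rot_3\in\{0,-1\}$. Then there is a Legendrian $\theta$-graph in $(\mathbb{R}^3,\xi_{std})$, in standard position near its vertices, such that each of its cycles $\mathcal C_1,\mathcal C_2,\mathcal C_3$ is an unknot and $tb(\mathcal C_i)=tb_i$, $rot(\mathcal C_i)=rot_i$ for $i=1,2,3$. -/

import Mathlib

open scoped ContDiff

noncomputable section

/-- Three-dimensional space, with coordinates `x = p 0`, `y = p 1`, `z = p 2`.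
Only its topology, its smooth structure and its orientation are used. -/
abbrev R3 : Type := Fin 3 → ℝ

/-- The determinant of three vectors of space; it is positive on positively oriented bases. -/
def det3 (u v w : R3) : ℝ := Matrix.det (Matrix.of ![u, v, w])

/-! ### The standard contact structure -/

/-- The standard contact form `α = dz - y dx` at the point `p`, applied to the vector `v`. -/
def contactForm (p v : R3) : ℝ := v 2 - p 1 * v 0

/-- The first vector `∂/∂y` of the positively oriented frame of the standard contact structure. -/
def frame1 : R3 := ![0, 1, 0]

/-- The second vector `-y ∂/∂z - ∂/∂x` of the positively oriented frame of the standard contact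
structure, at the point `p`. -/
def frame2 (p : R3) : R3 := ![-1, 0, -p 1]

/-- `v` is a non-zero vector of the contact plane at `p` which makes the angle `θ` with the first
vector of the frame, with respect to the frame. -/
def HasContactAngle (p v : R3) (θ : ℝ) : Prop :=
  ∃ r : ℝ, 0 < r ∧ v = r • (Real.cos θ • frame1 + Real.sin θ • frame2 p)

/-! ### Linking numbers and unknots -/

/-- The disjoint oriented closed curves `A` and `B`, both parametrised by `[0, T]` and possibly
with corners, have linking number `n`: in the projection of space along some direction `d`, the
curve `A` passes over `B` (that is, `A s - B t` is a positive multiple of `d`) in finitely many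
crossings, all of them transverse and none at a corner or at the base point, and the signs of these
crossings add up to `n`. The sign of a crossing at which `A` has direction `u`, `B` has
direction `v` and `w` points from `B` to `A` is the sign of `det (u, v, w)`. -/
def HasLinkingNumber (T : ℝ) (A B : ℝ → R3) (n : ℤ) : Prop :=
  (∀ s ∈ Set.Icc 0 T, ∀ t ∈ Set.Icc 0 T, A s ≠ B t) ∧
  ∃ d : R3, d ≠ 0 ∧ ∃ C : Finset (ℝ × ℝ),
    (∀ s ∈ Set.Icc 0 T, ∀ t ∈ Set.Icc 0 T,
      (s, t) ∈ C ↔ ∃ h : ℝ, 0 < h ∧ A s - B t = h • d) ∧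
    (∀ p ∈ C, p.1 ∈ Set.Ioo 0 T ∧ p.2 ∈ Set.Ioo 0 T ∧
      DifferentiableAt ℝ A p.1 ∧ DifferentiableAt ℝ B p.2 ∧
      det3 (deriv A p.1) (deriv B p.2) (A p.1 - B p.2) ≠ 0) ∧
    ∑ p ∈ C, (SignType.sign (det3 (deriv A p.1) (deriv B p.2) (A p.1 - B p.2)) : ℤ) = n

/-- The round unit circle in the plane `z = 0`. -/
def roundCircle : Set R3 := {p | p 0 ^ 2 + p 1 ^ 2 = 1 ∧ p 2 = 0}

/-- `K` is an unknot: an ambient isotopy of space carries `K` onto a round circle. -/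
def IsUnknot (K : Set R3) : Prop :=
  ∃ H : unitInterval → (R3 ≃ₜ R3),
    Continuous (fun q : unitInterval × R3 => H q.1 q.2) ∧
    (∀ p, H 0 p = p) ∧ H 1 '' K = roundCircle

/-! ### Legendrian θ-graphs -/

/-- A Legendrian θ-graph in space with the standard contact structure: two vertices `a`, `b` and
three smoothly immersed Legendrian edges from `a` to `b`, parametrised by `[0, 1]`, which together
are embedded, and no two of which have the same outward tangent direction at a vertex. -/
structure LegendrianThetaGraph where
  /-- the first vertex -/
  a : R3
  /-- the second vertex -/
  b : R3
  /-- the three edges; only the values on `[0, 1]` (and the derivatives there) matter -/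
  edge : Fin 3 → ℝ → R3
  smooth : ∀ i, ContDiff ℝ ∞ (edge i)
  edge_zero : ∀ i, edge i 0 = a
  edge_one : ∀ i, edge i 1 = b
  immersed : ∀ i, ∀ t ∈ Set.Icc (0 : ℝ) 1, deriv (edge i) t ≠ 0
  legendrian : ∀ i, ∀ t ∈ Set.Icc (0 : ℝ) 1, contactForm (edge i t) (deriv (edge i) t) = 0
  embedded : ∀ i j, ∀ s ∈ Set.Icc (0 : ℝ) 1, ∀ t ∈ Set.Icc (0 : ℝ) 1, edge i s = edge j t →
    (i = j ∧ s = t) ∨ (s = 0 ∧ t = 0) ∨ (s = 1 ∧ t = 1)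
  not_tangent_a : ∀ i j, i ≠ j → ¬ SameRay ℝ (deriv (edge i) 0) (deriv (edge j) 0)
  not_tangent_b : ∀ i j, i ≠ j → ¬ SameRay ℝ (deriv (edge i) 1) (deriv (edge j) 1)

namespace LegendrianThetaGraph

/-- The front projection (the projection to the `xz`-plane) has the standard form near the two
vertices: the three strands leave `a` to the right and arrive at `b` from the left, and near `a`
the edges with indices `0`, `1`, `2` are, in this order, the top, the middle and the lower
strand. -/
structure IsStandardNearVertices (G : LegendrianThetaGraph) : Prop where
  right_of_a : ∀ i, 0 < deriv (G.edge i) 0 0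
  left_of_b : ∀ i, 0 < deriv (G.edge i) 1 0
  order_at_a : ∃ δ : ℝ, 0 < δ ∧ ∀ i j, i < j → ∀ s ∈ Set.Ioo 0 δ, ∀ t ∈ Set.Ioo 0 δ,
    G.edge i s 0 = G.edge j t 0 → G.edge j t 2 < G.edge i s 2

/-- The cycle which leaves `a` along the edge `i` and comes back to `a` along the edge `j`, as an
oriented closed curve parametrised by `[0, 2]`. -/
def cycle (G : LegendrianThetaGraph) (i j : Fin 3) (t : ℝ) : R3 :=
  if t ≤ 1 then G.edge i t else G.edge j (2 - t)

/-- The set of points of the cycle formed by the edges `i` and `j`. -/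
def cycleSet (G : LegendrianThetaGraph) (i j : Fin 3) : Set R3 :=
  G.cycle i j '' Set.Icc 0 2

/-- The push-off of the cycle by the amount `ε` in the direction of the vector field `∂/∂z`, which
is transverse to the contact structure. -/
def pushOff (G : LegendrianThetaGraph) (i j : Fin 3) (ε : ℝ) (t : ℝ) : R3 :=
  G.cycle i j t + ![0, 0, ε]

/-- The cycle formed by the edges `i` and `j` has Thurston–Bennequin number `n`: this is the
linking number of the cycle with a small push-off transverse to the contact structure. The push-off
is small if all the intermediate push-offs are disjoint from the cycle. -/
def HasTB (G : LegendrianThetaGraph) (i j : Fin 3) (n : ℤ) : Prop :=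
  ∃ ε : ℝ, 0 < ε ∧
    (∀ δ ∈ Set.Ioc 0 ε, ∀ s ∈ Set.Icc (0 : ℝ) 2, ∀ t ∈ Set.Icc (0 : ℝ) 2,
      G.cycle i j s ≠ G.pushOff i j δ t) ∧
    HasLinkingNumber 2 (G.cycle i j) (G.pushOff i j ε) n

/-- The cycle which leaves `a` along the edge `i` and comes back along the edge `j` has rotation
number `n`: this is the winding number of its oriented tangent vector with respect to the frame
`∂/∂y`, `-y ∂/∂z - ∂/∂x` of the contact structure. Here `φ` is a continuous angle of the tangent
vector along the edge `i` and `ψ` along the reversed edge `j`. At a vertex the tangent vector turns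
by the exterior angle of the corner in the contact plane, which lies strictly between `-π` and `π`
(it is what rounding the corner gives); on its return to `a` the angle has increased by `2πn`. -/
def HasRot (G : LegendrianThetaGraph) (i j : Fin 3) (n : ℤ) : Prop :=
  ∃ φ ψ : ℝ → ℝ, ContinuousOn φ (Set.Icc 0 1) ∧ ContinuousOn ψ (Set.Icc 0 1) ∧
    (∀ t ∈ Set.Icc (0 : ℝ) 1, HasContactAngle (G.edge i t) (deriv (G.edge i) t) (φ t)) ∧
    (∀ t ∈ Set.Icc (0 : ℝ) 1, HasContactAngle (G.edge j t) (-deriv (G.edge j) t) (ψ t)) ∧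
    |ψ 1 - φ 1| < Real.pi ∧ |φ 0 + 2 * Real.pi * n - ψ 0| < Real.pi

end LegendrianThetaGraph

/-- The edge along which the `k`-th cycle leaves the vertex `a`. The three cycles leave `a` and
come back to it along the first and second, the first and third, the second and third edge. -/
def outEdge : Fin 3 → Fin 3 := ![0, 0, 1]

/-- The edge along which the `k`-th cycle comes back to the vertex `a`. -/
def backEdge : Fin 3 → Fin 3 := ![1, 2, 2]

end

/-! All edges are built as ascending curves. A function y with transverse zeros is the y-coordinate
of the Legendrian curve with velocity (y, y', y²); its front has slope y and a cusp at each zero of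
y, and its height z increases strictly. Three such strands from a to b form a braid over the height.
Any two of them form an unknot, because horizontal planes can be translated, rotated and scaled
until the two strands are in standard position (`isUnknot_of_two_strands`).

The invariants become turning angles. Seen along a generic horizontal direction, a cycle can cross
its push-off only at equal heights. The linking number therefore counts the passages of the planar
displacements `gap` through that direction, and these are determined by the angles which the four
displacements sweep out (`IsTheta.hasLinkingNumber`). The rotation number is read off from the angle
of the planar velocity (y, y') (`IsTheta.hasRot`).

The strands leave a in a fan and become parallel straight lines y = 1, which differ by their lane,
the constant value of x - z. Then one strand at a time dips below y = 1, which changes its lane by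
the integral of y - y². A shallow dip moves it to the right and does not turn it. A deep dip, with y
< 0 at the bottom, moves it to the left while its velocity makes one negative full turn. The moving
strand has y < 1 and the others have y = 1, so every overtaking is a half turn of known sign.
Reversed fans finally join the strands at b.

Let N i be the number of negative turns of strand i, and m i j the signed number of half turns of i
and j around each other due to overtakings. Then tb = -1 - N i - N j - m i j, and rot = N j - N i,
less 1 if j ends to the left of i (`IsTower.exists_graph`). Put t = -1 - tb. Moving the last strand
to the front by a deep dip changes neither t nor rot (`IsRealized.rotate`), so only the cyclic order
of the lanes matters. Letting the first strand overtake the second raises t of this pair by 1,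
changes its rotation number by ±1 and reverses the cyclic order (`IsRealized.swap`). For the cyclic
order 0, 1, 2 the sum rot₁ - rot₂ + rot₃ is 0, for the other one it is -1. The hypotheses say that
each rot is reached by t unit steps; a greedy induction (`achieves`) finds an order of the
overtakings in which the two cyclic orders alternate. -/

open Set Filter Topology

/-! ### Angles of planar vectors and their continuous lifts -/

/-- `θ` is an angle of the non-zero planar vector `v`. -/
def HasAngle (v : ℂ) (θ : ℝ) : Prop :=
  ∃ r : ℝ, 0 < r ∧ v = r * Complex.exp (θ * Complex.I)

theorem HasAngle.ne_zero {v : ℂ} {θ : ℝ} (h : HasAngle v θ) : v ≠ 0 := by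
  obtain ⟨r, hr, rfl⟩ := h
  exact mul_ne_zero (by exact_mod_cast hr.ne') (Complex.exp_ne_zero _)

theorem hasAngle_arg {v : ℂ} (h : v ≠ 0) : HasAngle v v.arg :=
  ⟨‖v‖, norm_pos_iff.2 h, (Complex.norm_mul_exp_arg_mul_I v).symm⟩

theorem HasAngle.mul_exp {v : ℂ} {θ : ℝ} (h : HasAngle v θ) (φ : ℝ) :
    HasAngle (v * Complex.exp (φ * Complex.I)) (θ + φ) := by
  obtain ⟨r, hr, rfl⟩ := h
  refine ⟨r, hr, ?_⟩
  rw [mul_assoc, ← Complex.exp_add]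
  push_cast
  ring_nf

theorem HasAngle.add_int_mul_two_pi {v : ℂ} {θ : ℝ} (h : HasAngle v θ) (n : ℤ) :
    HasAngle v (θ + 2 * Real.pi * n) := by
  have := h.mul_exp (2 * Real.pi * n)
  have h1 : Complex.exp (((2 * Real.pi * n : ℝ) : ℂ) * Complex.I) = 1 := by
    rw [Complex.exp_eq_one_iff]
    exact ⟨n, by push_cast; ring⟩
  rwa [h1, mul_one] at this

theorem HasAngle.exists_int {v : ℂ} {θ θ' : ℝ} (h : HasAngle v θ) (h' : HasAngle v θ') :
    ∃ n : ℤ, θ' = θ + 2 * Real.pi * n := by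
  obtain ⟨r, hr, hv⟩ := h
  obtain ⟨r', hr', hv'⟩ := h'
  have hn : r = r' := by
    have h1 : ‖v‖ = r := by rw [hv]; simp [abs_of_pos hr]
    have h2 : ‖v‖ = r' := by rw [hv']; simp [abs_of_pos hr']
    rw [← h1, ← h2]
  have he : Complex.exp (θ' * Complex.I) = Complex.exp (θ * Complex.I) := by
    have hr0 : (r : ℂ) ≠ 0 := by exact_mod_cast hr.ne'
    apply mul_left_cancel₀ hr0
    rw [← hv, hv', hn]
  obtain ⟨n, hn⟩ := Complex.exp_eq_exp_iff_exists_int.1 he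
  refine ⟨n, ?_⟩
  have := congrArg Complex.im hn
  simpa [mul_comm] using this

theorem HasAngle.eq_of_abs_lt {v : ℂ} {θ θ' : ℝ} (h : HasAngle v θ) (h' : HasAngle v θ')
    (hlt : |θ' - θ| < 2 * Real.pi) : θ' = θ := by
  obtain ⟨n, hn⟩ := h.exists_int h'
  have : n = 0 := by
    by_contra hne
    have h1 : (1 : ℝ) ≤ |(n : ℝ)| := by exact_mod_cast Int.one_le_abs hne
    have h2 : |θ' - θ| = 2 * Real.pi * |(n : ℝ)| := by
      rw [hn, add_sub_cancel_left, abs_mul, abs_of_pos Real.two_pi_pos]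
    nlinarith [Real.pi_pos]
  simp [hn, this]

theorem HasAngle.arg_eq {v : ℂ} {θ : ℝ} (h : HasAngle v θ) (h1 : -Real.pi < θ)
    (h2 : θ ≤ Real.pi) : v.arg = θ := by
  refine h.eq_of_abs_lt (hasAngle_arg h.ne_zero) ?_
  have := Complex.neg_pi_lt_arg v
  have := Complex.arg_le_pi v
  rw [abs_lt]
  constructor <;> linarith

theorem HasAngle.re_eq {v : ℂ} {θ : ℝ} (h : HasAngle v θ) :
    ∃ r : ℝ, 0 < r ∧ v.re = r * Real.cos θ ∧ v.im = r * Real.sin θ := by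
  obtain ⟨r, hr, rfl⟩ := h
  refine ⟨r, hr, ?_, ?_⟩
  · simp [Complex.exp_ofReal_mul_I_re]
  · simp [Complex.exp_ofReal_mul_I_im]

theorem hasAngle_iff {v : ℂ} {θ : ℝ} :
    HasAngle v θ ↔ ∃ r : ℝ, 0 < r ∧ v.re = r * Real.cos θ ∧ v.im = r * Real.sin θ := by
  refine ⟨fun h => h.re_eq, ?_⟩
  rintro ⟨r, hr, h1, h2⟩
  refine ⟨r, hr, Complex.ext ?_ ?_⟩
  · simp [Complex.exp_ofReal_mul_I_re, h1]
  · simp [Complex.exp_ofReal_mul_I_im, h2]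

/-- A non-zero vector of the closed half plane to the left of the direction `c` has an angle in
`[c, c + π]`. -/
theorem exists_hasAngle_mem {v : ℂ} (hv : v ≠ 0) (c : ℝ)
    (h : 0 ≤ (v * Complex.exp ((-c : ℝ) * Complex.I)).im) :
    ∃ θ ∈ Icc c (c + Real.pi), HasAngle v θ := by
  set w := v * Complex.exp ((-c : ℝ) * Complex.I) with hw
  have hw0 : w ≠ 0 := mul_ne_zero hv (Complex.exp_ne_zero _)
  refine ⟨w.arg + c, ⟨by linarith [Complex.arg_nonneg_iff.2 h],
    by linarith [Complex.arg_le_pi w]⟩, ?_⟩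
  have := (hasAngle_arg hw0).mul_exp c
  have h1 : w * Complex.exp (c * Complex.I) = v := by
    rw [hw, mul_assoc, ← Complex.exp_add]
    simp
  rwa [h1] at this

/-- The path `P` of non-zero planar vectors, defined on `[α, β]`, has a continuous angle which
starts at `θ₀` and ends at `θ₁`. -/
def HasLift (P : ℝ → ℂ) (α β θ₀ θ₁ : ℝ) : Prop :=
  ∃ Θ : ℝ → ℝ, ContinuousOn Θ (Icc α β) ∧ Θ α = θ₀ ∧ Θ β = θ₁ ∧
    ∀ h ∈ Icc α β, HasAngle (P h) (Θ h)

namespace HasLift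

variable {P Q : ℝ → ℂ} {α β γ θ₀ θ₁ θ₂ : ℝ}

theorem ne_zero (h : HasLift P α β θ₀ θ₁) {t : ℝ} (ht : t ∈ Icc α β) : P t ≠ 0 := by
  obtain ⟨Θ, -, -, -, h⟩ := h
  exact (h t ht).ne_zero

theorem hasAngle_right (h : HasLift P α β θ₀ θ₁) (hαβ : α ≤ β) : HasAngle (P β) θ₁ := by
  obtain ⟨Θ, -, -, h1, h⟩ := h
  exact h1 ▸ h β ⟨hαβ, le_rfl⟩

theorem congr (h : HasLift P α β θ₀ θ₁) (hPQ : ∀ t ∈ Icc α β, P t = Q t) :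
    HasLift Q α β θ₀ θ₁ := by
  obtain ⟨Θ, h1, h2, h3, h4⟩ := h
  exact ⟨Θ, h1, h2, h3, fun t ht => hPQ t ht ▸ h4 t ht⟩

theorem trans (h : HasLift P α β θ₀ θ₁) (h' : HasLift P β γ θ₁ θ₂) (hαβ : α ≤ β) (hβγ : β ≤ γ) :
    HasLift P α γ θ₀ θ₂ := by
  obtain ⟨Θ, h1, h2, h3, h4⟩ := h
  obtain ⟨Θ', h1', h2', h3', h4'⟩ := h'
  refine ⟨fun t => if t ≤ β then Θ t else Θ' t, ?_, by simp [hαβ, h2], ?_, ?_⟩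
  · rw [← Icc_union_Icc_eq_Icc hαβ hβγ]
    apply ContinuousOn.union_of_isClosed _ _ isClosed_Icc isClosed_Icc
    · exact h1.congr fun t ht => if_pos ht.2
    · refine h1'.congr fun t ht => ?_
      rcases ht.1.eq_or_lt with rfl | hlt
      · simp [h3, h2']
      · simp [not_le.2 hlt]
  · rcases hβγ.eq_or_lt with rfl | hlt
    · simp [h3, ← h2', h3']
    · simp [not_le.2 hlt, h3']
  · intro t ht
    by_cases htβ : t ≤ β
    · simpa [htβ] using h4 t ⟨ht.1, htβ⟩
    · simpa [htβ] using h4' t ⟨(not_le.1 htβ).le, ht.2⟩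

theorem add_int_mul_two_pi (h : HasLift P α β θ₀ θ₁) (n : ℤ) :
    HasLift P α β (θ₀ + 2 * Real.pi * n) (θ₁ + 2 * Real.pi * n) := by
  obtain ⟨Θ, h1, h2, h3, h4⟩ := h
  exact ⟨fun t => Θ t + 2 * Real.pi * n, h1.add continuousOn_const, by simp [h2], by simp [h3],
    fun t ht => (h4 t ht).add_int_mul_two_pi n⟩

theorem comp_sub (h : HasLift P α β θ₀ θ₁) (c : ℝ) :
    HasLift (fun t => P (t - c)) (c + α) (c + β) θ₀ θ₁ := by
  obtain ⟨Θ, h1, h2, h3, h4⟩ := h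
  refine ⟨fun t => Θ (t - c), ?_, by simp [h2], by simp [h3], fun t ht => h4 _ ?_⟩
  · refine h1.comp (by fun_prop) fun t ht => ?_
    constructor <;> linarith [ht.1, ht.2]
  · constructor <;> linarith [ht.1, ht.2]

/-- A path in a closed half plane. -/
theorem of_halfPlane (hP : ContinuousOn P (Icc α β)) (c : ℝ)
    (h0 : ∀ t ∈ Icc α β, P t ≠ 0)
    (him : ∀ t ∈ Icc α β, 0 ≤ (P t * Complex.exp ((-c : ℝ) * Complex.I)).im)
    (hα : HasAngle (P α) θ₀) (hβ : HasAngle (P β) θ₁)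
    (hθ₀ : θ₀ ∈ Icc c (c + Real.pi)) (hθ₁ : θ₁ ∈ Icc c (c + Real.pi)) :
    HasLift P α β θ₀ θ₁ := by
  set w : ℝ → ℂ := fun t => P t * Complex.exp ((-c : ℝ) * Complex.I) with hw
  have hw0 : ∀ t ∈ Icc α β, w t ≠ 0 := fun t ht => mul_ne_zero (h0 t ht) (Complex.exp_ne_zero _)
  have key : ∀ t θ, HasAngle (P t) θ → θ ∈ Icc c (c + Real.pi) → (w t).arg + c = θ := by
    intro t θ h hθ
    have := (h.mul_exp (-c)).arg_eq (by linarith [hθ.1, Real.pi_pos]) (by linarith [hθ.2])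
    simp only [hw]
    linarith
  refine ⟨fun t => (w t).arg + c, ?_, key _ _ hα hθ₀, key _ _ hβ hθ₁, fun t ht => ?_⟩
  · refine ContinuousOn.add ?_ continuousOn_const
    have hwc : ContinuousOn w (Icc α β) := hP.mul continuousOn_const
    intro t ht
    -- The principal argument is continuous from above at the negative real axis, so the closed half
    -- plane without 0 is admissible.
    have harg : ContinuousWithinAt Complex.arg {z : ℂ | 0 ≤ z.im} (w t) := by
      by_cases hs : w t ∈ Complex.slitPlane
      · exact (Complex.continuousAt_arg hs).continuousWithinAt
      · rw [Complex.mem_slitPlane_iff] at hs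
        push Not at hs
        refine Complex.continuousWithinAt_arg_of_re_neg_of_im_zero ?_ hs.2
        refine lt_of_le_of_ne hs.1 fun h => hw0 t ht (Complex.ext h hs.2)
    exact harg.comp (hwc t ht) fun s hs => him s hs
  · have := (hasAngle_arg (hw0 t ht)).mul_exp c
    have h1 : w t * Complex.exp (c * Complex.I) = P t := by
      simp only [hw]
      rw [mul_assoc, ← Complex.exp_add]
      simp
    rwa [h1] at this

end HasLift

/-- Near h the lift is Θ h plus the imaginary part of log (P t / P h): the quotient is close to 1,
and continuity of Θ excludes a jump by a multiple of 2π. -/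
theorem HasAngle.hasDerivAt_lift {P : ℝ → ℂ} {Θ : ℝ → ℝ} {h : ℝ} {P' : ℂ}
    (hP : HasDerivAt P P' h) (hΘ : ContinuousAt Θ h)
    (hang : ∀ᶠ t in 𝓝 h, HasAngle (P t) (Θ t)) :
    HasDerivAt Θ (P' / P h).im h := by
  have h0 : P h ≠ 0 := hang.self_of_nhds.ne_zero
  have hd : HasDerivAt (fun t => P t / P h) (P' / P h) h := hP.div_const _
  have hlog : HasDerivAt (fun t => Complex.log (P t / P h)) (P' / P h / (P h / P h)) h :=
    hd.clog_real (by rw [div_self h0]; exact Complex.one_mem_slitPlane)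
  rw [div_self h0, div_one] at hlog
  have him : HasDerivAt (fun t => (Complex.log (P t / P h)).im) (P' / P h).im h := by
    exact Complex.imCLM.hasFDerivAt.comp_hasDerivAt h hlog
  have : HasDerivAt (fun t => (Complex.log (P t / P h)).im + Θ h) (P' / P h).im h :=
    him.add_const _
  refine this.congr_of_eventuallyEq ?_
  have hnear : ∀ᶠ t in 𝓝 h, |Θ t - Θ h| < Real.pi := by
    have := (hΘ.sub continuousAt_const).abs.eventually
      (gt_mem_nhds (by simpa using Real.pi_pos : |Θ h - Θ h| < Real.pi))
    simpa using this
  filter_upwards [hang, hnear] with t ht hnt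
  obtain ⟨r, hr, hv⟩ := ht
  obtain ⟨s, hs, hv'⟩ := hang.self_of_nhds
  have hq : HasAngle (P t / P h) (Θ t - Θ h) := by
    refine ⟨r / s, div_pos hr hs, ?_⟩
    rw [hv, hv']
    push_cast
    rw [sub_mul, Complex.exp_sub]
    have := Complex.exp_ne_zero (Θ h * Complex.I)
    have : (s : ℂ) ≠ 0 := by exact_mod_cast hs.ne'
    field_simp
  rw [abs_lt] at hnt
  rw [Complex.log_im, hq.arg_eq hnt.1 hnt.2.le]
  ring

/-! ### Counting crossings with sign -/

theorem floor_eq_of_forall_ne_int {f : ℝ → ℝ} {a b : ℝ} (hab : a ≤ b)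
    (hf : ContinuousOn f (Icc a b)) (h : ∀ t ∈ Icc a b, ∀ n : ℤ, f t ≠ n) : ⌊f a⌋ = ⌊f b⌋ := by
  by_contra hne
  rcases lt_or_gt_of_ne hne with hlt | hlt
  · have h1 : f a ≤ ⌊f b⌋ := by
      have : (⌊f a⌋ : ℝ) + 1 ≤ ⌊f b⌋ := by exact_mod_cast hlt
      linarith [Int.lt_floor_add_one (f a)]
    obtain ⟨t, ht, hft⟩ := intermediate_value_Icc hab hf ⟨h1, Int.floor_le (f b)⟩
    exact h t ht _ hft
  · have h1 : f b ≤ ⌊f a⌋ := by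
      have : (⌊f b⌋ : ℝ) + 1 ≤ ⌊f a⌋ := by exact_mod_cast hlt
      linarith [Int.lt_floor_add_one (f b)]
    obtain ⟨t, ht, hft⟩ := intermediate_value_Icc' hab hf ⟨h1, Int.floor_le (f a)⟩
    exact h t ht _ hft

/-- Near a transverse passage through an integer the floor jumps by the sign of the derivative. -/
theorem floor_sub_floor_near {f : ℝ → ℝ} {p : ℝ} {n : ℤ} (hp : f p = n)
    (hd : DifferentiableAt ℝ f p) (h0 : deriv f p ≠ 0) :
    ∃ δ > 0, ∀ a ∈ Ioo (p - δ) p, ∀ b ∈ Ioo p (p + δ), (∀ m : ℤ, f b ≠ m) ∧ (∀ m : ℤ, f a ≠ m) ∧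
      ⌊f b⌋ - ⌊f a⌋ = (SignType.sign (deriv f p) : ℤ) := by
  have hnear : ∀ᶠ t in 𝓝[≠] p, |f t - n| < 1 := by
    have := (hd.continuousAt.sub continuousAt_const).abs.eventually
      (gt_mem_nhds (by simp [hp] : |f p - n| < 1))
    exact this.filter_mono nhdsWithin_le_nhds
  have hslope := hd.hasDerivAt.tendsto_slope
  rcases lt_or_gt_of_ne h0 with hneg | hpos
  · have hs : ∀ᶠ t in 𝓝[≠] p, slope f p t < 0 := hslope.eventually (gt_mem_nhds hneg)
    obtain ⟨δ, hδ, H⟩ := Metric.eventually_nhds_iff.1 (eventually_nhdsWithin_iff.1 (hnear.and hs))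
    refine ⟨δ, hδ, fun a ha b hb => ?_⟩
    have Ha := H (y := a) (by rw [Real.dist_eq, abs_lt]; constructor <;> linarith [ha.1, ha.2])
      (ne_of_lt ha.2)
    have Hb := H (y := b) (by rw [Real.dist_eq, abs_lt]; constructor <;> linarith [hb.1, hb.2])
      (ne_of_gt hb.1)
    rw [slope_def_field, hp, abs_lt] at Ha Hb
    have ha' : 0 < f a - n := by
      rcases div_neg_iff.1 Ha.2 with h | h
      · exact h.1
      · linarith [h.2, ha.2]
    have hb' : f b - n < 0 := by
      rcases div_neg_iff.1 Hb.2 with h | h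
      · linarith [h.2, hb.1]
      · exact h.1
    have fa : ⌊f a⌋ = n := by rw [Int.floor_eq_iff]; constructor <;> linarith [Ha.1.2]
    have fb : ⌊f b⌋ = n - 1 := by
      rw [Int.floor_eq_iff]; push_cast; constructor <;> linarith [Hb.1.1]
    refine ⟨fun m hm => ?_, fun m hm => ?_, ?_⟩
    · rw [hm, Int.floor_intCast] at fb
      rw [hm, fb] at Hb; push_cast at Hb; linarith [Hb.1.1]
    · rw [hm, Int.floor_intCast] at fa
      rw [hm, fa] at ha'; linarith
    · rw [fa, fb, sign_neg hneg]; simp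
  · have hs : ∀ᶠ t in 𝓝[≠] p, 0 < slope f p t := hslope.eventually (lt_mem_nhds hpos)
    obtain ⟨δ, hδ, H⟩ := Metric.eventually_nhds_iff.1 (eventually_nhdsWithin_iff.1 (hnear.and hs))
    refine ⟨δ, hδ, fun a ha b hb => ?_⟩
    have Ha := H (y := a) (by rw [Real.dist_eq, abs_lt]; constructor <;> linarith [ha.1, ha.2])
      (ne_of_lt ha.2)
    have Hb := H (y := b) (by rw [Real.dist_eq, abs_lt]; constructor <;> linarith [hb.1, hb.2])
      (ne_of_gt hb.1)
    rw [slope_def_field, hp, abs_lt] at Ha Hb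
    have ha' : f a - n < 0 := by
      rcases div_pos_iff.1 Ha.2 with h | h
      · linarith [h.2, ha.2]
      · exact h.1
    have hb' : 0 < f b - n := by
      rcases div_pos_iff.1 Hb.2 with h | h
      · exact h.1
      · linarith [h.2, hb.1]
    have fb : ⌊f b⌋ = n := by rw [Int.floor_eq_iff]; constructor <;> linarith [Hb.1.2]
    have fa : ⌊f a⌋ = n - 1 := by
      rw [Int.floor_eq_iff]; push_cast; constructor <;> linarith [Ha.1.1]
    refine ⟨fun m hm => ?_, fun m hm => ?_, ?_⟩
    · rw [hm, Int.floor_intCast] at fb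
      rw [hm, fb] at hb'; linarith
    · rw [hm, Int.floor_intCast] at fa
      rw [hm, fa] at Ha; push_cast at Ha; linarith [Ha.1.1]
    · rw [fa, fb, sign_pos hpos]; simp

/-- The floor is constant between integer points of f and jumps by the sign of the derivative at
each of them. The induction removes the largest such point. -/
theorem sum_sign_deriv_eq_floor_sub_floor {f : ℝ → ℝ} {α β : ℝ} (hαβ : α ≤ β)
    (hf : ContinuousOn f (Icc α β)) (C : Finset ℝ)
    (hC : ∀ t ∈ Icc α β, t ∈ C ↔ ∃ n : ℤ, f t = n)
    (hreg : ∀ t ∈ C, t ∈ Ioo α β ∧ DifferentiableAt ℝ f t ∧ deriv f t ≠ 0) :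
    ∑ t ∈ C, (SignType.sign (deriv f t) : ℤ) = ⌊f β⌋ - ⌊f α⌋ := by
  induction hn : C.card generalizing C β with
  | zero =>
    have hC0 : C = ∅ := Finset.card_eq_zero.1 hn
    subst hC0
    rw [floor_eq_of_forall_ne_int hαβ hf fun t ht n hn => by simpa using (hC t ht).2 ⟨n, hn⟩]
    simp
  | succ k ih =>
    have hne : C.Nonempty := Finset.card_pos.1 (by omega)
    set p := C.max' hne with hp
    have hpC : p ∈ C := C.max'_mem hne
    obtain ⟨hpI, hpd, hp0⟩ := hreg p hpC
    obtain ⟨n, hpn⟩ := (hC p ⟨hpI.1.le, hpI.2.le⟩).1 hpC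
    obtain ⟨δ, hδ, H⟩ := floor_sub_floor_near hpn hpd hp0
    -- L separates the remaining points from p, so that the induction hypothesis applies on an
    -- interval which ends between L and p.
    obtain ⟨L, hL1, hL2⟩ : ∃ L, (∀ t ∈ C.erase p, t < L) ∧ α ≤ L ∧ L < p := by
      rcases (C.erase p).eq_empty_or_nonempty with he | he
      · exact ⟨α, by simp [he], le_rfl, hpI.1⟩
      · have hm := (C.erase p).max'_mem he
        have hlt : (C.erase p).max' he < p :=
          lt_of_le_of_ne (C.le_max' _ (Finset.mem_of_mem_erase hm)) (Finset.ne_of_mem_erase hm)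
        refine ⟨((C.erase p).max' he + p) / 2, fun t ht => ?_, ?_, by linarith⟩
        · linarith [(C.erase p).le_max' t ht]
        · linarith [(hreg _ (Finset.mem_of_mem_erase hm)).1.1]
    obtain ⟨a, ha1, ha2⟩ := exists_between (max_lt hL2.2 (by linarith : p - δ < p))
    obtain ⟨b, hb1, hb2⟩ := exists_between (lt_min hpI.2 (by linarith : p < p + δ))
    rw [max_lt_iff] at ha1
    rw [lt_min_iff] at hb2
    obtain ⟨Hb, Ha, Hs⟩ := H a ⟨ha1.2, ha2⟩ b ⟨hb1, hb2.2⟩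
    have hbβ : ⌊f b⌋ = ⌊f β⌋ := by
      refine floor_eq_of_forall_ne_int hb2.1.le
        (hf.mono (Icc_subset_Icc (by linarith [hpI.1]) le_rfl)) fun t ht m hm => ?_
      have : t ∈ C := (hC t ⟨by linarith [hpI.1, ht.1], ht.2⟩).2 ⟨m, hm⟩
      linarith [C.le_max' t this, ht.1]
    have haα : α ≤ a := by linarith
    have := ih haα (hf.mono (Icc_subset_Icc le_rfl (by linarith [hpI.2]))) (C.erase p)
      (fun t ht => by
        rw [Finset.mem_erase, hC t ⟨ht.1, by linarith [ht.2, hpI.2]⟩]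
        exact and_iff_right (by linarith [ht.2] : t < p).ne)
      (fun t ht => by
        obtain ⟨h1, h2⟩ := hreg t (Finset.mem_of_mem_erase ht)
        exact ⟨⟨h1.1, by linarith [hL1 t ht]⟩, h2⟩)
      (by rw [Finset.card_erase_of_mem hpC]; omega)
    rw [← Finset.add_sum_erase C _ hpC, this, ← Hs, hbβ]
    ring

/-- An accumulation point of integer points would be an integer point itself, but transversality
makes these isolated. -/
theorem finite_int_values {f : ℝ → ℝ} {α β : ℝ} (hf : ContinuousOn f (Icc α β))
    (hreg : ∀ t ∈ Icc α β, (∃ n : ℤ, f t = n) → DifferentiableAt ℝ f t ∧ deriv f t ≠ 0) :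
    {t ∈ Icc α β | ∃ n : ℤ, f t = n}.Finite := by
  by_contra hinf
  obtain ⟨p, hp, hacc⟩ := Set.Infinite.exists_accPt_of_subset_isCompact (K := Icc α β) hinf
    isCompact_Icc (fun t ht => ht.1)
  have hcl : IsClosed {t ∈ Icc α β | ∃ n : ℤ, f t = n} := by
    have hZ : IsClosed (range ((↑) : ℤ → ℝ)) := Int.isClosedEmbedding_coe_real.isClosed_range
    have := hf.preimage_isClosed_of_isClosed isClosed_Icc hZ
    convert this using 1
    ext t
    simp [eq_comm]
  obtain ⟨-, n, hn⟩ := hcl.closure_eq ▸ (mem_closure_iff_clusterPt.2 hacc.clusterPt)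
  obtain ⟨hd, h0⟩ := hreg p hp ⟨n, hn⟩
  obtain ⟨δ, hδ, H⟩ := floor_sub_floor_near hn hd h0
  rw [accPt_iff_nhds] at hacc
  obtain ⟨t, ⟨ht, htI, m, hm⟩, htp⟩ := hacc (Ioo (p - δ) (p + δ))
    (Ioo_mem_nhds (by linarith) (by linarith))
  rcases lt_or_gt_of_ne htp with h | h
  · exact (H t ⟨ht.1, h⟩ (p + δ / 2) ⟨by linarith, by linarith⟩).2.1 m hm
  · exact (H (p - δ / 2) ⟨by linarith, by linarith⟩ t ⟨h, ht.2⟩).1 m hm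

/-- One-dimensional Sard: a generic translation makes finitely many functions pass through the
integers transversally, away from finite exceptional sets. -/
theorem exists_generic_translation {ι : Type*} [Finite ι] (f : ι → ℝ → ℝ) (I F : ι → Set ℝ)
    (hF : ∀ i, (F i).Countable) (hd : ∀ i, ∀ t ∈ I i \ F i, DifferentiableAt ℝ (f i) t) :
    ∃ c : ℝ, ∀ i, ∀ t ∈ I i, (∃ n : ℤ, f i t - c = n) →
      t ∉ F i ∧ DifferentiableAt ℝ (f i) t ∧ deriv (f i) t ≠ 0 := by
  let bad : Set ℝ := ⋃ i, ⋃ n : ℤ, (fun v => v - (n : ℝ)) ''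
    (f i '' F i ∪ f i '' {t | DifferentiableAt ℝ (f i) t ∧ deriv (f i) t = 0})
  have hbad : MeasureTheory.volume bad = 0 := by
    refine MeasureTheory.measure_iUnion_null fun i => MeasureTheory.measure_iUnion_null fun n => ?_
    have h1 : MeasureTheory.volume (f i '' F i) = 0 := ((hF i).image _).measure_zero _
    have h2 : MeasureTheory.volume
        (f i '' {t | DifferentiableAt ℝ (f i) t ∧ deriv (f i) t = 0}) = 0 := by
      refine MeasureTheory.addHaar_image_eq_zero_of_det_fderivWithin_eq_zero _
        (f' := fun _ => 0) (fun t ht => ?_) (fun t ht => by simp)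
      have := ht.1.hasDerivAt
      rw [ht.2] at this
      have h3 := this.hasFDerivAt.hasFDerivWithinAt
        (s := {t | DifferentiableAt ℝ (f i) t ∧ deriv (f i) t = 0})
      have h4 : ContinuousLinearMap.toSpanSingleton ℝ (0 : ℝ) = 0 := by ext; simp
      rwa [h4] at h3
    have h3 := MeasureTheory.measure_union_null h1 h2
    have : (fun v : ℝ => v - (n : ℝ)) = fun v => v + (-(n : ℝ)) := by
      ext; ring
    rw [this, Set.image_add_right]
    rw [MeasureTheory.measure_preimage_add_right]
    exact h3
  obtain ⟨c, hc⟩ : ∃ c, c ∉ bad := by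
    by_contra hall
    push Not at hall
    have : bad = univ := eq_univ_of_forall hall
    rw [this] at hbad
    simp at hbad
  refine ⟨c, fun i t ht ⟨n, hn⟩ => ?_⟩
  have hcn : ∀ S : Set ℝ, S ⊆ F i ∪ {t | DifferentiableAt ℝ (f i) t ∧ deriv (f i) t = 0} →
      t ∉ S := by
    intro S hS htS
    apply hc
    refine mem_iUnion.2 ⟨i, mem_iUnion.2 ⟨n, ⟨f i t, ?_, by linarith⟩⟩⟩
    rcases hS htS with h | h
    · exact Or.inl ⟨t, h, rfl⟩
    · exact Or.inr ⟨t, h, rfl⟩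
  have h1 : t ∉ F i := hcn _ subset_union_left
  have h2 := hcn _ subset_union_right
  have h3 := hd i t ⟨ht, h1⟩
  exact ⟨h1, h3, fun h => h2 ⟨h3, h⟩⟩

/-! ### Ascending Legendrian strands

A smooth function `y` with transverse zeros determines the Legendrian curve with velocity
`(y, y', y ^ 2)`. Its height is strictly increasing. -/

/-- The `x`-coordinate of the strand determined by `y`. -/
noncomputable def xInt (y : ℝ → ℝ) (s : ℝ) : ℝ := ∫ u in (0 : ℝ)..s, y u

/-- The `z`-coordinate of the strand determined by `y`. -/
noncomputable def zInt (y : ℝ → ℝ) (s : ℝ) : ℝ := ∫ u in (0 : ℝ)..s, y u ^ 2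

/-- The parameter at which the strand determined by `y` reaches the height `h`. -/
noncomputable def level (y : ℝ → ℝ) (h : ℝ) : ℝ := Function.invFun (zInt y) h

/-- The position, in the `xy`-plane, of the strand determined by `y` at the height `h`. -/
noncomputable def pos (y : ℝ → ℝ) (h : ℝ) : ℂ := ⟨xInt y (level y h), y (level y h)⟩

/-- `y` has transverse zeros, and is bounded from below far away. -/
structure IsStrand (y : ℝ → ℝ) : Prop where
  smooth : ContDiff ℝ ∞ y
  regular : ∀ s, y s = 0 → deriv y s ≠ 0
  away : ∃ R, ∀ s, R ≤ |s| → 1 / 4 ≤ y s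

@[simp] theorem xInt_zero (y : ℝ → ℝ) : xInt y 0 = 0 := by simp [xInt]

@[simp] theorem zInt_zero (y : ℝ → ℝ) : zInt y 0 = 0 := by simp [zInt]

theorem hasDerivAt_xInt {y : ℝ → ℝ} (hy : Continuous y) (s : ℝ) :
    HasDerivAt (xInt y) (y s) s :=
  intervalIntegral.integral_hasDerivAt_right (hy.intervalIntegrable _ _)
    (hy.stronglyMeasurableAtFilter _ _) hy.continuousAt

theorem hasDerivAt_zInt {y : ℝ → ℝ} (hy : Continuous y) (s : ℝ) :
    HasDerivAt (zInt y) (y s ^ 2) s :=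
  hasDerivAt_xInt (hy.pow 2) s

theorem contDiff_xInt {y : ℝ → ℝ} (hy : ContDiff ℝ ∞ y) : ContDiff ℝ ∞ (xInt y) := by
  rw [contDiff_infty_iff_deriv]
  refine ⟨fun s => (hasDerivAt_xInt hy.continuous s).differentiableAt, ?_⟩
  rwa [show deriv (xInt y) = y from funext fun s => (hasDerivAt_xInt hy.continuous s).deriv]

theorem contDiff_zInt {y : ℝ → ℝ} (hy : ContDiff ℝ ∞ y) : ContDiff ℝ ∞ (zInt y) :=
  contDiff_xInt (hy.pow 2)

theorem monotone_zInt {y : ℝ → ℝ} (hy : Continuous y) : Monotone (zInt y) :=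
  monotone_of_deriv_nonneg (fun s => (hasDerivAt_zInt hy s).differentiableAt) fun s => by
    rw [(hasDerivAt_zInt hy s).deriv]; positivity

theorem xInt_sub_eq {y : ℝ → ℝ} (hy : Continuous y) (a b : ℝ) :
    xInt y b - xInt y a = ∫ u in a..b, y u :=
  intervalIntegral.integral_interval_sub_left (hy.intervalIntegrable _ _)
    (hy.intervalIntegrable _ _)

namespace IsStrand

variable {y : ℝ → ℝ} (hy : IsStrand y)
include hy

theorem continuous : Continuous y := hy.smooth.continuous

theorem differentiable : Differentiable ℝ y := hy.smooth.differentiable (by simp)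

theorem continuous_deriv : Continuous (deriv y) := hy.smooth.continuous_deriv (by simp)

/-- The vertical speed y² vanishes at cusps. If the height were constant on an interval, however, y
would vanish there together with its derivative, against transversality. -/
theorem strictMono_zInt : StrictMono (zInt y) := by
  have hmono := monotone_zInt hy.continuous
  refine hmono.strictMono_of_injective fun a b hab => ?_
  by_contra hne
  wlog hlt : a < b generalizing a b
  · exact this b a hab.symm (Ne.symm hne) (lt_of_le_of_ne (not_lt.1 hlt) (Ne.symm hne))
  have hconst : ∀ t ∈ Ioo a b, y t = 0 := by
    intro t ht
    have : zInt y =ᶠ[𝓝 t] fun _ => zInt y a := by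
      filter_upwards [Ioo_mem_nhds ht.1 ht.2] with u hu
      exact le_antisymm (hab ▸ hmono hu.2.le) (hmono hu.1.le)
    have h1 := this.deriv_eq
    rw [(hasDerivAt_zInt hy.continuous t).deriv, deriv_const] at h1
    exact pow_eq_zero_iff (two_ne_zero) |>.1 h1
  have hm : (a + b) / 2 ∈ Ioo a b := ⟨by linarith, by linarith⟩
  refine hy.regular _ (hconst _ hm) ?_
  have : y =ᶠ[𝓝 ((a + b) / 2)] fun _ => 0 := by
    filter_upwards [Ioo_mem_nhds hm.1 hm.2] with u hu using hconst u hu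
  rw [this.deriv_eq, deriv_const]

/-- Far away y ≥ 1/4, so the height grows there at least with speed 1/16. -/
theorem surjective_zInt : Function.Surjective (zInt y) := by
  obtain ⟨R, hR⟩ := hy.away
  have hc : Continuous (zInt y) := (contDiff_zInt hy.smooth).continuous
  have hd : ∀ s, HasDerivAt (fun s => zInt y s - s / 16) (y s ^ 2 - 1 / 16) s := fun s =>
    (hasDerivAt_zInt hy.continuous s).sub ((hasDerivAt_id s).div_const 16)
  have hdc : Continuous fun s => zInt y s - s / 16 := by fun_prop
  have hnn : ∀ s, R ≤ |s| → 0 ≤ y s ^ 2 - 1 / 16 := fun s hs => by nlinarith [hR s hs]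
  have h1 : MonotoneOn (fun s => zInt y s - s / 16) (Ici |R|) := by
    refine monotoneOn_of_deriv_nonneg (convex_Ici _) hdc.continuousOn
      (fun s _ => (hd s).differentiableAt.differentiableWithinAt) fun s hs => ?_
    rw [interior_Ici] at hs
    rw [(hd s).deriv]
    exact hnn s (by linarith [le_abs_self s, le_abs_self R, mem_Ioi.1 hs])
  have h2 : MonotoneOn (fun s => zInt y s - s / 16) (Iic (-|R|)) := by
    refine monotoneOn_of_deriv_nonneg (convex_Iic _) hdc.continuousOn
      (fun s _ => (hd s).differentiableAt.differentiableWithinAt) fun s hs => ?_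
    rw [interior_Iic] at hs
    rw [(hd s).deriv]
    exact hnn s (by linarith [neg_abs_le s, le_abs_self R, mem_Iio.1 hs])
  refine hc.surjective ?_ ?_
  · have : Tendsto (fun s => s / 16 + (zInt y |R| - |R| / 16)) atTop atTop :=
      tendsto_atTop_add_const_right _ _ (tendsto_id.atTop_div_const (by norm_num))
    refine tendsto_atTop_mono' _ ?_ this
    filter_upwards [eventually_ge_atTop |R|] with s hs
    have := h1 (mem_Ici.2 le_rfl) hs hs
    simp only at this
    linarith
  · have : Tendsto (fun s => s / 16 + (zInt y (-|R|) - (-|R|) / 16)) atBot atBot :=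
      tendsto_atBot_add_const_right _ _ (tendsto_id.atBot_div_const (by norm_num))
    refine tendsto_atBot_mono' _ ?_ this
    filter_upwards [eventually_le_atBot (-|R|)] with s hs
    have := h2 hs (mem_Iic.2 le_rfl) hs
    simp only at this
    linarith

theorem level_zInt (s : ℝ) : level y (zInt y s) = s :=
  Function.leftInverse_invFun hy.strictMono_zInt.injective s

theorem zInt_level (h : ℝ) : zInt y (level y h) = h :=
  Function.rightInverse_invFun hy.surjective_zInt h

theorem level_eq_iff {h s : ℝ} : level y h = s ↔ h = zInt y s :=
  ⟨fun e => by rw [← e, hy.zInt_level], fun e => by rw [e, hy.level_zInt]⟩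

@[simp] theorem level_zero : level y 0 = 0 := by rw [hy.level_eq_iff, zInt_zero]

theorem strictMono_level : StrictMono (level y) := fun a b hab => by
  rw [← hy.strictMono_zInt.lt_iff_lt, hy.zInt_level, hy.zInt_level]
  exact hab

theorem level_le_iff {h s : ℝ} : level y h ≤ s ↔ h ≤ zInt y s := by
  rw [← hy.strictMono_zInt.le_iff_le, hy.zInt_level]

theorem le_level_iff {h s : ℝ} : s ≤ level y h ↔ zInt y s ≤ h := by
  rw [← hy.strictMono_zInt.le_iff_le, hy.zInt_level]

theorem level_lt_iff {h s : ℝ} : level y h < s ↔ h < zInt y s := by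
  rw [← hy.strictMono_zInt.lt_iff_lt, hy.zInt_level]

theorem lt_level_iff {h s : ℝ} : s < level y h ↔ zInt y s < h := by
  rw [← hy.strictMono_zInt.lt_iff_lt, hy.zInt_level]

theorem continuous_level : Continuous (level y) := by
  have hs : Function.Surjective (level y) := fun s => ⟨_, hy.level_zInt s⟩
  exact hy.strictMono_level.monotone.continuous_of_surjective hs

theorem hasDerivAt_level {h : ℝ} (h0 : y (level y h) ≠ 0) :
    HasDerivAt (level y) (y (level y h) ^ 2)⁻¹ h :=
  HasDerivAt.of_local_left_inverse hy.continuous_level.continuousAt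
    (hasDerivAt_zInt hy.continuous _) (pow_ne_zero 2 h0)
    (Eventually.of_forall fun t => hy.zInt_level t)

theorem continuous_pos : Continuous (pos y) := by
  have hx : Continuous (xInt y) := (contDiff_xInt hy.smooth).continuous
  have h1 : Continuous fun h => xInt y (level y h) := hx.comp hy.continuous_level
  have h2 : Continuous fun h => y (level y h) := hy.continuous.comp hy.continuous_level
  have : pos y = fun h => ((xInt y (level y h) : ℝ) : ℂ) + (y (level y h) : ℝ) * Complex.I := by
    ext h
    exact Complex.mk_eq_add_mul_I _ _
  rw [this]
  exact (Complex.continuous_ofReal.comp h1).add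
    ((Complex.continuous_ofReal.comp h2).mul continuous_const)

theorem pos_zInt (s : ℝ) : pos y (zInt y s) = ⟨xInt y s, y s⟩ := by
  rw [pos, hy.level_zInt]

theorem hasDerivAt_pos {h : ℝ} (h0 : y (level y h) ≠ 0) :
    HasDerivAt (pos y) ((y (level y h) ^ 2)⁻¹ * ⟨y (level y h), deriv y (level y h)⟩ : ℂ) h := by
  have hl := hy.hasDerivAt_level h0
  have h1 := (hasDerivAt_xInt hy.continuous (level y h)).comp h hl
  have h2 := ((hy.differentiable (level y h)).hasDerivAt).comp h hl
  have : pos y = fun h => ((xInt y (level y h) : ℝ) : ℂ) + (y (level y h) : ℝ) * Complex.I := by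
    ext h
    exact Complex.mk_eq_add_mul_I _ _
  rw [this]
  have h3 := h1.ofReal_comp.add (h2.ofReal_comp.mul_const Complex.I)
  have h4 : ((y (level y h) ^ 2)⁻¹ * ⟨y (level y h), deriv y (level y h)⟩ : ℂ) =
      ((y (level y h) * (y (level y h) ^ 2)⁻¹ : ℝ) : ℂ) +
        ((deriv y (level y h) * (y (level y h) ^ 2)⁻¹ : ℝ) : ℂ) * Complex.I := by
    rw [Complex.mk_eq_add_mul_I]
    push_cast
    ring
  rw [h4]
  exact h3

/-- At the heights of cusps the formula for the derivative of `pos` is not available. Countably many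
such heights are harmless for the choice of a generic direction. -/
theorem countable_zeros : {s | y s = 0}.Countable := by
  have hfin : ∀ n : ℕ, {s ∈ Icc (-(n : ℝ)) n | y s = 0}.Finite := by
    intro n
    by_contra hinf
    obtain ⟨p, -, hacc⟩ := Set.Infinite.exists_accPt_of_subset_isCompact
      (K := Icc (-(n : ℝ)) n) hinf isCompact_Icc fun t ht => ht.1
    have hcl : IsClosed {s | y s = 0} := isClosed_eq hy.continuous continuous_const
    have hacc' : AccPt p (𝓟 {s | y s = 0}) := hacc.mono (principal_mono.2 fun t ht => ht.2)
    have hp : p ∈ {s | y s = 0} :=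
      hcl.closure_subset (mem_closure_iff_clusterPt.2 hacc'.clusterPt)
    have := (hy.differentiable p).hasDerivAt.eventually_ne (c := 0) (hy.regular p hp)
    rw [accPt_iff_frequently_nhdsNE] at hacc'
    exact hacc' (this.mono fun t ht h => ht h)
  refine (countable_iUnion fun n => (hfin n).countable).mono fun s hs => ?_
  obtain ⟨n, hn⟩ := exists_nat_ge |s|
  exact mem_iUnion.2 ⟨n, abs_le.1 hn, hs⟩

theorem countable_zero_heights (c : ℝ) : {h | y (level y (h - c)) = 0}.Countable := by
  have : {h | y (level y (h - c)) = 0} ⊆ (fun s => zInt y s + c) '' {s | y s = 0} := by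
    intro h hh
    exact ⟨level y (h - c), hh, by simp [hy.zInt_level]⟩
  exact (hy.countable_zeros.image _).mono this

end IsStrand

/-- Finitely many paths of planar vectors pass transversally, and with a signed number of passages
which is determined by their lifts, through the direction of a generic angle `2πc`. -/
theorem exists_direction_crossings {ι : Type*} [Finite ι] (P P' : ι → ℝ → ℂ) (F : ι → Set ℝ)
    (A B : ι → ℝ) {α β : ℝ} (hαβ : α ≤ β) (hF : ∀ i, (F i).Countable)
    (hlift : ∀ i, HasLift (P i) α β (A i) (B i))
    (hd : ∀ i, ∀ t ∈ Icc α β \ F i, HasDerivAt (P i) (P' i t) t) :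
    ∃ (c : ℝ) (C : ι → Finset ℝ), ∀ i,
      (∀ t ∈ C i, t ∈ Ioo α β ∧ t ∉ F i ∧ (P' i t / P i t).im ≠ 0) ∧
      (∀ t ∈ Icc α β, t ∈ C i ↔ HasAngle (P i t) (2 * Real.pi * c)) ∧ (∀ t ∈ C i, t ∈ Icc α β) ∧
      ∑ t ∈ C i, (SignType.sign (P' i t / P i t).im : ℤ) =
        ⌊B i / (2 * Real.pi) - c⌋ - ⌊A i / (2 * Real.pi) - c⌋ := by
  choose Θ hΘc hΘα hΘβ hΘ using hlift
  have hpi := Real.two_pi_pos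
  let f : ι → ℝ → ℝ := fun i t => Θ i t / (2 * Real.pi)
  have hderiv : ∀ i, ∀ t ∈ Ioo α β, t ∉ F i →
      HasDerivAt (f i) ((P' i t / P i t).im / (2 * Real.pi)) t := by
    intro i t ht htF
    refine (HasAngle.hasDerivAt_lift (hd i t ⟨⟨ht.1.le, ht.2.le⟩, htF⟩)
      ((hΘc i).continuousAt (Icc_mem_nhds ht.1 ht.2)) ?_).div_const _
    filter_upwards [Icc_mem_nhds ht.1 ht.2] with s hs using hΘ i s hs
  obtain ⟨c, hc⟩ := exists_generic_translation f (fun _ => Icc α β) (fun i => F i ∪ {α, β})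
    (fun i => (hF i).union (Set.toFinite _).countable) (fun i t ht => by
      have h1 : t ≠ α := fun h => ht.2 (Or.inr (Or.inl h))
      have h2 : t ≠ β := fun h => ht.2 (Or.inr (Or.inr h))
      exact (hderiv i t ⟨lt_of_le_of_ne ht.1.1 (Ne.symm h1), lt_of_le_of_ne ht.1.2 h2⟩
        fun h => ht.2 (Or.inl h)).differentiableAt)
  have hfc : ∀ i, ContinuousOn (fun t => f i t - c) (Icc α β) := fun i =>
    ((hΘc i).div_const _).sub continuousOn_const
  have hreg : ∀ i, ∀ t ∈ Icc α β, (∃ n : ℤ, f i t - c = n) →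
      t ∈ Ioo α β ∧ t ∉ F i ∧ DifferentiableAt ℝ (fun t => f i t - c) t ∧
      deriv (fun t => f i t - c) t ≠ 0 := by
    intro i t ht hn
    obtain ⟨h1, h2, h3⟩ := hc i t ht hn
    have h4 : t ≠ α := fun h => h1 (Or.inr (Or.inl h))
    have h5 : t ≠ β := fun h => h1 (Or.inr (Or.inr h))
    refine ⟨⟨lt_of_le_of_ne ht.1 (Ne.symm h4), lt_of_le_of_ne ht.2 h5⟩, fun h => h1 (Or.inl h),
      h2.sub_const c, ?_⟩
    rwa [deriv_sub_const]
  have hfin := fun i => finite_int_values (hfc i) fun t ht hn => (hreg i t ht hn).2.2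
  refine ⟨c, fun i => (hfin i).toFinset, fun i => ?_⟩
  have hmem : ∀ t, t ∈ (hfin i).toFinset ↔ t ∈ Icc α β ∧ ∃ n : ℤ, f i t - c = n := fun t => by
    simp
  have hder : ∀ t ∈ (hfin i).toFinset, deriv (fun t => f i t - c) t =
      (P' i t / P i t).im / (2 * Real.pi) := by
    intro t ht
    obtain ⟨h1, h2⟩ := (hmem t).1 ht
    obtain ⟨h3, h4, -⟩ := hreg i t h1 h2
    rw [deriv_sub_const, (hderiv i t h3 h4).deriv]
  refine ⟨fun t ht => ?_, fun t ht => ?_, fun t ht => ((hmem t).1 ht).1, ?_⟩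
  · obtain ⟨h1, h2⟩ := (hmem t).1 ht
    obtain ⟨h3, h4, -, h5⟩ := hreg i t h1 h2
    rw [hder t ht] at h5
    exact ⟨h3, h4, fun h => h5 (by rw [h, zero_div])⟩
  · rw [hmem, and_iff_right ht]
    constructor
    · rintro ⟨n, hn⟩
      have := (hΘ i t ht).add_int_mul_two_pi (-n)
      have h2 : Θ i t + 2 * Real.pi * ((-n : ℤ) : ℝ) = 2 * Real.pi * c := by
        have : Θ i t = 2 * Real.pi * f i t := by simp only [f]; field_simp
        rw [this]
        push_cast
        rw [← hn]
        ring
      rwa [h2] at this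
    · intro h
      obtain ⟨n, hn⟩ := h.exists_int (hΘ i t ht)
      refine ⟨n, ?_⟩
      simp only [f]
      rw [hn]
      field_simp
      ring
  · have := sum_sign_deriv_eq_floor_sub_floor hαβ (hfc i) (hfin i).toFinset
      (fun t ht => by rw [hmem, and_iff_right ht])
      (fun t ht => by
        obtain ⟨h1, h2⟩ := (hmem t).1 ht
        obtain ⟨h3, -, h4⟩ := hreg i t h1 h2
        exact ⟨h3, h4⟩)
    simp only [f, hΘα, hΘβ] at this
    rw [← this]
    refine Finset.sum_congr rfl fun t ht => ?_
    have h1 := hder t ht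
    simp only [f] at h1
    rw [h1]
    have h2 : ∀ x : ℝ, SignType.sign (x / (2 * Real.pi)) = SignType.sign x := by
      intro x
      rw [div_eq_mul_inv, sign_mul, sign_pos (inv_pos.2 hpi), mul_one]
    rw [h2]

/-! ### Ascending θ-graphs -/

/-- The strand determined by `y`, as a curve in space. -/
noncomputable def spacePoint (y : ℝ → ℝ) (s : ℝ) : R3 := ![xInt y s, y s, zInt y s]

theorem hasDerivAt_vec3 {f g k : ℝ → ℝ} {f' g' k' t : ℝ} (hf : HasDerivAt f f' t)
    (hg : HasDerivAt g g' t) (hk : HasDerivAt k k' t) :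
    HasDerivAt (fun s => (![f s, g s, k s] : R3)) ![f', g', k'] t := by
  rw [hasDerivAt_pi]
  intro i
  fin_cases i
  · exact hf
  · exact hg
  · exact hk

theorem hasDerivAt_spacePoint {y : ℝ → ℝ} (hy : IsStrand y) (s : ℝ) :
    HasDerivAt (spacePoint y) ![y s, deriv y s, y s ^ 2] s :=
  hasDerivAt_vec3 (hasDerivAt_xInt hy.continuous s) (hy.differentiable s).hasDerivAt
    (hasDerivAt_zInt hy.continuous s)

theorem contDiff_spacePoint {y : ℝ → ℝ} (hy : IsStrand y) : ContDiff ℝ ∞ (spacePoint y) := by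
  rw [contDiff_pi]
  intro i
  fin_cases i
  · exact contDiff_xInt hy.smooth
  · exact hy.smooth
  · exact contDiff_zInt hy.smooth

/-- Three ascending strands, of lengths `E i`, which have their end points in common. -/
structure IsTheta (y : Fin 3 → ℝ → ℝ) (E : Fin 3 → ℝ) (H : ℝ) : Prop where
  strand : ∀ i, IsStrand (y i)
  length_pos : ∀ i, 0 < E i
  height : ∀ i, zInt (y i) (E i) = H
  start : ∀ i j, y i 0 = y j 0
  finish_x : ∀ i j, xInt (y i) (E i) = xInt (y j) (E j)
  finish_y : ∀ i j, y i (E i) = y j (E j)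
  start_pos : ∀ i, 0 < y i 0
  finish_pos : ∀ i, 0 < y i (E i)
  start_slope : ∀ i j, i ≠ j → deriv (y i) 0 ≠ deriv (y j) 0
  finish_slope : ∀ i j, i ≠ j → deriv (y i) (E i) ≠ deriv (y j) (E j)
  disjoint : ∀ i j, i ≠ j → ∀ h ∈ Ioo 0 H, pos (y i) h ≠ pos (y j) h

theorem eq_of_sameRay {u v : R3} (h : SameRay ℝ u v) (hu : 0 < u 0) (hv : 0 < v 0) :
    u 1 / u 0 = v 1 / v 0 := by
  have hu0 : u ≠ 0 := fun e => by rw [e] at hu; simp at hu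
  have hv0 : v ≠ 0 := fun e => by rw [e] at hv; simp at hv
  obtain ⟨r, hr, rfl⟩ := h.exists_pos_left hu0 hv0
  simp only [Pi.smul_apply, smul_eq_mul]
  field_simp

namespace IsTheta

variable {y : Fin 3 → ℝ → ℝ} {E : Fin 3 → ℝ} {H : ℝ} (hT : IsTheta y E H)
include hT

theorem height_pos : 0 < H := by
  rw [← hT.height 0, ← zInt_zero (y 0)]
  exact (hT.strand 0).strictMono_zInt (hT.length_pos 0)

theorem hasDerivAt_edge (i : Fin 3) (t : ℝ) :
    HasDerivAt (fun t => spacePoint (y i) (E i * t))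
      (E i • ![y i (E i * t), deriv (y i) (E i * t), y i (E i * t) ^ 2]) t := by
  have h1 : HasDerivAt (fun t => E i * t) (E i) t := by
    simpa using (hasDerivAt_id t).const_mul (E i)
  exact (hasDerivAt_spacePoint (hT.strand i) (E i * t)).scomp t h1

theorem spacePoint_level (i : Fin 3) (h : ℝ) :
    spacePoint (y i) (level (y i) h) = ![(pos (y i) h).re, (pos (y i) h).im, h] := by
  simp [spacePoint, pos, (hT.strand i).zInt_level]

/-- The Legendrian θ-graph formed by three ascending strands. -/
noncomputable def graph : LegendrianThetaGraph where
  a := spacePoint (y 0) 0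
  b := spacePoint (y 0) (E 0)
  edge i t := spacePoint (y i) (E i * t)
  smooth i := (contDiff_spacePoint (hT.strand i)).comp (contDiff_const.mul contDiff_id)
  edge_zero i := by simp [spacePoint, hT.start i 0]
  edge_one i := by simp [spacePoint, hT.finish_x i 0, hT.finish_y i 0, hT.height]
  immersed i t _ := by
    rw [(hT.hasDerivAt_edge i t).deriv]
    intro h
    have h0 := congrFun h 0
    have h1 := congrFun h 1
    have hE := (hT.length_pos i).ne'
    simp [hE] at h0 h1
    exact (hT.strand i).regular _ h0 h1
  legendrian i t _ := by
    rw [(hT.hasDerivAt_edge i t).deriv]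
    simp [contactForm, spacePoint]
    ring
  embedded i j s hs t ht hst := by
    have hz : zInt (y i) (E i * s) = zInt (y j) (E j * t) := congrFun hst 2
    have hmem : ∀ k, ∀ r ∈ Icc (0 : ℝ) 1, E k * r ∈ Icc 0 (E k) := fun k r hr =>
      ⟨mul_nonneg (hT.length_pos k).le hr.1, mul_le_of_le_one_right (hT.length_pos k).le hr.2⟩
    have hcancel : ∀ k, ∀ r r', E k * r = E k * r' → r = r' := fun k r r' h =>
      mul_left_cancel₀ (hT.length_pos k).ne' h
    by_cases hij : i = j
    · subst hij
      exact Or.inl ⟨rfl, hcancel i _ _ ((hT.strand i).strictMono_zInt.injective hz)⟩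
    · right
      -- A common point of two edges lies on both at the same height, so either `disjoint` excludes
      -- it or the height is that of a vertex.
      set h := zInt (y i) (E i * s) with hh
      have hp : pos (y i) h = pos (y j) h := by
        rw [hz, (hT.strand j).pos_zInt, ← hz, hh, (hT.strand i).pos_zInt]
        have h0 := congrFun hst 0
        have h1 := congrFun hst 1
        simp only [spacePoint, Matrix.cons_val_zero, Matrix.cons_val_one] at h0 h1
        rw [h0, h1]
      have hnot := fun hI => hT.disjoint i j hij h hI hp
      have h0 : 0 ≤ h := by
        rw [hh, ← zInt_zero (y i)]
        exact (hT.strand i).strictMono_zInt.monotone (hmem i s hs).1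
      have h1 : h ≤ H := by
        rw [hh, ← hT.height i]
        exact (hT.strand i).strictMono_zInt.monotone (hmem i s hs).2
      have hval : ∀ k r, zInt (y k) (E k * r) = 0 → r = 0 := fun k r e => by
        rw [← zInt_zero (y k)] at e
        simpa using hcancel k r 0 (by
          simpa using (hT.strand k).strictMono_zInt.injective e)
      have hval' : ∀ k r, zInt (y k) (E k * r) = H → r = 1 := fun k r e => by
        rw [← hT.height k] at e
        simpa using hcancel k r 1 (by
          simpa using (hT.strand k).strictMono_zInt.injective e)
      rcases h0.eq_or_lt with e | h0
      · exact Or.inl ⟨hval i s (by rw [← hh, ← e]), hval j t (by rw [← hz, ← e])⟩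
      · rcases h1.eq_or_lt with e | h1
        · exact Or.inr ⟨hval' i s (by rw [← hh, ← e]), hval' j t (by rw [← hz, ← e])⟩
        · exact absurd ⟨h0, h1⟩ hnot
  not_tangent_a i j hij h := by
    rw [(hT.hasDerivAt_edge i 0).deriv, (hT.hasDerivAt_edge j 0).deriv] at h
    have hi := hT.length_pos i
    have hj := hT.length_pos j
    have pi := hT.start_pos i
    have pj := hT.start_pos j
    have := eq_of_sameRay h (by simpa using mul_pos hi pi) (by simpa using mul_pos hj pj)
    simp only [mul_zero, Pi.smul_apply, smul_eq_mul, Matrix.cons_val_zero,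
      Matrix.cons_val_one] at this
    rw [mul_div_mul_left _ _ hi.ne', mul_div_mul_left _ _ hj.ne', hT.start i j] at this
    exact hT.start_slope i j hij (by rwa [div_left_inj' pj.ne'] at this)
  not_tangent_b i j hij h := by
    rw [(hT.hasDerivAt_edge i 1).deriv, (hT.hasDerivAt_edge j 1).deriv] at h
    have hi := hT.length_pos i
    have hj := hT.length_pos j
    have pi := hT.finish_pos i
    have pj := hT.finish_pos j
    have := eq_of_sameRay h (by simpa using mul_pos hi pi) (by simpa using mul_pos hj pj)
    simp only [mul_one, Pi.smul_apply, smul_eq_mul, Matrix.cons_val_zero,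
      Matrix.cons_val_one] at this
    rw [mul_div_mul_left _ _ hi.ne', mul_div_mul_left _ _ hj.ne', hT.finish_y i j] at this
    exact hT.finish_slope i j hij (by rwa [div_left_inj' pj.ne'] at this)

@[simp] theorem graph_edge (i : Fin 3) (t : ℝ) :
    hT.graph.edge i t = spacePoint (y i) (E i * t) := rfl

end IsTheta

/-! ### Linking numbers and rotation numbers of the cycles -/

/-- The displacement, at the height `h`, from the strand `y l` pushed up by `ε` to the strand
`y k`. -/
noncomputable def gap (y : Fin 3 → ℝ → ℝ) (ε : ℝ) (k l : Fin 3) (h : ℝ) : ℂ :=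
  pos (y k) h - pos (y l) (h - ε)

/-- The point of space at the height `h` above the point `ζ` of the plane. -/
noncomputable def atHeight (ζ : ℂ) (h : ℝ) : R3 := ![ζ.re, ζ.im, h]

namespace IsTheta

variable {y : Fin 3 → ℝ → ℝ} {E : Fin 3 → ℝ} {H : ℝ} (hT : IsTheta y E H)

/-- The strand on the part `κ` of the cycle formed by the edges `i` and `j`. -/
def part (i j : Fin 3) : Fin 2 → Fin 3 := ![i, j]

/-- The orientation of the part `κ` of a cycle with respect to the height. -/
def partSign : Fin 2 → ℝ := ![1, -1]

include hT in
theorem level_mem (k : Fin 3) {h : ℝ} (hh : h ∈ Icc 0 H) :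
    level (y k) h / E k ∈ Icc (0 : ℝ) 1 := by
  have hE := hT.length_pos k
  rw [mem_Icc, div_le_one hE, (hT.strand k).level_le_iff, hT.height]
  refine ⟨div_nonneg ?_ hE.le, hh.2⟩
  rw [(hT.strand k).le_level_iff, zInt_zero]
  exact hh.1

include hT in
theorem level_mem_Ioo (k : Fin 3) {h : ℝ} (hh : h ∈ Ioo 0 H) :
    level (y k) h / E k ∈ Ioo (0 : ℝ) 1 := by
  have hE := hT.length_pos k
  rw [mem_Ioo, div_lt_one hE, (hT.strand k).level_lt_iff, hT.height]
  refine ⟨div_pos ?_ hE, hh.2⟩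
  rw [(hT.strand k).lt_level_iff, zInt_zero]
  exact hh.1

include hT in
theorem mul_level_div (k : Fin 3) (h : ℝ) : E k * (level (y k) h / E k) = level (y k) h :=
  mul_div_cancel₀ _ (hT.length_pos k).ne'

/-- The parameter at which the part `κ` of the cycle formed by `i` and `j` has height `h`. -/
noncomputable def param (y : Fin 3 → ℝ → ℝ) (E : Fin 3 → ℝ) (i j : Fin 3) (κ : Fin 2) (h : ℝ) :
    ℝ :=
  if κ = 0 then level (y i) h / E i else 2 - level (y j) h / E j

theorem edge_level (k : Fin 3) (h : ℝ) :
    hT.graph.edge k (level (y k) h / E k) = atHeight (pos (y k) h) h := by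
  rw [graph_edge, hT.mul_level_div, hT.spacePoint_level, atHeight]

theorem cycle_param (i j : Fin 3) (κ : Fin 2) {h : ℝ} (hh : h ∈ Icc 0 H) :
    hT.graph.cycle i j (param y E i j κ h) = atHeight (pos (y (part i j κ)) h) h := by
  fin_cases κ
  · change hT.graph.cycle i j (level (y i) h / E i) = atHeight (pos (y i) h) h
    rw [LegendrianThetaGraph.cycle, if_pos (hT.level_mem i hh).2, edge_level]
  · change hT.graph.cycle i j (2 - level (y j) h / E j) = atHeight (pos (y j) h) h
    rw [LegendrianThetaGraph.cycle]
    have h1 := (hT.level_mem j hh).2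
    -- `cycle` assigns the parameter 1 to the edge `i`. On the second part this concerns only the
    -- vertex b, where the edges agree.
    split_ifs with hle
    · have h2 : level (y j) h / E j = 1 := by linarith
      have h3 : hT.graph.edge i (2 - level (y j) h / E j) =
          hT.graph.edge j (level (y j) h / E j) := by
        rw [h2, show (2 : ℝ) - 1 = 1 by norm_num, hT.graph.edge_one, hT.graph.edge_one]
      rw [h3, edge_level]
    · rw [sub_sub_cancel, edge_level]

include hT in
theorem exists_param (i j : Fin 3) {s : ℝ} (hs : s ∈ Icc (0 : ℝ) 2) :
    ∃ κ, ∃ h ∈ Icc 0 H, s = param y E i j κ h := by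
  have key : ∀ k, ∀ t ∈ Icc (0 : ℝ) 1, ∃ h ∈ Icc 0 H, t = level (y k) h / E k := by
    intro k t ht
    have hE := hT.length_pos k
    refine ⟨zInt (y k) (E k * t), ⟨?_, ?_⟩, ?_⟩
    · rw [← zInt_zero (y k)]
      exact (hT.strand k).strictMono_zInt.monotone (mul_nonneg hE.le ht.1)
    · rw [← hT.height k]
      exact (hT.strand k).strictMono_zInt.monotone (mul_le_of_le_one_right hE.le ht.2)
    · rw [(hT.strand k).level_zInt, mul_div_cancel_left₀ _ hE.ne']
  rcases le_total s 1 with h | h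
  · obtain ⟨t, ht, e⟩ := key i s ⟨hs.1, h⟩
    exact ⟨0, t, ht, e⟩
  · obtain ⟨t, ht, e⟩ := key j (2 - s) ⟨by linarith [hs.2], by linarith⟩
    refine ⟨1, t, ht, ?_⟩
    simp only [param]
    rw [if_neg (by decide), ← e]
    ring

include hT in
theorem param_mem_Icc (i j : Fin 3) (κ : Fin 2) {h : ℝ} (hh : h ∈ Icc 0 H) :
    param y E i j κ h ∈ Icc (0 : ℝ) 2 := by
  have h1 := hT.level_mem i hh
  have h2 := hT.level_mem j hh
  simp only [param]
  split_ifs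
  · exact ⟨h1.1, by linarith [h1.2]⟩
  · constructor <;> linarith [h2.1, h2.2]

include hT in
theorem param_mem_Ioo (i j : Fin 3) (κ : Fin 2) {h : ℝ} (hh : h ∈ Ioo 0 H) :
    param y E i j κ h ∈ Ioo (0 : ℝ) 2 := by
  have h1 := hT.level_mem_Ioo i hh
  have h2 := hT.level_mem_Ioo j hh
  simp only [param]
  split_ifs
  · exact ⟨h1.1, by linarith [h1.2]⟩
  · constructor <;> linarith [h2.1, h2.2]

include hT in
theorem param_injective (i j : Fin 3) {κ κ' : Fin 2} {h h' : ℝ} (hh : h ∈ Ioo 0 H)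
    (hh' : h' ∈ Ioo 0 H) (he : param y E i j κ h = param y E i j κ' h') : κ = κ' ∧ h = h' := by
  have h1 := hT.level_mem_Ioo i hh
  have h2 := hT.level_mem_Ioo j hh
  have h1' := hT.level_mem_Ioo i hh'
  have h2' := hT.level_mem_Ioo j hh'
  have hinj : ∀ k, level (y k) h / E k = level (y k) h' / E k → h = h' := fun k e =>
    (hT.strand k).strictMono_level.injective (by rwa [div_left_inj' (hT.length_pos k).ne'] at e)
  fin_cases κ <;> fin_cases κ' <;> simp [param] at he ⊢
  · exact hinj i he
  · linarith [h1.2, h2'.2]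
  · linarith [h1'.2, h2.2]
  · exact hinj j he

theorem hasDerivAt_cycle (i j : Fin 3) (κ : Fin 2) {h : ℝ} (hh : h ∈ Ioo 0 H) :
    HasDerivAt (hT.graph.cycle i j)
      ((partSign κ * E (part i j κ)) • ![y (part i j κ) (level (y (part i j κ)) h),
        deriv (y (part i j κ)) (level (y (part i j κ)) h),
        y (part i j κ) (level (y (part i j κ)) h) ^ 2]) (param y E i j κ h) := by
  fin_cases κ
  · have h1 := hT.level_mem_Ioo i hh
    have h2 := hT.hasDerivAt_edge i (level (y i) h / E i)
    rw [hT.mul_level_div] at h2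
    change HasDerivAt (hT.graph.cycle i j) (((1 : ℝ) * E i) • ![y i (level (y i) h),
      deriv (y i) (level (y i) h), y i (level (y i) h) ^ 2]) (level (y i) h / E i)
    rw [one_mul]
    refine h2.congr_of_eventuallyEq ?_
    filter_upwards [gt_mem_nhds h1.2] with t ht
    simp [LegendrianThetaGraph.cycle, ht.le]
  · have h1 := hT.level_mem_Ioo j hh
    have h2 := hT.hasDerivAt_edge j (level (y j) h / E j)
    rw [hT.mul_level_div] at h2
    have h3 : HasDerivAt (fun t : ℝ => 2 - t) (-1) (2 - level (y j) h / E j) := by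
      simpa using (hasDerivAt_id (2 - level (y j) h / E j)).const_sub 2
    have h4 := HasDerivAt.scomp_of_eq _ h2 h3 (sub_sub_cancel 2 (level (y j) h / E j)).symm
    change HasDerivAt (hT.graph.cycle i j) (((-1 : ℝ) * E j) • ![y j (level (y j) h),
      deriv (y j) (level (y j) h), y j (level (y j) h) ^ 2]) (2 - level (y j) h / E j)
    rw [mul_smul]
    refine h4.congr_of_eventuallyEq ?_
    filter_upwards [lt_mem_nhds (by linarith [h1.2] : 1 < 2 - level (y j) h / E j)] with t ht
    simp [LegendrianThetaGraph.cycle, not_le.2 ht]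

end IsTheta

/-- Once both velocities are rescaled to vertical speed 1, their difference is horizontal and the
determinant is a planar cross product with ζ. Hence the sign of a crossing is, up to orientations,
the sign of the angular velocity of the displacement ζ. -/
theorem det3_atHeight_sub (a b p p' q q' u v : ℝ) (hu : u ≠ 0) (hv : v ≠ 0) (ζ : ℂ)
    (hζ : ζ ≠ 0) :
    det3 (a • ![p, p', u ^ 2]) (b • ![q, q', v ^ 2]) (atHeight ζ 0) =
      a * b * (u ^ 2 * v ^ 2 * Complex.normSq ζ) *
        ((((u ^ 2)⁻¹ * ⟨p, p'⟩ - (v ^ 2)⁻¹ * ⟨q, q'⟩ : ℂ)) / ζ).im := by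
  have h0 : Complex.normSq ζ ≠ 0 := by rwa [Ne, Complex.normSq_eq_zero]
  have h1 : ((((u ^ 2)⁻¹ * ⟨p, p'⟩ - (v ^ 2)⁻¹ * ⟨q, q'⟩ : ℂ)) / ζ).im =
      (((u ^ 2)⁻¹ * p' - (v ^ 2)⁻¹ * q') * ζ.re - ((u ^ 2)⁻¹ * p - (v ^ 2)⁻¹ * q) * ζ.im) /
        Complex.normSq ζ := by
    rw [Complex.div_im]
    have e1 : ((u ^ 2)⁻¹ * ⟨p, p'⟩ - (v ^ 2)⁻¹ * ⟨q, q'⟩ : ℂ) =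
        ⟨(u ^ 2)⁻¹ * p - (v ^ 2)⁻¹ * q, (u ^ 2)⁻¹ * p' - (v ^ 2)⁻¹ * q'⟩ := by
      apply Complex.ext <;> simp only [Complex.sub_re, Complex.sub_im, Complex.re_ofReal_mul,
        Complex.im_ofReal_mul]
    rw [e1]
    ring
  rw [h1]
  simp [det3, Matrix.det_fin_three, atHeight]
  field_simp
  ring

theorem atHeight_sub (ζ ζ' : ℂ) (h h' : ℝ) :
    atHeight ζ h - atHeight ζ' h' = atHeight (ζ - ζ') (h - h') := by
  ext i
  fin_cases i <;> simp [atHeight]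

theorem atHeight_add_lift (ζ : ℂ) (h ε : ℝ) :
    atHeight ζ h + ![0, 0, ε] = atHeight ζ (h + ε) := by
  ext i
  fin_cases i <;> simp [atHeight]

theorem atHeight_injective {ζ ζ' : ℂ} {h h' : ℝ} (e : atHeight ζ h = atHeight ζ' h') :
    ζ = ζ' ∧ h = h' := by
  have h0 := congrFun e 0
  have h1 := congrFun e 1
  have h2 := congrFun e 2
  simp [atHeight] at h0 h1 h2
  exact ⟨Complex.ext h0 h1, h2⟩

theorem hasAngle_iff_atHeight (ζ : ℂ) (h θ : ℝ) :
    (∃ r : ℝ, 0 < r ∧ atHeight ζ h = r • atHeight (Complex.exp (θ * Complex.I)) 0) ↔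
      h = 0 ∧ HasAngle ζ θ := by
  have key : ∀ r : ℝ, r • atHeight (Complex.exp (θ * Complex.I)) 0 =
      atHeight (r * Complex.exp (θ * Complex.I)) 0 := by
    intro r
    ext i
    fin_cases i <;> simp [atHeight]
  constructor
  · rintro ⟨r, hr, e⟩
    rw [key] at e
    obtain ⟨e1, e2⟩ := atHeight_injective e
    exact ⟨e2, r, hr, e1⟩
  · rintro ⟨rfl, r, hr, e⟩
    exact ⟨r, hr, by rw [key, e]⟩

namespace IsTheta

variable {y : Fin 3 → ℝ → ℝ} {E : Fin 3 → ℝ} {H : ℝ} (hT : IsTheta y E H)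

theorem continuous_gap (hs : ∀ i, IsStrand (y i)) (ε : ℝ) (k l : Fin 3) :
    Continuous (gap y ε k l) :=
  (hs k).continuous_pos.sub ((hs l).continuous_pos.comp (continuous_id.sub continuous_const))

theorem cycle_sub_pushOff (i j : Fin 3) (ε : ℝ) (κ κ' : Fin 2) {h h' : ℝ} (hh : h ∈ Icc 0 H)
    (hh' : h' ∈ Icc 0 H) :
    hT.graph.cycle i j (param y E i j κ h) - hT.graph.pushOff i j ε (param y E i j κ' h') =
      atHeight (pos (y (part i j κ)) h - pos (y (part i j κ')) h') (h - (h' + ε)) := by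
  rw [LegendrianThetaGraph.pushOff, hT.cycle_param i j κ hh, hT.cycle_param i j κ' hh',
    atHeight_add_lift, atHeight_sub]

theorem cycle_ne_pushOff (i j : Fin 3) {ε : ℝ}
    (hgap : ∀ k l, ∀ h ∈ Icc ε H, gap y ε k l h ≠ 0) :
    ∀ s ∈ Icc (0 : ℝ) 2, ∀ t ∈ Icc (0 : ℝ) 2, hT.graph.cycle i j s ≠ hT.graph.pushOff i j ε t := by
  intro s hs t ht e
  obtain ⟨κ, h, hh, rfl⟩ := hT.exists_param i j hs
  obtain ⟨κ', h', hh', rfl⟩ := hT.exists_param i j ht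
  have := hT.cycle_sub_pushOff i j ε κ κ' hh hh'
  rw [e, sub_self] at this
  have e0 : (0 : R3) = atHeight 0 0 := by ext i; fin_cases i <;> simp [atHeight]
  obtain ⟨h1, h2⟩ := atHeight_injective (e0.symm.trans this)
  have h3 : h' = h - ε := by linarith
  refine hgap (part i j κ) (part i j κ') h ⟨by linarith [hh'.1], hh.2⟩ ?_
  rw [gap, ← h3, ← h1]

/-- The crossings along the horizontal direction of angle 2πc are the passages of the four gaps
through this angle, and each gap contributes a difference of floors of its lift. All strands share
their end points, so the initial angle depends only on the first index and the final angle only on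
the second. The two parts of the cycle have opposite orientations, so these boundary terms cancel in
the signed sum and only the full turns n remain. -/
theorem hasLinkingNumber (i j : Fin 3) {ε : ℝ} (hε : 0 < ε) (hεH : ε < H)
    (A B : Fin 3 → ℝ) (n : Fin 3 → Fin 3 → ℤ)
    (hlift : ∀ k l, HasLift (gap y ε k l) ε H (A k) (B l + 2 * Real.pi * n k l)) :
    HasLinkingNumber 2 (hT.graph.cycle i j) (hT.graph.pushOff i j ε)
      (n i i + n j j - n i j - n j i) := by
  have hpi := Real.two_pi_pos
  refine ⟨hT.cycle_ne_pushOff i j (fun k l h hh => (hlift k l).ne_zero hh), ?_⟩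
  let e := part i j
  let vel : Fin 3 → ℝ → ℂ := fun k h =>
    ((y k (level (y k) h) ^ 2)⁻¹ * ⟨y k (level (y k) h), deriv (y k) (level (y k) h)⟩ : ℂ)
  let P' : Fin 2 × Fin 2 → ℝ → ℂ := fun p h => vel (e p.1) h - vel (e p.2) (h - ε)
  let F : Fin 2 × Fin 2 → Set ℝ := fun p =>
    {h | y (e p.1) (level (y (e p.1)) (h - 0)) = 0} ∪
      {h | y (e p.2) (level (y (e p.2)) (h - ε)) = 0}
  have hF0 : ∀ p h, h ∉ F p → y (e p.1) (level (y (e p.1)) h) ≠ 0 ∧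
      y (e p.2) (level (y (e p.2)) (h - ε)) ≠ 0 := by
    intro p h hh
    constructor
    · exact fun h0 => hh (Or.inl (by simpa using h0))
    · exact fun h0 => hh (Or.inr h0)
  obtain ⟨c, C, hC⟩ := exists_direction_crossings
    (fun p : Fin 2 × Fin 2 => gap y ε (e p.1) (e p.2)) P' F (fun p => A (e p.1))
    (fun p => B (e p.2) + 2 * Real.pi * n (e p.1) (e p.2)) hεH.le
    (fun p => ((hT.strand _).countable_zero_heights 0).union
      ((hT.strand _).countable_zero_heights ε))
    (fun p => hlift _ _)
    (fun p h hh => by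
      obtain ⟨h1, h2⟩ := hF0 p h hh.2
      have h3 : HasDerivAt (fun t : ℝ => t - ε) 1 h := by
        simpa using (hasDerivAt_id h).sub_const ε
      have h4 := ((hT.strand _).hasDerivAt_pos h2).scomp h h3
      rw [one_smul] at h4
      exact ((hT.strand _).hasDerivAt_pos h1).sub h4)
  let d : R3 := atHeight (Complex.exp ((2 * Real.pi * c : ℝ) * Complex.I)) 0
  let φ : (Σ _ : Fin 2 × Fin 2, ℝ) → ℝ × ℝ := fun q =>
    (param y E i j q.1.1 q.2, param y E i j q.1.2 (q.2 - ε))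
  let S : Finset (Σ _ : Fin 2 × Fin 2, ℝ) := Finset.univ.sigma C
  have hS : ∀ q, q ∈ S ↔ q.2 ∈ C q.1 := by
    intro q
    simp [S]
  have hIoo : ∀ q ∈ S, q.2 ∈ Ioo 0 H ∧ q.2 - ε ∈ Ioo 0 H := by
    intro q hq
    have := ((hC q.1).1 q.2 ((hS q).1 hq)).1
    refine ⟨⟨?_, ?_⟩, ⟨?_, ?_⟩⟩ <;> linarith [this.1, this.2]
  have hdiff : ∀ q : (Σ _ : Fin 2 × Fin 2, ℝ), q.2 ∈ Icc ε H →
      hT.graph.cycle i j (φ q).1 - hT.graph.pushOff i j ε (φ q).2 =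
        atHeight (gap y ε (e q.1.1) (e q.1.2) q.2) 0 := by
    intro q hq
    have := hT.cycle_sub_pushOff i j ε q.1.1 q.1.2 (h := q.2) (h' := q.2 - ε)
      ⟨by linarith [hq.1], hq.2⟩ ⟨by linarith [hq.1], by linarith [hq.2]⟩
    rw [sub_add_cancel, sub_self] at this
    exact this
  have hinj : Set.InjOn φ S := by
    intro q hq q' hq' he
    have h1 := hIoo q hq
    have h2 := hIoo q' hq'
    obtain ⟨a1, a2⟩ := hT.param_injective i j h1.1 h2.1 (congrArg Prod.fst he)
    obtain ⟨b1, -⟩ := hT.param_injective i j h1.2 h2.2 (congrArg Prod.snd he)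
    obtain ⟨⟨q1, q2⟩, q3⟩ := q
    obtain ⟨⟨q1', q2'⟩, q3'⟩ := q'
    simp only at a1 a2 b1
    rw [a1, a2, b1]
  have hderivA : ∀ q ∈ S, HasDerivAt (hT.graph.cycle i j)
      ((partSign q.1.1 * E (e q.1.1)) • ![y (e q.1.1) (level (y (e q.1.1)) q.2),
        deriv (y (e q.1.1)) (level (y (e q.1.1)) q.2),
        y (e q.1.1) (level (y (e q.1.1)) q.2) ^ 2]) (φ q).1 := fun q hq =>
    hT.hasDerivAt_cycle i j q.1.1 (hIoo q hq).1
  have hderivB : ∀ q ∈ S, HasDerivAt (hT.graph.pushOff i j ε)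
      ((partSign q.1.2 * E (e q.1.2)) • ![y (e q.1.2) (level (y (e q.1.2)) (q.2 - ε)),
        deriv (y (e q.1.2)) (level (y (e q.1.2)) (q.2 - ε)),
        y (e q.1.2) (level (y (e q.1.2)) (q.2 - ε)) ^ 2]) (φ q).2 := fun q hq =>
    (hT.hasDerivAt_cycle i j q.1.2 (hIoo q hq).2).add_const _
  have hdet : ∀ q ∈ S, ∃ r : ℝ, 0 < r ∧
      det3 (deriv (hT.graph.cycle i j) (φ q).1) (deriv (hT.graph.pushOff i j ε) (φ q).2)
        (hT.graph.cycle i j (φ q).1 - hT.graph.pushOff i j ε (φ q).2) =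
      partSign q.1.1 * partSign q.1.2 * r *
        (P' q.1 q.2 / gap y ε (e q.1.1) (e q.1.2) q.2).im := by
    intro q hq
    have hqC := (hS q).1 hq
    obtain ⟨-, h1, -⟩ := (hC q.1).1 q.2 hqC
    obtain ⟨h2, h3⟩ := hF0 q.1 q.2 h1
    have hI := (hC q.1).2.2.1 q.2 hqC
    have hg := (hlift (e q.1.1) (e q.1.2)).ne_zero hI
    rw [(hderivA q hq).deriv, (hderivB q hq).deriv, hdiff q hI, det3_atHeight_sub _ _ _ _ _ _ _ _
      h2 h3 _ hg]
    refine ⟨E (e q.1.1) * E (e q.1.2) * (y (e q.1.1) (level (y (e q.1.1)) q.2) ^ 2 *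
      y (e q.1.2) (level (y (e q.1.2)) (q.2 - ε)) ^ 2 *
      Complex.normSq (gap y ε (e q.1.1) (e q.1.2) q.2)), ?_, ?_⟩
    · have := Complex.normSq_pos.2 hg
      have := hT.length_pos (e q.1.1)
      have := hT.length_pos (e q.1.2)
      positivity
    · simp only [P', vel]
      ring
  refine ⟨d, ?_, S.image φ, ?_, ?_, ?_⟩
  · intro h0
    have e0 : (0 : R3) = atHeight 0 0 := by ext i; fin_cases i <;> simp [atHeight]
    exact Complex.exp_ne_zero _ (atHeight_injective (h0.trans e0)).1
  · intro s hs t ht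
    rw [Finset.mem_image]
    constructor
    · rintro ⟨q, hq, he⟩
      have hqC := (hS q).1 hq
      have hI := (hC q.1).2.2.1 q.2 hqC
      have ha := ((hC q.1).2.1 q.2 hI).1 hqC
      have := hdiff q hI
      rw [he] at this
      rw [this]
      exact (hasAngle_iff_atHeight _ _ _).2 ⟨rfl, ha⟩
    · intro hcross
      obtain ⟨κ, h, hh, rfl⟩ := hT.exists_param i j hs
      obtain ⟨κ', h', hh', rfl⟩ := hT.exists_param i j ht
      rw [hT.cycle_sub_pushOff i j ε κ κ' hh hh'] at hcross
      obtain ⟨h1, h2⟩ := (hasAngle_iff_atHeight _ _ _).1 hcross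
      have h3 : h' = h - ε := by linarith
      subst h3
      have hI : h ∈ Icc ε H := ⟨by linarith [hh'.1], hh.2⟩
      exact ⟨⟨(κ, κ'), h⟩, (hS _).2 (((hC (κ, κ')).2.1 h hI).2 h2), rfl⟩
  · intro p hp
    obtain ⟨q, hq, rfl⟩ := Finset.mem_image.1 hp
    have hI := hIoo q hq
    refine ⟨hT.param_mem_Ioo i j _ hI.1, hT.param_mem_Ioo i j _ hI.2,
      (hderivA q hq).differentiableAt, (hderivB q hq).differentiableAt, ?_⟩
    obtain ⟨r, hr, he⟩ := hdet q hq
    rw [he]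
    have h1 := ((hC q.1).1 q.2 ((hS q).1 hq)).2.2
    have h2 : ∀ κ, partSign κ ≠ 0 := by
      intro κ
      fin_cases κ <;> simp [partSign]
    exact mul_ne_zero (mul_ne_zero (mul_ne_zero (h2 _) (h2 _)) hr.ne') h1
  · rw [Finset.sum_image hinj, Finset.sum_sigma]
    let sg : Fin 2 → ℤ := ![1, -1]
    have hsum : ∀ p : Fin 2 × Fin 2, ∑ h ∈ C p,
        (SignType.sign (det3 (deriv (hT.graph.cycle i j) (φ ⟨p, h⟩).1)
          (deriv (hT.graph.pushOff i j ε) (φ ⟨p, h⟩).2)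
          (hT.graph.cycle i j (φ ⟨p, h⟩).1 - hT.graph.pushOff i j ε (φ ⟨p, h⟩).2)) : ℤ) =
        sg p.1 * sg p.2 * (n (e p.1) (e p.2) + ⌊B (e p.2) / (2 * Real.pi) - c⌋ -
          ⌊A (e p.1) / (2 * Real.pi) - c⌋) := by
      intro p
      have h1 := (hC p).2.2.2
      have h2 : (B (e p.2) + 2 * Real.pi * n (e p.1) (e p.2)) / (2 * Real.pi) - c =
          B (e p.2) / (2 * Real.pi) - c + n (e p.1) (e p.2) := by
        field_simp
        ring
      rw [h2, Int.floor_add_intCast] at h1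
      have h3 : n (e p.1) (e p.2) + ⌊B (e p.2) / (2 * Real.pi) - c⌋ -
          ⌊A (e p.1) / (2 * Real.pi) - c⌋ = ∑ h ∈ C p,
            (SignType.sign (P' p h / gap y ε (e p.1) (e p.2) h).im : ℤ) := by
        rw [h1]; ring
      rw [h3, Finset.mul_sum]
      refine Finset.sum_congr rfl fun h hh => ?_
      obtain ⟨r, hr, he⟩ := hdet ⟨p, h⟩ ((hS ⟨p, h⟩).2 hh)
      rw [he, sign_mul, sign_mul, sign_mul, sign_pos hr, mul_one]
      have h4 : ∀ κ, ((SignType.sign (partSign κ) : SignType) : ℤ) = sg κ := by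
        intro κ
        fin_cases κ
        · simp [partSign, sg]
        · simp [partSign, sg]
      rw [SignType.coe_mul, SignType.coe_mul, h4, h4]
    rw [Finset.sum_congr rfl fun p _ => hsum p, Fintype.sum_prod_type]
    simp only [Fin.sum_univ_two]
    simp only [sg, e, part, Matrix.cons_val_zero, Matrix.cons_val_one]
    ring

/-- Lifts for every small ε give at once the linking number of one push-off and the disjointness of
all smaller ones. The end angles A and B may depend on ε, the turns n may not. -/
theorem hasTB (i j : Fin 3) {ε₀ : ℝ} (hε₀ : 0 < ε₀) (n : Fin 3 → Fin 3 → ℤ)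
    (hlift : ∀ ε ∈ Ioo 0 ε₀, ∃ A B : Fin 3 → ℝ,
      ∀ k l, HasLift (gap y ε k l) ε H (A k) (B l + 2 * Real.pi * n k l)) :
    hT.graph.HasTB i j (n i i + n j j - n i j - n j i) := by
  have hH := hT.height_pos
  obtain ⟨ε, hε, hε'⟩ := exists_between (lt_min hε₀ hH)
  rw [lt_min_iff] at hε'
  refine ⟨ε, hε, fun δ hδ => ?_, ?_⟩
  · obtain ⟨A, B, h⟩ := hlift δ ⟨hδ.1, hδ.2.trans_lt hε'.1⟩
    exact hT.cycle_ne_pushOff i j (fun k l h' hh => (h k l).ne_zero hh)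
  · obtain ⟨A, B, h⟩ := hlift ε ⟨hε, hε'.1⟩
    exact hT.hasLinkingNumber i j hε hε'.2 A B n h

/-- The rotation number of a cycle, from the continuous angles of the velocities of its edges. -/
theorem hasRot (i j : Fin 3) {α β : Fin 3 → ℝ}
    (hlift : ∀ k, HasLift (fun s => ⟨y k s, deriv (y k) s⟩) 0 (E k) (α k) (β k)) (n m : ℤ)
    (hend : |β j + Real.pi * (2 * m + 1) - β i| < Real.pi)
    (hstart : |α i + 2 * Real.pi * n - (α j + Real.pi * (2 * m + 1))| < Real.pi) :
    hT.graph.HasRot i j n := by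
  choose Θ hc h0 h1 hang using hlift
  have hmem : ∀ k, ∀ t ∈ Icc (0 : ℝ) 1, E k * t ∈ Icc 0 (E k) := fun k t ht =>
    ⟨mul_nonneg (hT.length_pos k).le ht.1, mul_le_of_le_one_right (hT.length_pos k).le ht.2⟩
  have hcont : ∀ k (a : ℝ), ContinuousOn (fun t => Θ k (E k * t) + a) (Icc 0 1) := fun k a =>
    ((hc k).comp (by fun_prop) (hmem k)).add continuousOn_const
  -- The velocity (y, y', y²) is y' times the first minus y times the second frame vector, so the
  -- contact angle is the planar angle minus π/2.
  have key : ∀ k (σ : ℝ) (θ : ℝ) t, HasAngle (σ * ⟨y k (E k * t), deriv (y k) (E k * t)⟩) θ →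
      HasContactAngle (hT.graph.edge k t) (σ • deriv (hT.graph.edge k) t)
        (θ - Real.pi / 2) := by
    intro k σ θ t hθ
    obtain ⟨r, hr, hre, him⟩ := hθ.re_eq
    rw [Complex.re_ofReal_mul] at hre
    rw [Complex.im_ofReal_mul] at him
    have hE := hT.length_pos k
    refine ⟨E k * r, mul_pos hE hr, ?_⟩
    have hd : deriv (hT.graph.edge k) t = _ := (hT.hasDerivAt_edge k t).deriv
    rw [hd, Real.cos_sub_pi_div_two, Real.sin_sub_pi_div_two, graph_edge]
    simp only at hre him
    ext a
    fin_cases a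
    · simp [frame1, frame2]
      linear_combination E k * hre
    · simp [frame1, frame2]
      linear_combination E k * him
    · simp [frame1, frame2, spacePoint]
      linear_combination E k * y k (E k * t) * hre
  refine ⟨fun t => Θ i (E i * t) + -(Real.pi / 2),
    fun t => Θ j (E j * t) + (Real.pi * (2 * m + 1) - Real.pi / 2), hcont i _, hcont j _,
    fun t ht => ?_, fun t ht => ?_, ?_, ?_⟩
  · have := key i 1 _ t (by simpa using hang i _ (hmem i t ht))
    rwa [one_smul, sub_eq_add_neg] at this
  · have h2 : HasAngle ((-1 : ℝ) * ⟨y j (E j * t), deriv (y j) (E j * t)⟩)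
        (Θ j (E j * t) + Real.pi * (2 * m + 1)) := by
      have h3 := ((hang j _ (hmem j t ht)).mul_exp Real.pi).add_int_mul_two_pi m
      rw [Complex.exp_pi_mul_I] at h3
      convert h3 using 1
      · push_cast; ring
      · ring
    have := key j (-1) _ t h2
    rw [neg_smul, one_smul] at this
    convert this using 1
    ring
  · simp only [mul_one, h1]
    convert hend using 2
    ring
  · simp only [mul_zero, h0]
    convert hstart using 2
    ring

end IsTheta

/-! ### Ambient isotopies -/

/-- An ambient isotopy of space carries `K` onto `L`. -/
def AmbientIsotopic (K L : Set R3) : Prop :=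
  ∃ H : unitInterval → (R3 ≃ₜ R3),
    Continuous (fun q : unitInterval × R3 => H q.1 q.2) ∧ (∀ p, H 0 p = p) ∧ H 1 '' K = L

theorem AmbientIsotopic.trans {K L M : Set R3} (h : AmbientIsotopic K L)
    (h' : AmbientIsotopic L M) : AmbientIsotopic K M := by
  obtain ⟨F, hF, hF0, hF1⟩ := h
  obtain ⟨G, hG, hG0, hG1⟩ := h'
  refine ⟨fun t => (F t).trans (G t), ?_, fun p => by simp [hF0, hG0], ?_⟩
  · exact hG.comp (continuous_fst.prodMk hF)
  · rw [← hG1, ← hF1, Set.image_image]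
    rfl

theorem AmbientIsotopic.isUnknot {K : Set R3} (h : AmbientIsotopic K roundCircle) :
    IsUnknot K := h

theorem continuous_atHeight {X : Type*} [TopologicalSpace X] {f : X → ℂ} {g : X → ℝ}
    (hf : Continuous f) (hg : Continuous g) : Continuous fun x => atHeight (f x) (g x) := by
  refine continuous_pi fun i => ?_
  fin_cases i
  · exact Complex.continuous_re.comp hf
  · exact Complex.continuous_im.comp hf
  · exact hg

/-- The horizontal coordinates of a point of space, as a complex number. -/
def planar (p : R3) : ℂ := ⟨p 0, p 1⟩

theorem continuous_planar : Continuous planar := by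
  have : planar = fun p : R3 => ((p 0 : ℝ) : ℂ) + (p 1 : ℝ) * Complex.I := by
    ext p
    exact Complex.mk_eq_add_mul_I _ _
  rw [this]
  exact (Complex.continuous_ofReal.comp (continuous_apply 0)).add
    ((Complex.continuous_ofReal.comp (continuous_apply 1)).mul continuous_const)

@[simp] theorem atHeight_planar (p : R3) : atHeight (planar p) (p 2) = p := by
  ext i
  fin_cases i <;> simp [atHeight, planar]

@[simp] theorem planar_atHeight (ζ : ℂ) (h : ℝ) : planar (atHeight ζ h) = ζ := by
  apply Complex.ext <;> simp [atHeight, planar]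

@[simp] theorem atHeight_two (ζ : ℂ) (h : ℝ) : atHeight ζ h 2 = h := by
  simp [atHeight]

/-- Horizontal planes may be translated, rotated and scaled, depending on the height. -/
theorem ambientIsotopic_fiberwise (K : Set R3) {m ℓ : ℝ → ℂ} (hm : Continuous m)
    (hℓ : Continuous ℓ) :
    AmbientIsotopic K
      ((fun p => atHeight (Complex.exp (-ℓ (p 2)) * (planar p - m (p 2))) (p 2)) '' K) := by
  have h2 : Continuous fun p : R3 => p 2 := continuous_apply 2
  refine ⟨fun t =>
    { toFun := fun p => atHeight (Complex.exp (-((t : ℝ) : ℂ) * ℓ (p 2)) *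
        (planar p - (t : ℝ) * m (p 2))) (p 2)
      invFun := fun p => atHeight (Complex.exp (((t : ℝ) : ℂ) * ℓ (p 2)) * planar p +
        (t : ℝ) * m (p 2)) (p 2)
      left_inv := fun p => ?_
      right_inv := fun p => ?_
      continuous_toFun := ?_
      continuous_invFun := ?_ }, ?_, fun p => ?_, ?_⟩
  · simp only [planar_atHeight, atHeight_two]
    rw [← mul_assoc, ← Complex.exp_add, neg_mul, add_neg_cancel, Complex.exp_zero, one_mul,
      sub_add_cancel, atHeight_planar]
  · simp only [planar_atHeight, atHeight_two]
    rw [add_sub_cancel_right, ← mul_assoc, ← Complex.exp_add, neg_mul, neg_add_cancel,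
      Complex.exp_zero, one_mul, atHeight_planar]
  · exact continuous_atHeight ((Complex.continuous_exp.comp
      (continuous_const.mul (hℓ.comp h2))).mul
      (continuous_planar.sub (continuous_const.mul (hm.comp h2)))) h2
  · exact continuous_atHeight (((Complex.continuous_exp.comp
      (continuous_const.mul (hℓ.comp h2))).mul continuous_planar).add
      (continuous_const.mul (hm.comp h2))) h2
  · have ht : Continuous fun q : unitInterval × R3 => (((q.1 : ℝ)) : ℂ) :=
      Complex.continuous_ofReal.comp (continuous_subtype_val.comp continuous_fst)
    have h3 : Continuous fun q : unitInterval × R3 => q.2 2 := h2.comp continuous_snd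
    exact continuous_atHeight ((Complex.continuous_exp.comp (ht.neg.mul (hℓ.comp h3))).mul
      ((continuous_planar.comp continuous_snd).sub (ht.mul (hm.comp h3)))) h3
  · change atHeight _ _ = p
    simp
  · refine Set.image_congr fun p _ => ?_
    change atHeight _ _ = _
    simp

/-- Heights may be changed by an increasing homeomorphism of the line. -/
theorem ambientIsotopic_height (K : Set R3) {f : ℝ → ℝ} (hf : StrictMono f) (hc : Continuous f)
    (htop : Tendsto f atTop atTop) (hbot : Tendsto f atBot atBot) :
    AmbientIsotopic K ((fun p => atHeight (planar p) (f (p 2))) '' K) := by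
  let g : unitInterval → ℝ → ℝ := fun t z => (1 - t) * z + t * f z
  have hg : ∀ t, StrictMono (g t) := by
    intro t a b hab
    have h0 := t.2.1
    have h1 := t.2.2
    have := hf hab
    simp only [g]
    rcases h1.eq_or_lt with e | h1
    · rw [e]; linarith
    · nlinarith
  have hgc : Continuous fun q : unitInterval × ℝ => g q.1 q.2 := by
    have ht : Continuous fun q : unitInterval × ℝ => (q.1 : ℝ) :=
      continuous_subtype_val.comp continuous_fst
    exact ((continuous_const.sub ht).mul continuous_snd).add (ht.mul (hc.comp continuous_snd))
  have hgc1 : ∀ t, Continuous (g t) := fun t =>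
    hgc.comp (continuous_const.prodMk continuous_id)
  have hgs : ∀ t, Function.Surjective (g t) := by
    intro t
    have h0 := t.2.1
    have h1 := t.2.2
    refine (hgc1 t).surjective ?_ ?_
    · refine tendsto_atTop.2 fun b => ?_
      filter_upwards [eventually_ge_atTop b, tendsto_atTop.1 htop b] with z hz hz'
      simp only [g]
      nlinarith
    · refine tendsto_atBot.2 fun b => ?_
      filter_upwards [eventually_le_atBot b, tendsto_atBot.1 hbot b] with z hz hz'
      simp only [g]
      nlinarith
  let e : unitInterval → (ℝ ≃ₜ ℝ) := fun t =>
    ((hg t).orderIsoOfSurjective (g t) (hgs t)).toHomeomorph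
  have he : ∀ t z, e t z = g t z := fun t z => rfl
  have h2 : Continuous fun p : R3 => p 2 := continuous_apply 2
  refine ⟨fun t =>
    { toFun := fun p => atHeight (planar p) (e t (p 2))
      invFun := fun p => atHeight (planar p) ((e t).symm (p 2))
      left_inv := fun p => by simp
      right_inv := fun p => by simp
      continuous_toFun := continuous_atHeight continuous_planar ((e t).continuous.comp h2)
      continuous_invFun :=
        continuous_atHeight continuous_planar ((e t).symm.continuous.comp h2) }, ?_,
    fun p => ?_, ?_⟩
  · exact continuous_atHeight (continuous_planar.comp continuous_snd)
      (hgc.comp (continuous_fst.prodMk (h2.comp continuous_snd)))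
  · change atHeight (planar p) (g 0 (p 2)) = p
    simp [g]
  · refine Set.image_congr fun p _ => ?_
    change atHeight (planar p) (g 1 (p 2)) = _
    simp [g]

/-- A quarter turn about the `x`-axis. -/
theorem ambientIsotopic_quarterTurn (K : Set R3) :
    AmbientIsotopic K ((fun p : R3 => (![p 0, -p 2, p 1] : R3)) '' K) := by
  let rot : ℝ → R3 → R3 := fun θ p =>
    ![p 0, Real.cos θ * p 1 - Real.sin θ * p 2, Real.sin θ * p 1 + Real.cos θ * p 2]
  have hrot : Continuous fun q : ℝ × R3 => rot q.1 q.2 := by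
    refine continuous_pi fun i => ?_
    fin_cases i <;> simp [rot] <;> fun_prop
  have hinv : ∀ θ p, rot (-θ) (rot θ p) = p := by
    intro θ p
    have := Real.sin_sq_add_cos_sq θ
    ext i
    fin_cases i
    · simp [rot]
    · simp [rot]
      linear_combination p 1 * this
    · simp [rot]
      linear_combination p 2 * this
  have h1 : ∀ θ, Continuous (rot θ) := fun θ => hrot.comp (continuous_const.prodMk continuous_id)
  refine ⟨fun t =>
    { toFun := rot (Real.pi / 2 * t)
      invFun := rot (-(Real.pi / 2 * t))
      left_inv := hinv _
      right_inv := fun p => by simpa using hinv (-(Real.pi / 2 * t)) p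
      continuous_toFun := h1 _
      continuous_invFun := h1 _ }, ?_, fun p => ?_, ?_⟩
  · exact hrot.comp ((continuous_const.mul
      (continuous_subtype_val.comp continuous_fst)).prodMk continuous_snd)
  · change rot (Real.pi / 2 * (0 : ℝ)) p = p
    ext i
    fin_cases i <;> simp [rot]
  · refine Set.image_congr fun p _ => ?_
    change rot (Real.pi / 2 * (1 : ℝ)) p = _
    ext i
    fin_cases i <;> simp [rot]

/-- An increasing homeomorphism of the line which makes the two parabolic arcs `x = ±(1 - u²)` a
round circle. -/
noncomputable def roundingHeight (u : ℝ) : ℝ := u * √(2 - min (u ^ 2) 1)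

theorem continuous_roundingHeight : Continuous roundingHeight := by
  unfold roundingHeight
  fun_prop

theorem one_le_sqrt_two_sub_min (u : ℝ) : 1 ≤ √(2 - min (u ^ 2) 1) := by
  rw [Real.one_le_sqrt]
  linarith [min_le_right (u ^ 2) 1]

theorem roundingHeight_sq (u : ℝ) : roundingHeight u ^ 2 = u ^ 2 * (2 - min (u ^ 2) 1) := by
  rw [roundingHeight, mul_pow, Real.sq_sqrt]
  linarith [min_le_right (u ^ 2) 1]

theorem strictMono_roundingHeight : StrictMono roundingHeight := by
  refine strictMono_of_odd_strictMonoOn_nonneg (fun u => by simp [roundingHeight]) ?_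
  intro a ha b hb hab
  have ha' : (0 : ℝ) ≤ a := ha
  have hb' : 0 < b := lt_of_le_of_lt ha' hab
  have hb1 := one_le_sqrt_two_sub_min b
  have hpos : 0 ≤ roundingHeight b := by unfold roundingHeight; positivity
  refine lt_of_pow_lt_pow_left₀ 2 hpos ?_
  rw [roundingHeight_sq, roundingHeight_sq]
  have hsq : a ^ 2 < b ^ 2 := by nlinarith
  have h0 : 0 ≤ a ^ 2 := sq_nonneg a
  rcases le_total (b ^ 2) 1 with h | h
  · rw [min_eq_left h, min_eq_left (by linarith)]
    nlinarith
  · rw [min_eq_right h]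
    rcases le_total (a ^ 2) 1 with h' | h'
    · rw [min_eq_left h']
      rcases h.eq_or_lt with e | h
      · rw [← e] at hsq ⊢; nlinarith
      · nlinarith [sq_nonneg (1 - a ^ 2)]
    · rw [min_eq_right h']; linarith

theorem tendsto_roundingHeight_atTop : Tendsto roundingHeight atTop atTop := by
  refine tendsto_atTop_mono' _ ?_ tendsto_id
  filter_upwards [eventually_ge_atTop 0] with u hu
  simp only [id, roundingHeight]
  nlinarith [one_le_sqrt_two_sub_min u]

theorem tendsto_roundingHeight_atBot : Tendsto roundingHeight atBot atBot := by
  refine tendsto_atBot_mono' _ ?_ tendsto_id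
  filter_upwards [eventually_le_atBot 0] with u hu
  simp only [id, roundingHeight]
  nlinarith [one_le_sqrt_two_sub_min u]

/-- A closed curve which consists of two ascending strands, given by their positions `P` and `Q`
at each height, is unknotted. -/
theorem isUnknot_of_two_strands {P Q : ℝ → ℂ} {H : ℝ} (hH : 0 < H) (hP : Continuous P)
    (hQ : Continuous Q) (h0 : P 0 = Q 0) (h1 : P H = Q H) (hne : ∀ h ∈ Ioo 0 H, P h ≠ Q h)
    {D₀ D₁ : ℂ} (hD₀ : HasDerivAt (P - Q) D₀ 0) (hD₁ : HasDerivAt (P - Q) D₁ H)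
    (hD₀' : D₀ ≠ 0) (hD₁' : D₁ ≠ 0) :
    IsUnknot ((fun h => atHeight (P h) h) '' Icc 0 H ∪ (fun h => atHeight (Q h) h) '' Icc 0 H) := by
  set D := P - Q with hD
  have hDc : Continuous D := hP.sub hQ
  have hD0 : D 0 = 0 := by simp [hD, h0]
  have hDH : D H = 0 := by simp [hD, h1]
  let q₁ := dslope D 0
  have hq₁ : ∀ h, D h = h • q₁ h := fun h => by
    have := sub_smul_dslope D 0 h
    rw [hD0, sub_zero, sub_zero] at this
    exact this.symm
  have hq₁c : Continuous q₁ := by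
    rw [← continuousOn_univ, continuousOn_dslope univ_mem]
    exact ⟨hDc.continuousOn, hD₀.differentiableAt⟩
  have hq₁H : q₁ H = 0 := by
    have := hq₁ H
    rw [hDH] at this
    exact (smul_eq_zero.1 this.symm).resolve_left hH.ne'
  have hq₁d : HasDerivAt q₁ (H⁻¹ • D₁) H := by
    have hinv : HasDerivAt (fun h : ℝ => h⁻¹) (-(H ^ 2)⁻¹) H := hasDerivAt_inv hH.ne'
    have h3 := hinv.smul hD₁
    rw [hDH, smul_zero, add_zero] at h3
    refine h3.congr_of_eventuallyEq ?_
    filter_upwards [lt_mem_nhds hH] with h hh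
    simp only [Pi.smul_apply', hq₁ h]
    rw [smul_smul, inv_mul_cancel₀ hh.ne', one_smul]
  let q := dslope q₁ H
  have hq : ∀ h, q₁ h = (h - H) • q h := fun h => by
    have := sub_smul_dslope q₁ H h
    rw [hq₁H, sub_zero] at this
    exact this.symm
  have hqc : Continuous q := by
    rw [← continuousOn_univ, continuousOn_dslope univ_mem]
    exact ⟨hq₁c.continuousOn, hq₁d.differentiableAt⟩
  have hq0 : ∀ h ∈ Icc 0 H, q h ≠ 0 := by
    intro h hh e
    have h4 : q₁ h = 0 := by rw [hq h, e, smul_zero]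
    rcases hh.1.eq_or_lt with rfl | hl
    · have : q₁ 0 = D₀ := by
        rw [← hD₀.deriv]
        exact dslope_same _ _
      exact hD₀' (this.symm.trans h4)
    · rcases hh.2.eq_or_lt with rfl | hr
      · have : q h = h⁻¹ • D₁ := by
          rw [← hq₁d.deriv]
          exact dslope_same _ _
        rw [this] at e
        exact hD₁' ((smul_eq_zero.1 e).resolve_left (inv_ne_zero hH.ne'))
      · have : D h = 0 := by rw [hq₁ h, h4, smul_zero]
        exact hne h ⟨hl, hr⟩ (sub_eq_zero.1 this)
  -- With u = 2h/H - 1 one has h (h - H) = -(H²/4)(1 - u²). The factor -H²/8 makes half the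
  -- difference of the strands equal to (1 - u²) R.
  let R : ℝ → ℂ := fun h => ((-(H ^ 2) / 8 : ℝ) : ℂ) * q h
  have hRc : Continuous R := continuous_const.mul hqc
  have hR0 : ∀ h ∈ Icc 0 H, R h ≠ 0 := fun h hh =>
    mul_ne_zero (by
      have : (-(H ^ 2) / 8 : ℝ) ≠ 0 := by
        have : H ^ 2 ≠ 0 := pow_ne_zero 2 hH.ne'
        intro e
        apply this
        linarith
      exact_mod_cast this) (hq0 h hh)
  have hDR : ∀ h, D h = ((2 * (1 - (2 * h / H - 1) ^ 2) : ℝ) : ℂ) * R h := by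
    intro h
    rw [hq₁ h, hq h, smul_smul, Complex.real_smul]
    simp only [R]
    rw [← mul_assoc, ← Complex.ofReal_mul]
    congr 2
    field_simp
    ring
  -- A continuous logarithm of R, by path lifting for the exponential covering. Subtracting the
  -- midpoint and multiplying by exp (-ℓ) then turns the strands into the arcs x = ±(1 - u²).
  obtain ⟨ℓ, hℓc, hℓ⟩ : ∃ ℓ : ℝ → ℂ, Continuous ℓ ∧ ∀ h ∈ Icc 0 H, Complex.exp (ℓ h) = R h := by
    have hmem : ∀ t : unitInterval, H * t ∈ Icc 0 H := fun t =>
      ⟨mul_nonneg hH.le t.2.1, mul_le_of_le_one_right hH.le t.2.2⟩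
    let γ : C(unitInterval, {z : ℂ // z ≠ 0}) :=
      ⟨fun t => ⟨R (H * t), hR0 _ (hmem t)⟩, Continuous.subtype_mk
        (hRc.comp (continuous_const.mul continuous_subtype_val)) _⟩
    have hγ0 : γ 0 = ⟨_, (Complex.log (R (H * (0 : unitInterval)))).exp_ne_zero⟩ := by
      apply Subtype.ext
      simp only [γ, ContinuousMap.coe_mk]
      rw [Complex.exp_log (hR0 _ (hmem 0))]
    obtain ⟨Γ, hΓ, -⟩ := Complex.isCoveringMap_exp.exists_path_lifts γ
      (Complex.log (R (H * (0 : unitInterval)))) hγ0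
    refine ⟨fun h => Γ (projIcc 0 1 zero_le_one (h / H)), ?_, fun h hh => ?_⟩
    · exact Γ.continuous.comp (continuous_projIcc.comp (continuous_id.div_const H))
    · have h5 : h / H ∈ Icc (0 : ℝ) 1 := ⟨div_nonneg hh.1 hH.le, (div_le_one hH).2 hh.2⟩
      have h6 := congrFun hΓ (projIcc 0 1 zero_le_one (h / H))
      have h7 := congrArg Subtype.val h6
      simp only [Function.comp_apply, γ, ContinuousMap.coe_mk] at h7
      rw [h7, projIcc_of_mem zero_le_one h5]
      congr 1
      field_simp
  have hm : Continuous fun h => (P h + Q h) / 2 := (hP.add hQ).div_const 2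
  let f : ℝ → ℝ := fun z => roundingHeight (2 * z / H - 1)
  have hfm : StrictMono f := fun a b hab => strictMono_roundingHeight (by
    have : 2 * a / H < 2 * b / H := by
      rw [div_lt_div_iff_of_pos_right hH]; linarith
    linarith)
  have hfc : Continuous f := continuous_roundingHeight.comp (by fun_prop)
  have hft : Tendsto f atTop atTop := tendsto_roundingHeight_atTop.comp
    (tendsto_atTop_add_const_right _ _ ((tendsto_id.const_mul_atTop two_pos).atTop_div_const hH))
  have hfb : Tendsto f atBot atBot := tendsto_roundingHeight_atBot.comp
    (tendsto_atBot_add_const_right _ _ ((tendsto_id.const_mul_atBot two_pos).atBot_div_const hH))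
  refine AmbientIsotopic.isUnknot ?_
  have step := ((ambientIsotopic_fiberwise ((fun h => atHeight (P h) h) '' Icc 0 H ∪
    (fun h => atHeight (Q h) h) '' Icc 0 H) hm hℓc).trans
    (ambientIsotopic_height _ hfm hfc hft hfb)).trans (ambientIsotopic_quarterTurn _)
  have hexp : ∀ h ∈ Icc 0 H, ∀ x : ℝ, Complex.exp (-ℓ h) * (x * R h) = x := by
    intro h hh x
    rw [← hℓ h hh, mul_left_comm, ← Complex.exp_add, neg_add_cancel, Complex.exp_zero, mul_one]
  have himP : ∀ h ∈ Icc 0 H, Complex.exp (-ℓ h) * (P h - (P h + Q h) / 2) =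
      ((1 - (2 * h / H - 1) ^ 2 : ℝ) : ℂ) := by
    intro h hh
    rw [← hexp h hh, show P h - (P h + Q h) / 2 = D h / 2 by rw [hD, Pi.sub_apply]; ring, hDR h]
    push_cast
    ring
  have himQ : ∀ h ∈ Icc 0 H, Complex.exp (-ℓ h) * (Q h - (P h + Q h) / 2) =
      ((-(1 - (2 * h / H - 1) ^ 2) : ℝ) : ℂ) := by
    intro h hh
    rw [← hexp h hh, show Q h - (P h + Q h) / 2 = -(D h / 2) by rw [hD, Pi.sub_apply]; ring, hDR h]
    push_cast
    ring
  have humem : ∀ h ∈ Icc 0 H, (2 * h / H - 1) ^ 2 ≤ 1 := by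
    intro h hh
    have h8 : 2 * h / H - 1 ∈ Icc (-1 : ℝ) 1 := by
      constructor
      · have := div_nonneg (mul_nonneg zero_le_two hh.1) hH.le
        linarith
      · have : 2 * h / H ≤ 2 := by rw [div_le_iff₀ hH]; linarith [hh.2]
        linarith
    nlinarith [h8.1, h8.2]
  have hround : ∀ u : ℝ, u ^ 2 ≤ 1 → (1 - u ^ 2) ^ 2 + roundingHeight u ^ 2 = 1 := by
    intro u hu
    rw [roundingHeight_sq, min_eq_left hu]
    ring
  let F₁ : R3 → R3 := fun p =>
    atHeight (Complex.exp (-ℓ (p 2)) * (planar p - (P (p 2) + Q (p 2)) / 2)) (p 2)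
  let Φ : R3 → R3 := fun p =>
    ![atHeight (planar (F₁ p)) (f (F₁ p 2)) 0, -atHeight (planar (F₁ p)) (f (F₁ p 2)) 2,
      atHeight (planar (F₁ p)) (f (F₁ p 2)) 1]
  have hΦ : ∀ (Z : ℝ → ℂ) (h x : ℝ), Complex.exp (-ℓ h) * (Z h - (P h + Q h) / 2) = (x : ℂ) →
      Φ (atHeight (Z h) h) = ![x, -f h, 0] := by
    intro Z h x hx
    simp only [Φ, F₁, atHeight_two, planar_atHeight, hx]
    simp [atHeight]
  suffices himg : Φ '' ((fun h => atHeight (P h) h) '' Icc 0 H ∪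
      (fun h => atHeight (Q h) h) '' Icc 0 H) = roundCircle by
    rw [Set.image_image, Set.image_image] at step
    rwa [← himg]
  ext p
  constructor
  · rintro ⟨-, ⟨h, hh, rfl⟩ | ⟨h, hh, rfl⟩, rfl⟩
    · simp only [hΦ P h _ (himP h hh)]
      simpa [roundCircle] using hround _ (humem h hh)
    · simp only [hΦ Q h _ (himQ h hh)]
      have := hround _ (humem h hh)
      simp only [roundCircle, mem_ofPred_eq, Matrix.cons_val_zero, Matrix.cons_val_one, neg_sq]
      exact ⟨this, rfl⟩
  · rintro ⟨h1, h2⟩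
    obtain ⟨u, hu⟩ := continuous_roundingHeight.surjective tendsto_roundingHeight_atTop
      tendsto_roundingHeight_atBot (-p 1)
    have hu1 : u ^ 2 ≤ 1 := by
      have h3 : roundingHeight u ^ 2 ≤ 1 := by rw [hu]; nlinarith [sq_nonneg (p 0)]
      rw [roundingHeight_sq] at h3
      by_contra hlt
      rw [min_eq_right (not_le.1 hlt).le] at h3
      linarith
    have hu2 := abs_le.1 ((sq_le_one_iff_abs_le_one u).1 hu1)
    set h := H * (u + 1) / 2 with hh
    have hhI : h ∈ Icc 0 H := by
      constructor
      · rw [hh]; have := mul_nonneg hH.le (by linarith [hu2.1] : 0 ≤ u + 1); linarith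
      · rw [hh]; nlinarith [hu2.2]
    have huh : 2 * h / H - 1 = u := by
      rw [hh]; field_simp; ring
    have hfh : f h = -p 1 := by simp only [f]; rw [huh, hu]
    have hsq : p 0 ^ 2 = (1 - u ^ 2) ^ 2 := by
      have := hround u hu1
      rw [hu] at this
      linarith
    have hp : ∀ x, p 0 = x → (![x, -f h, 0] : R3) = p := by
      intro x hx
      rw [hfh]
      ext i
      fin_cases i
      · simp [hx]
      · simp
      · simp [h2]
    -- The sign of the first coordinate tells from which strand the point of the circle comes.
    rcases sq_eq_sq_iff_eq_or_eq_neg.1 hsq with e | e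
    · refine ⟨_, Or.inl ⟨h, hhI, rfl⟩, ?_⟩
      simp only [hΦ P h _ (himP h hhI)]
      exact hp _ (by rw [huh, e])
    · refine ⟨_, Or.inr ⟨h, hhI, rfl⟩, ?_⟩
      simp only [hΦ Q h _ (himQ h hhI)]
      exact hp _ (by rw [huh, e])

namespace IsTheta

variable {y : Fin 3 → ℝ → ℝ} {E : Fin 3 → ℝ} {H : ℝ} (hT : IsTheta y E H)

theorem cycleSet_eq (i j : Fin 3) : hT.graph.cycleSet i j =
    (fun h => atHeight (pos (y i) h) h) '' Icc 0 H ∪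
      (fun h => atHeight (pos (y j) h) h) '' Icc 0 H := by
  ext p
  constructor
  · rintro ⟨s, hs, rfl⟩
    obtain ⟨κ, h, hh, rfl⟩ := hT.exists_param i j hs
    rw [hT.cycle_param i j κ hh]
    fin_cases κ
    · exact Or.inl ⟨h, hh, rfl⟩
    · exact Or.inr ⟨h, hh, rfl⟩
  · rintro (⟨h, hh, rfl⟩ | ⟨h, hh, rfl⟩)
    · exact ⟨_, hT.param_mem_Icc i j 0 hh, hT.cycle_param i j 0 hh⟩
    · exact ⟨_, hT.param_mem_Icc i j 1 hh, hT.cycle_param i j 1 hh⟩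

/-- At the vertices y is positive, so the positions are differentiable in the height, and distinct
slopes make their difference vanish to first order only. This is what `isUnknot_of_two_strands`
requires. -/
theorem isUnknot {i j : Fin 3} (hij : i ≠ j) : IsUnknot (hT.graph.cycleSet i j) := by
  have hlev : ∀ k, level (y k) H = E k := fun k => by
    rw [(hT.strand k).level_eq_iff, hT.height]
  have hlev0 : ∀ k, level (y k) 0 = 0 := fun k => (hT.strand k).level_zero
  have hd0 := ((hT.strand i).hasDerivAt_pos (h := 0) (by rw [hlev0]; exact (hT.start_pos i).ne')).sub
    ((hT.strand j).hasDerivAt_pos (h := 0) (by rw [hlev0]; exact (hT.start_pos j).ne'))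
  have hdH := ((hT.strand i).hasDerivAt_pos (h := H) (by rw [hlev]; exact (hT.finish_pos i).ne')).sub
    ((hT.strand j).hasDerivAt_pos (h := H) (by rw [hlev]; exact (hT.finish_pos j).ne'))
  have hne : ∀ (a b c d : ℝ), 0 < a → c ≠ d →
      ((a ^ 2)⁻¹ * ⟨a, c⟩ - (a ^ 2)⁻¹ * ⟨a, d⟩ : ℂ) ≠ 0 := by
    intro a b c d ha hcd e
    rw [← mul_sub] at e
    have h1 : (((a ^ 2)⁻¹ : ℝ) : ℂ) ≠ 0 := by
      exact_mod_cast (inv_pos.2 (pow_pos ha 2)).ne'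
    have h2 := (mul_eq_zero.1 e).resolve_left h1
    have h3 := congrArg Complex.im h2
    simp only [Complex.sub_im, Complex.zero_im] at h3
    exact hcd (sub_eq_zero.1 h3)
  rw [cycleSet_eq]
  refine isUnknot_of_two_strands hT.height_pos (hT.strand i).continuous_pos
    (hT.strand j).continuous_pos ?_ ?_ (hT.disjoint i j hij) hd0 hdH ?_ ?_
  · simp [pos, hlev0, hT.start i j]
  · simp [pos, hlev, hT.finish_x i j, hT.finish_y i j]
  · rw [hlev0, hlev0, hT.start i j]
    exact hne _ 0 _ _ (hT.start_pos j) (hT.start_slope i j hij)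
  · rw [hlev, hlev, hT.finish_y i j]
    exact hne _ 0 _ _ (hT.finish_pos j) (hT.finish_slope i j hij)

end IsTheta

/-! ### Prolonging strands -/

/-- The strand determined by `y`, which is straight from the parameter `S` on, prolonged there by
the strand determined by `w`. -/
def prolong (y : ℝ → ℝ) (S : ℝ) (w : ℝ → ℝ) (s : ℝ) : ℝ := y s + w (s - S) - 1

theorem isStrand_one : IsStrand fun _ => 1 :=
  ⟨contDiff_const, fun s h => absurd h one_ne_zero, ⟨0, fun s _ => by norm_num⟩⟩

theorem xInt_glue {f g k : ℝ → ℝ} {S : ℝ} (hf : Continuous f) (hS : 0 ≤ S)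
    (h₁ : ∀ s ≤ S, f s = g s) (h₂ : ∀ s, S ≤ s → f s = k (s - S)) :
    (∀ s ≤ S, xInt f s = xInt g s) ∧ ∀ r, 0 ≤ r → xInt f (S + r) = xInt g S + xInt k r := by
  have hle : ∀ s ≤ S, xInt f s = xInt g s := fun s hs => by
    refine intervalIntegral.integral_congr fun u hu => h₁ u ?_
    rcases le_total 0 s with h | h
    · rw [uIcc_of_le h] at hu; exact hu.2.trans hs
    · rw [uIcc_of_ge h] at hu; exact hu.2.trans hS
  refine ⟨hle, fun r hr => ?_⟩
  have h3 := xInt_sub_eq hf S (S + r)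
  have h4 : ∫ u in S..(S + r), f u = xInt k r := by
    rw [intervalIntegral.integral_congr (g := fun u => k (u - S)) fun u hu => by
      rw [uIcc_of_le (by linarith)] at hu
      exact h₂ u hu.1, intervalIntegral.integral_comp_sub_right]
    simp [xInt]
  rw [h4, hle S le_rfl] at h3
  linarith

theorem xInt_of_eq_one_of_nonpos {w : ℝ → ℝ} (hw : ∀ s ≤ 0, w s = 1) {s : ℝ} (hs : s ≤ 0) :
    xInt w s = s := by
  rw [xInt, intervalIntegral.integral_congr (g := fun _ => (1 : ℝ)) fun u hu => by
    rw [uIcc_of_ge hs] at hu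
    exact hw u hu.2]
  simp

theorem zInt_of_eq_one_of_nonpos {w : ℝ → ℝ} (hw : ∀ s ≤ 0, w s = 1) {s : ℝ} (hs : s ≤ 0) :
    zInt w s = s :=
  xInt_of_eq_one_of_nonpos (w := fun s => w s ^ 2) (fun s hs => by simp [hw s hs]) hs

theorem pos_of_nonpos {w : ℝ → ℝ} (hs : IsStrand w) (hw : ∀ s ≤ 0, w s = 1) {h : ℝ} (hh : h ≤ 0) :
    pos w h = ⟨h, 1⟩ := by
  have := hs.pos_zInt h
  rwa [zInt_of_eq_one_of_nonpos hw hh, xInt_of_eq_one_of_nonpos hw hh, hw h hh] at this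

theorem xInt_of_eq_one_of_le {w : ℝ → ℝ} (hc : Continuous w) {a : ℝ} (hw : ∀ s, a ≤ s → w s = 1)
    {s : ℝ} (hs : a ≤ s) : xInt w s = xInt w a + (s - a) := by
  have h3 := xInt_sub_eq hc a s
  rw [intervalIntegral.integral_congr (g := fun _ => (1 : ℝ)) fun u hu => by
    rw [uIcc_of_le hs] at hu
    exact hw u hu.1] at h3
  simp at h3
  linarith

theorem zInt_of_eq_one_of_le {w : ℝ → ℝ} (hc : Continuous w) {a : ℝ} (hw : ∀ s, a ≤ s → w s = 1)
    {s : ℝ} (hs : a ≤ s) : zInt w s = zInt w a + (s - a) :=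
  xInt_of_eq_one_of_le (w := fun s => w s ^ 2) (hc.pow 2) (fun s hs => by simp [hw s hs]) hs

theorem level_of_eq_one_of_le {w : ℝ → ℝ} (hs : IsStrand w) {a : ℝ} (hw : ∀ s, a ≤ s → w s = 1)
    {h : ℝ} (hh : 0 ≤ h) : level w (zInt w a + h) = a + h := by
  rw [hs.level_eq_iff, zInt_of_eq_one_of_le hs.continuous hw (s := a + h) (by linarith)]
  ring

/-- While y = 1, both x and z grow with speed 1. The value of x - z is constant: the lane of the
straight strand. -/
theorem pos_of_eq_one_of_le {w : ℝ → ℝ} (hs : IsStrand w) {a : ℝ} (hw : ∀ s, a ≤ s → w s = 1)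
    {h : ℝ} (hh : 0 ≤ h) : pos w (zInt w a + h) = ⟨xInt w a + h, 1⟩ := by
  rw [pos, level_of_eq_one_of_le hs hw hh, hw _ (by linarith),
    xInt_of_eq_one_of_le hs.continuous hw (by linarith)]
  simp

theorem pos_one (h : ℝ) : pos (fun _ => 1) h = ⟨h, 1⟩ := by
  have hz : ∀ s, zInt (fun _ => 1) s = s := fun s => by simp [zInt]
  have hx : ∀ s, xInt (fun _ => 1) s = s := fun s => by simp [xInt]
  have := isStrand_one.pos_zInt h
  rwa [hz, hx] at this

section Prolong

variable {y w : ℝ → ℝ} {S : ℝ} (hy : IsStrand y) (hS : 0 ≤ S) (hyS : ∀ s, S ≤ s → y s = 1)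
  (hw : IsStrand w) (hw0 : ∀ s ≤ 0, w s = 1)

include hw0 in
theorem prolong_of_le {s : ℝ} (hs : s ≤ S) : prolong y S w s = y s := by
  rw [prolong, hw0 _ (by linarith)]
  ring

include hyS in
theorem prolong_of_ge {s : ℝ} (hs : S ≤ s) : prolong y S w s = w (s - S) := by
  rw [prolong, hyS _ hs]
  ring

include hw0 in
theorem deriv_prolong_of_lt {s : ℝ} (hs : s < S) : deriv (prolong y S w) s = deriv y s := by
  refine EventuallyEq.deriv_eq ?_
  filter_upwards [gt_mem_nhds hs] with t ht using prolong_of_le hw0 ht.le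

include hyS in
theorem deriv_prolong_of_gt {s : ℝ} (hs : S < s) :
    deriv (prolong y S w) s = deriv w (s - S) := by
  rw [← deriv_comp_sub_const (f := w) (a := S)]
  refine EventuallyEq.deriv_eq ?_
  filter_upwards [lt_mem_nhds hs] with t ht using prolong_of_ge hyS ht.le

include hy hyS hw hw0 in
theorem isStrand_prolong : IsStrand (prolong y S w) where
  smooth := (hy.smooth.add (hw.smooth.comp (contDiff_id.sub contDiff_const))).sub contDiff_const
  regular s hs := by
    rcases lt_trichotomy s S with h | h | h
    · rw [prolong_of_le hw0 h.le] at hs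
      rw [deriv_prolong_of_lt hw0 h]
      exact hy.regular s hs
    · rw [prolong_of_le hw0 h.le, hyS s h.ge] at hs
      exact absurd hs one_ne_zero
    · rw [prolong_of_ge hyS h.le] at hs
      rw [deriv_prolong_of_gt hyS h]
      exact hw.regular _ hs
  away := by
    obtain ⟨R, hR⟩ := hy.away
    obtain ⟨R', hR'⟩ := hw.away
    refine ⟨max R (|S| + |R'|), fun s hs => ?_⟩
    rcases le_total s S with h | h
    · rw [prolong_of_le hw0 h]
      exact hR s ((le_max_left _ _).trans hs)
    · rw [prolong_of_ge hyS h]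
      refine hR' _ ?_
      have h1 := (le_max_right R (|S| + |R'|)).trans hs
      have h2 := abs_sub_abs_le_abs_sub s S
      linarith [le_abs_self R']

include hy hS hyS hw hw0 in
theorem xInt_prolong : (∀ s ≤ S, xInt (prolong y S w) s = xInt y s) ∧
    ∀ r, 0 ≤ r → xInt (prolong y S w) (S + r) = xInt y S + xInt w r :=
  xInt_glue (isStrand_prolong hy hyS hw hw0).continuous hS (fun _ hs => prolong_of_le hw0 hs)
    fun _ hs => prolong_of_ge hyS hs

include hy hS hyS hw hw0 in
theorem zInt_prolong : (∀ s ≤ S, zInt (prolong y S w) s = zInt y s) ∧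
    ∀ r, 0 ≤ r → zInt (prolong y S w) (S + r) = zInt y S + zInt w r :=
  xInt_glue (g := fun s => y s ^ 2) (k := fun s => w s ^ 2)
    ((isStrand_prolong hy hyS hw hw0).continuous.pow 2) hS
    (fun _ hs => by simp only [prolong_of_le hw0 hs])
    fun _ hs => by simp only [prolong_of_ge hyS hs]

include hy hS hyS hw hw0 in
theorem pos_prolong_of_le {h : ℝ} (hh : h ≤ zInt y S) :
    pos (prolong y S w) h = pos y h := by
  have hl : level y h ≤ S := by rwa [hy.level_le_iff]
  have h1 : level (prolong y S w) h = level y h := by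
    rw [(isStrand_prolong hy hyS hw hw0).level_eq_iff,
      (zInt_prolong hy hS hyS hw hw0).1 _ hl, hy.zInt_level]
  rw [pos, h1, pos, (xInt_prolong hy hS hyS hw hw0).1 _ hl, prolong_of_le hw0 hl]

include hy hS hyS hw hw0 in
theorem level_prolong_add {h : ℝ} (hh : 0 ≤ h) :
    level (prolong y S w) (zInt y S + h) = S + level w h := by
  have hl : 0 ≤ level w h := by rwa [hw.le_level_iff, zInt_zero]
  rw [(isStrand_prolong hy hyS hw hw0).level_eq_iff,
    (zInt_prolong hy hS hyS hw hw0).2 _ hl, hw.zInt_level]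

include hy hS hyS hw hw0 in
theorem pos_prolong_add {h : ℝ} (hh : 0 ≤ h) :
    pos (prolong y S w) (zInt y S + h) = xInt y S + pos w h := by
  have hl : 0 ≤ level w h := by rwa [hw.le_level_iff, zInt_zero]
  rw [pos, level_prolong_add hy hS hyS hw hw0 hh, (xInt_prolong hy hS hyS hw hw0).2 _ hl,
    prolong_of_ge hyS (by linarith), add_sub_cancel_left, pos]
  apply Complex.ext <;> simp

include hy hw hw0 in
/-- The formula for the prolonged strand also holds shortly before the prolongation starts. -/
theorem pos_prolong_add' (hS : 1 ≤ S) (hyS : ∀ s, S - 1 ≤ s → y s = 1) {h : ℝ} (hh : -1 ≤ h) :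
    pos (prolong y S w) (zInt y S + h) = xInt y S + pos w h := by
  have hyS' : ∀ s, S ≤ s → y s = 1 := fun s hs => hyS s (by linarith)
  rcases le_total 0 h with h0 | h0
  · exact pos_prolong_add hy (by linarith) hyS' hw hw0 h0
  -- The last unit of `y` lies on the straight line along which `w` is continued to negative
  -- heights. Gaps compare the heights h and h - ε, so the formula is needed below the joint as
  -- well.
  · rw [pos_prolong_of_le hy (by linarith) hyS' hw hw0 (by linarith), pos_of_nonpos hw hw0 h0]
    have h1 := zInt_of_eq_one_of_le hy.continuous hyS (s := S) (by linarith)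
    have h2 := xInt_of_eq_one_of_le hy.continuous hyS (s := S) (by linarith)
    have h3 := pos_of_eq_one_of_le hy hyS (h := 1 + h) (by linarith)
    rw [h1, h2, show zInt y (S - 1) + (S - (S - 1)) + h = zInt y (S - 1) + (1 + h) by ring, h3]
    apply Complex.ext <;> simp
    ring

end Prolong

/-! ### Lifts of paths in half planes with a vertical or horizontal boundary -/

namespace HasLift

variable {P : ℝ → ℂ} {α β θ₀ θ₁ : ℝ}

theorem of_halfPlane' (hP : ContinuousOn P (Icc α β)) {c : ℝ} {e : ℂ}
    (hc : Complex.exp ((-c : ℝ) * Complex.I) = e) (k : ℤ) (h0 : ∀ t ∈ Icc α β, P t ≠ 0)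
    (him : ∀ t ∈ Icc α β, 0 ≤ (P t * e).im) (hα : HasAngle (P α) θ₀) (hβ : HasAngle (P β) θ₁)
    (hθ₀ : θ₀ ∈ Icc (2 * Real.pi * k + c) (2 * Real.pi * k + c + Real.pi))
    (hθ₁ : θ₁ ∈ Icc (2 * Real.pi * k + c) (2 * Real.pi * k + c + Real.pi)) :
    HasLift P α β θ₀ θ₁ := by
  have h1 := hα.add_int_mul_two_pi (-k)
  have h2 := hβ.add_int_mul_two_pi (-k)
  push_cast at h1 h2
  have := (of_halfPlane hP c h0 (by rwa [hc]) h1 h2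
    ⟨by linarith [hθ₀.1], by linarith [hθ₀.2]⟩
    ⟨by linarith [hθ₁.1], by linarith [hθ₁.2]⟩).add_int_mul_two_pi k
  convert this using 1 <;> ring

theorem of_im_nonneg (hP : ContinuousOn P (Icc α β)) (k : ℤ) (h0 : ∀ t ∈ Icc α β, P t ≠ 0)
    (him : ∀ t ∈ Icc α β, 0 ≤ (P t).im) (hα : HasAngle (P α) θ₀) (hβ : HasAngle (P β) θ₁)
    (hθ₀ : θ₀ ∈ Icc (2 * Real.pi * k) (2 * Real.pi * k + Real.pi))
    (hθ₁ : θ₁ ∈ Icc (2 * Real.pi * k) (2 * Real.pi * k + Real.pi)) :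
    HasLift P α β θ₀ θ₁ :=
  of_halfPlane' hP (c := 0) (e := 1) (by simp) k h0 (by simpa using him) hα hβ (by simpa using hθ₀)
    (by simpa using hθ₁)

theorem of_im_nonpos (hP : ContinuousOn P (Icc α β)) (k : ℤ) (h0 : ∀ t ∈ Icc α β, P t ≠ 0)
    (him : ∀ t ∈ Icc α β, (P t).im ≤ 0) (hα : HasAngle (P α) θ₀) (hβ : HasAngle (P β) θ₁)
    (hθ₀ : θ₀ ∈ Icc (2 * Real.pi * k - Real.pi) (2 * Real.pi * k))
    (hθ₁ : θ₁ ∈ Icc (2 * Real.pi * k - Real.pi) (2 * Real.pi * k)) :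
    HasLift P α β θ₀ θ₁ :=
  of_halfPlane' hP (c := -Real.pi) (e := -1) (by simp) k h0 (by simpa using him) hα hβ
    ⟨by linarith [hθ₀.1], by linarith [hθ₀.2]⟩ ⟨by linarith [hθ₁.1], by linarith [hθ₁.2]⟩

theorem of_re_nonneg (hP : ContinuousOn P (Icc α β)) (k : ℤ) (h0 : ∀ t ∈ Icc α β, P t ≠ 0)
    (hre : ∀ t ∈ Icc α β, 0 ≤ (P t).re) (hα : HasAngle (P α) θ₀) (hβ : HasAngle (P β) θ₁)
    (hθ₀ : θ₀ ∈ Icc (2 * Real.pi * k - Real.pi / 2) (2 * Real.pi * k + Real.pi / 2))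
    (hθ₁ : θ₁ ∈ Icc (2 * Real.pi * k - Real.pi / 2) (2 * Real.pi * k + Real.pi / 2)) :
    HasLift P α β θ₀ θ₁ :=
  of_halfPlane' hP (c := -(Real.pi / 2)) (e := Complex.I)
    (by rw [neg_neg]; push_cast; exact Complex.exp_pi_div_two_mul_I) k h0 (by simpa using hre) hα hβ
    ⟨by linarith [hθ₀.1], by linarith [hθ₀.2]⟩ ⟨by linarith [hθ₁.1], by linarith [hθ₁.2]⟩

theorem of_re_nonpos (hP : ContinuousOn P (Icc α β)) (k : ℤ) (h0 : ∀ t ∈ Icc α β, P t ≠ 0)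
    (hre : ∀ t ∈ Icc α β, (P t).re ≤ 0) (hα : HasAngle (P α) θ₀) (hβ : HasAngle (P β) θ₁)
    (hθ₀ : θ₀ ∈ Icc (2 * Real.pi * k + Real.pi / 2) (2 * Real.pi * k + 3 * Real.pi / 2))
    (hθ₁ : θ₁ ∈ Icc (2 * Real.pi * k + Real.pi / 2) (2 * Real.pi * k + 3 * Real.pi / 2)) :
    HasLift P α β θ₀ θ₁ :=
  of_halfPlane' hP (c := Real.pi / 2) (e := -Complex.I)
    (by push_cast; rw [neg_mul, Complex.exp_neg, Complex.exp_pi_div_two_mul_I, Complex.inv_I])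
    k h0 (by simpa using hre) hα hβ
    ⟨by linarith [hθ₀.1], by linarith [hθ₀.2]⟩ ⟨by linarith [hθ₁.1], by linarith [hθ₁.2]⟩

end HasLift

theorem hasAngle_of_pos {r : ℝ} (hr : 0 < r) (k : ℤ) : HasAngle ⟨r, 0⟩ (2 * Real.pi * k) := by
  have h : HasAngle ⟨r, 0⟩ 0 := hasAngle_iff.2 ⟨r, hr, by simp, by simp⟩
  simpa using h.add_int_mul_two_pi k

theorem hasAngle_of_neg {r : ℝ} (hr : r < 0) (k : ℤ) :
    HasAngle ⟨r, 0⟩ (Real.pi + 2 * Real.pi * k) := by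
  have h : HasAngle ⟨r, 0⟩ Real.pi := hasAngle_iff.2 ⟨-r, by linarith, by simp, by simp⟩
  exact h.add_int_mul_two_pi k

/-- A quadrant lies in two of the half planes in which lifts are constructed. Normalising the angle
there, in this lemma and the next, allows lifts in successive half planes to be glued. -/
theorem exists_hasAngle_third {v : ℂ} (hv : v ≠ 0) (hre : v.re ≤ 0) (him : v.im ≤ 0) :
    ∃ θ ∈ Icc (-Real.pi) (-(Real.pi / 2)), HasAngle v θ := by
  obtain ⟨θ, hθ, h⟩ := exists_hasAngle_mem hv (-Real.pi) (by simpa using him)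
  refine ⟨θ, ⟨hθ.1, ?_⟩, h⟩
  by_contra hlt
  obtain ⟨r, hr, h1, -⟩ := h.re_eq
  have := Real.cos_pos_of_mem_Ioo (x := θ) ⟨by linarith, by linarith [hθ.2, Real.pi_pos]⟩
  nlinarith [mul_pos hr this]

theorem exists_hasAngle_second {v : ℂ} (hv : v ≠ 0) (hre : v.re ≤ 0) (him : 0 ≤ v.im) :
    ∃ θ ∈ Icc (-(3 * Real.pi / 2)) (-Real.pi), HasAngle v θ := by
  obtain ⟨θ, hθ, h⟩ := exists_hasAngle_mem hv 0 (by simpa using him)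
  refine ⟨θ + 2 * Real.pi * (-1 : ℤ), ⟨?_, ?_⟩, h.add_int_mul_two_pi _⟩
  · by_contra hlt
    push_cast at hlt
    obtain ⟨r, hr, h1, -⟩ := h.re_eq
    have := Real.cos_pos_of_mem_Ioo (x := θ) ⟨by linarith [hθ.1, Real.pi_pos], by linarith⟩
    nlinarith [mul_pos hr this]
  · push_cast
    linarith [hθ.2]

/-- The velocity, in the `xy`-plane, of the strand determined by `y`. -/
noncomputable def tangent (y : ℝ → ℝ) (s : ℝ) : ℂ := ⟨y s, deriv y s⟩

theorem IsStrand.continuous_tangent {y : ℝ → ℝ} (hy : IsStrand y) : Continuous (tangent y) := by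
  have : tangent y = fun s => ((y s : ℝ) : ℂ) + (deriv y s : ℝ) * Complex.I := by
    ext s
    exact Complex.mk_eq_add_mul_I _ _
  rw [this]
  exact (Complex.continuous_ofReal.comp hy.continuous).add
    ((Complex.continuous_ofReal.comp hy.continuous_deriv).mul continuous_const)

theorem IsStrand.tangent_ne_zero {y : ℝ → ℝ} (hy : IsStrand y) (s : ℝ) : tangent y s ≠ 0 := by
  intro h
  exact hy.regular s (congrArg Complex.re h) (congrArg Complex.im h)

theorem IsStrand.continuous_chord {y : ℝ → ℝ} (hy : IsStrand y) (ε : ℝ) :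
    Continuous fun h => pos y h - pos y (h - ε) :=
  hy.continuous_pos.sub (hy.continuous_pos.comp (continuous_id.sub continuous_const))

/-! ### Dips -/

theorem hasDerivAt_expNegInvGlue {s : ℝ} (hs : 0 < s) :
    HasDerivAt expNegInvGlue (expNegInvGlue s * (s ^ 2)⁻¹) s := by
  have h1 : HasDerivAt (fun s : ℝ => Real.exp (-s⁻¹)) (Real.exp (-s⁻¹) * -(-(s ^ 2)⁻¹)) s :=
    ((hasDerivAt_inv hs.ne').neg).exp
  rw [neg_neg] at h1
  have h2 : expNegInvGlue s = Real.exp (-s⁻¹) := by simp [expNegInvGlue, not_le.2 hs]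
  rw [h2]
  refine h1.congr_of_eventuallyEq ?_
  filter_upwards [lt_mem_nhds hs] with t ht
  simp [expNegInvGlue, not_le.2 ht]

theorem expNegInvGlue_lt_one (s : ℝ) : expNegInvGlue s < 1 := by
  rcases le_or_gt s 0 with h | h
  · rw [expNegInvGlue.zero_of_nonpos h]; exact one_pos
  · have h2 : expNegInvGlue s = Real.exp (-s⁻¹) := by simp [expNegInvGlue, not_le.2 h]
    rw [h2, Real.exp_lt_one_iff]
    linarith [inv_pos.2 h]

/-- A smooth bump with support `[0, 1]` which increases up to `1 / 2` and then decreases. -/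
noncomputable def dipBump (s : ℝ) : ℝ := expNegInvGlue s * expNegInvGlue (1 - s)

theorem contDiff_dipBump : ContDiff ℝ ∞ dipBump :=
  expNegInvGlue.contDiff.mul (expNegInvGlue.contDiff.comp (contDiff_const.sub contDiff_id))

theorem dipBump_of_le {s : ℝ} (hs : s ≤ 0) : dipBump s = 0 := by
  rw [dipBump, expNegInvGlue.zero_of_nonpos hs, zero_mul]

theorem dipBump_of_ge {s : ℝ} (hs : 1 ≤ s) : dipBump s = 0 := by
  rw [dipBump, expNegInvGlue.zero_of_nonpos (by linarith : 1 - s ≤ 0), mul_zero]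

theorem dipBump_pos {s : ℝ} (hs : s ∈ Ioo (0 : ℝ) 1) : 0 < dipBump s :=
  mul_pos (expNegInvGlue.pos_of_pos hs.1) (expNegInvGlue.pos_of_pos (by linarith [hs.2]))

theorem dipBump_nonneg (s : ℝ) : 0 ≤ dipBump s :=
  mul_nonneg (expNegInvGlue.nonneg _) (expNegInvGlue.nonneg _)

theorem dipBump_lt_one (s : ℝ) : dipBump s < 1 :=
  mul_lt_one_of_nonneg_of_lt_one_left (expNegInvGlue.nonneg _) (expNegInvGlue_lt_one _)
    (expNegInvGlue_lt_one _).le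

theorem hasDerivAt_dipBump {s : ℝ} (hs : s ∈ Ioo (0 : ℝ) 1) :
    HasDerivAt dipBump (dipBump s * ((s ^ 2)⁻¹ - ((1 - s) ^ 2)⁻¹)) s := by
  have h1 := hasDerivAt_expNegInvGlue hs.1
  have h2 := (hasDerivAt_expNegInvGlue (by linarith [hs.2] : 0 < 1 - s))
  have h3 : HasDerivAt (fun s : ℝ => 1 - s) (-1) s := by
    simpa using (hasDerivAt_id s).const_sub 1
  have h4 : HasDerivAt dipBump _ s := h1.mul (h2.comp s h3)
  refine h4.congr_deriv ?_
  simp only [dipBump]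
  ring

theorem inv_sq_sub_pos {s : ℝ} (hs : 0 < s) (hs' : s < 1 / 2) :
    0 < (s ^ 2)⁻¹ - ((1 - s) ^ 2)⁻¹ := by
  rw [sub_pos]
  exact inv_strictAnti₀ (pow_pos hs 2) (by nlinarith)

theorem inv_sq_sub_neg {s : ℝ} (hs : 1 / 2 < s) (hs' : s < 1) :
    (s ^ 2)⁻¹ - ((1 - s) ^ 2)⁻¹ < 0 := by
  rw [sub_neg]
  exact inv_strictAnti₀ (pow_pos (by linarith) 2) (by nlinarith)

/-- The function `1` with a dip of depth proportional to `A` on `[0, ℓ]`. -/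
noncomputable def dip (A ℓ s : ℝ) : ℝ := 1 - A * dipBump (s / ℓ)

section Dip

variable {A ℓ : ℝ} (hA : 0 < A) (hℓ : 0 < ℓ)

include hℓ

theorem dip_of_le {s : ℝ} (hs : s ≤ 0) : dip A ℓ s = 1 := by
  rw [dip, dipBump_of_le (div_nonpos_of_nonpos_of_nonneg hs hℓ.le)]
  ring

theorem dip_of_ge {s : ℝ} (hs : ℓ ≤ s) : dip A ℓ s = 1 := by
  rw [dip, dipBump_of_ge (by rwa [one_le_div hℓ])]
  ring

theorem div_mem_Ioo {s : ℝ} (hs : s ∈ Ioo 0 ℓ) : s / ℓ ∈ Ioo (0 : ℝ) 1 :=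
  ⟨div_pos hs.1 hℓ, (div_lt_one hℓ).2 hs.2⟩

include hA

theorem dip_lt_one {s : ℝ} (hs : s ∈ Ioo 0 ℓ) : dip A ℓ s < 1 := by
  have := mul_pos hA (dipBump_pos (div_mem_Ioo hℓ hs))
  rw [dip]
  linarith

omit hℓ in
theorem dip_le_one (s : ℝ) : dip A ℓ s ≤ 1 := by
  have := mul_nonneg hA.le (dipBump_nonneg (s / ℓ))
  rw [dip]
  linarith

omit hA in
theorem hasDerivAt_dip {s : ℝ} (hs : s ∈ Ioo 0 ℓ) :
    HasDerivAt (dip A ℓ) (-(A / ℓ * dipBump (s / ℓ)) *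
      (((s / ℓ) ^ 2)⁻¹ - ((1 - s / ℓ) ^ 2)⁻¹)) s := by
  have h1 : HasDerivAt (fun s : ℝ => s / ℓ) (1 / ℓ) s := (hasDerivAt_id s).div_const ℓ
  have h2 := (hasDerivAt_dipBump (div_mem_Ioo hℓ hs)).comp s h1
  have h3 : HasDerivAt (dip A ℓ) _ s := (h2.const_mul A).const_sub 1
  refine h3.congr_deriv ?_
  ring

/-- Outside the open interval, and also at its two ends, the dip attains its maximum 1. -/
theorem deriv_dip_of_notMem {s : ℝ} (hs : s ∉ Ioo 0 ℓ) : deriv (dip A ℓ) s = 0 := by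
  refine IsLocalMax.deriv_eq_zero (Eventually.of_forall fun t => ?_)
  have h1 : dip A ℓ s = 1 := by
    rcases le_or_gt s 0 with h | h
    · exact dip_of_le hℓ h
    · exact dip_of_ge hℓ (not_lt.1 fun h' => hs ⟨h, h'⟩)
  rw [h1]
  exact dip_le_one hA t

theorem deriv_dip_neg {s : ℝ} (hs : s ∈ Ioo 0 (ℓ / 2)) : deriv (dip A ℓ) s < 0 := by
  have hs' : s ∈ Ioo 0 ℓ := ⟨hs.1, by linarith [hs.2]⟩
  have h1 := div_mem_Ioo hℓ hs'
  have h2 : s / ℓ < 1 / 2 := by rw [div_lt_iff₀ hℓ]; linarith [hs.2]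
  rw [(hasDerivAt_dip hℓ hs').deriv]
  have h3 := mul_pos (div_pos hA hℓ) (dipBump_pos h1)
  have h4 := mul_pos h3 (inv_sq_sub_pos h1.1 h2)
  linarith

theorem deriv_dip_pos {s : ℝ} (hs : s ∈ Ioo (ℓ / 2) ℓ) : 0 < deriv (dip A ℓ) s := by
  have hs' : s ∈ Ioo 0 ℓ := ⟨by linarith [hs.1], hs.2⟩
  have h1 := div_mem_Ioo hℓ hs'
  have h2 : 1 / 2 < s / ℓ := by rw [lt_div_iff₀ hℓ]; linarith [hs.1]
  rw [(hasDerivAt_dip hℓ hs').deriv]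
  have h3 := mul_pos (div_pos hA hℓ) (dipBump_pos h1)
  have h4 := mul_pos_of_neg_of_neg (by linarith : -(A / ℓ * dipBump (s / ℓ)) < 0)
    (inv_sq_sub_neg h2 h1.2)
  exact h4

omit hA hℓ in
theorem contDiff_dip : ContDiff ℝ ∞ (dip A ℓ) :=
  contDiff_const.sub (contDiff_const.mul (contDiff_dipBump.comp (contDiff_id.div_const ℓ)))

theorem strictAntiOn_dip : StrictAntiOn (dip A ℓ) (Icc 0 (ℓ / 2)) := by
  refine strictAntiOn_of_deriv_neg (convex_Icc _ _) contDiff_dip.continuous.continuousOn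
    fun s hs => ?_
  rw [interior_Icc] at hs
  exact deriv_dip_neg hA hℓ hs

theorem strictMonoOn_dip : StrictMonoOn (dip A ℓ) (Icc (ℓ / 2) ℓ) := by
  refine strictMonoOn_of_deriv_pos (convex_Icc _ _) contDiff_dip.continuous.continuousOn
    fun s hs => ?_
  rw [interior_Icc] at hs
  exact deriv_dip_pos hA hℓ hs

theorem deriv_dip_half : deriv (dip A ℓ) (ℓ / 2) = 0 := by
  have hmin : IsLocalMin (dip A ℓ) (ℓ / 2) := by
    filter_upwards [Ioo_mem_nhds (by linarith : 0 < ℓ / 2) (by linarith : ℓ / 2 < ℓ)] with t ht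
    rcases le_total t (ℓ / 2) with h | h
    · exact (strictAntiOn_dip hA hℓ).antitoneOn ⟨ht.1.le, h⟩ ⟨by linarith, le_rfl⟩ h
    · exact (strictMonoOn_dip hA hℓ).monotoneOn ⟨le_rfl, by linarith⟩ ⟨h, ht.2.le⟩ h
  exact hmin.deriv_eq_zero

theorem deriv_dip_nonpos {s : ℝ} (hs : s ≤ ℓ / 2) : deriv (dip A ℓ) s ≤ 0 := by
  by_cases h : s ∈ Ioo 0 (ℓ / 2)
  · exact (deriv_dip_neg hA hℓ h).le
  · rcases hs.eq_or_lt with rfl | hlt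
    · exact (deriv_dip_half hA hℓ).le
    · exact (deriv_dip_of_notMem hA hℓ fun h' => h ⟨h'.1, hlt⟩).le

theorem deriv_dip_nonneg {s : ℝ} (hs : ℓ / 2 ≤ s) : 0 ≤ deriv (dip A ℓ) s := by
  by_cases h : s ∈ Ioo (ℓ / 2) ℓ
  · exact (deriv_dip_pos hA hℓ h).le
  · rcases hs.eq_or_lt with rfl | hlt
    · exact (deriv_dip_half hA hℓ).ge
    · exact (deriv_dip_of_notMem hA hℓ fun h' => h ⟨hlt, h'.2⟩).ge

/-- On the descending half, a dip decreases strictly after its start. -/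
theorem dip_lt_of_lt_half {t s : ℝ} (hts : t < s) (hs0 : 0 < s) (hs : s ≤ ℓ / 2) :
    dip A ℓ s < dip A ℓ t := by
  rcases le_total t 0 with h | h
  · rw [dip_of_le hℓ h]
    exact dip_lt_one hA hℓ ⟨hs0, by linarith⟩
  · exact strictAntiOn_dip hA hℓ ⟨h, by linarith⟩ ⟨hs0.le, hs⟩ hts

/-- On the ascending half, a dip increases strictly before its end. -/
theorem dip_lt_of_half_lt {t s : ℝ} (hts : t < s) (ht0 : ℓ / 2 ≤ t) (ht : t < ℓ) :
    dip A ℓ t < dip A ℓ s := by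
  rcases le_total ℓ s with h | h
  · rw [dip_of_ge hℓ h]
    exact dip_lt_one hA hℓ ⟨by linarith, ht⟩
  · exact strictMonoOn_dip hA hℓ ⟨ht0, ht.le⟩ ⟨by linarith, h⟩ hts

/-- Inside (0, ℓ) the derivative vanishes only at the bottom ℓ/2, so the zeros are transverse as
soon as the bottom value is not 0. -/
theorem isStrand_dip (hne : dip A ℓ (ℓ / 2) ≠ 0) : IsStrand (dip A ℓ) where
  smooth := contDiff_dip
  regular s hs := by
    have h0 : 0 < s := by
      by_contra h
      rw [dip_of_le hℓ (not_lt.1 h)] at hs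
      exact one_ne_zero hs
    have h1 : s < ℓ := by
      by_contra h
      rw [dip_of_ge hℓ (not_lt.1 h)] at hs
      exact one_ne_zero hs
    rcases lt_trichotomy s (ℓ / 2) with h | h | h
    · exact (deriv_dip_neg hA hℓ ⟨h0, h⟩).ne
    · exact absurd (h ▸ hs) hne
    · exact (deriv_dip_pos hA hℓ ⟨h, h1⟩).ne'
  away := by
    refine ⟨ℓ, fun s hs => ?_⟩
    rcases le_total 0 s with h | h
    · rw [abs_of_nonneg h] at hs
      rw [dip_of_ge hℓ hs]
      norm_num
    · rw [dip_of_le hℓ h]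
      norm_num

end Dip

/-! ### Changes of lane by shallow and by deep dips -/

/-- A strand which is straight outside `[0, ℓ]` and moves from the lane `0` to the lane `c`, while
its velocity and its chords make `-n` full turns. -/
structure IsMove (w : ℝ → ℝ) (ℓ c : ℝ) (n : ℤ) : Prop where
  strand : IsStrand w
  length_pos : 0 < ℓ
  before : ∀ s ≤ 0, w s = 1
  after : ∀ s, ℓ ≤ s → w s = 1
  lt_one : ∀ s ∈ Ioo 0 ℓ, w s < 1
  shift : xInt w ℓ - zInt w ℓ = c
  turn : HasLift (tangent w) 0 ℓ 0 (2 * Real.pi * (-n : ℤ))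
  chord : ∃ ε₀ > 0, ∀ ε ∈ Ioo 0 ε₀,
    HasLift (fun h => pos w h - pos w (h - ε)) 0 (zInt w ℓ + 1) 0 (2 * Real.pi * (-n : ℤ))

section Dip

variable {A ℓ : ℝ} (hA : 0 < A) (hℓ : 0 < ℓ)
include hA hℓ

omit hA in
-- The lane changes at the rate y - y². For a dip this equals A β - A² β² with β the bump: its
-- integral is positive for 0 < A ≤ 1 and negative for large A, and it scales with ℓ.
theorem xInt_sub_zInt_dip : xInt (dip A ℓ) ℓ - zInt (dip A ℓ) ℓ =
    ℓ * (A * (∫ u in (0 : ℝ)..1, dipBump u) - A ^ 2 * ∫ u in (0 : ℝ)..1, dipBump u ^ 2) := by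
  have hc : Continuous (dip A ℓ) := contDiff_dip.continuous
  have hb : Continuous dipBump := contDiff_dipBump.continuous
  have h1 : xInt (dip A ℓ) ℓ - zInt (dip A ℓ) ℓ = ∫ u in (0 : ℝ)..ℓ,
      (fun v => A * dipBump v - A ^ 2 * dipBump v ^ 2) (u / ℓ) := by
    have hc2 : Continuous fun u => dip A ℓ u ^ 2 := hc.pow 2
    rw [xInt, zInt, ← intervalIntegral.integral_sub (hc.intervalIntegrable _ _)
      (hc2.intervalIntegrable _ _)]
    refine intervalIntegral.integral_congr fun u _ => ?_
    simp only [dip]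
    ring
  have hb1 : Continuous fun u => A * dipBump u := hb.const_mul A
  have hb2 : Continuous fun u => A ^ 2 * dipBump u ^ 2 := (hb.pow 2).const_mul _
  rw [h1, intervalIntegral.integral_comp_div
      (fun v => A * dipBump v - A ^ 2 * dipBump v ^ 2) hℓ.ne', zero_div, div_self hℓ.ne',
    intervalIntegral.integral_sub (hb1.intervalIntegrable _ _) (hb2.intervalIntegrable _ _), intervalIntegral.integral_const_mul,
    intervalIntegral.integral_const_mul, smul_eq_mul]

omit hA in
theorem chord_start {ε : ℝ} (hε : 0 < ε) (hs : IsStrand (dip A ℓ)) :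
    HasAngle (pos (dip A ℓ) 0 - pos (dip A ℓ) (0 - ε)) 0 := by
  have hw0 : ∀ s ≤ 0, dip A ℓ s = 1 := fun s hs => dip_of_le hℓ hs
  rw [pos_of_nonpos hs hw0 le_rfl, pos_of_nonpos hs hw0 (by linarith)]
  have : (⟨0, 1⟩ - ⟨0 - ε, 1⟩ : ℂ) = ⟨ε, 0⟩ := by apply Complex.ext <;> simp
  rw [this]
  simpa using hasAngle_of_pos hε 0

omit hA in
theorem chord_end {ε h : ℝ} (hε : 0 < ε) (hs : IsStrand (dip A ℓ))
    (hh : zInt (dip A ℓ) ℓ ≤ h - ε) (k : ℤ) :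
    HasAngle (pos (dip A ℓ) h - pos (dip A ℓ) (h - ε)) (2 * Real.pi * k) := by
  have hw1 : ∀ s, ℓ ≤ s → dip A ℓ s = 1 := fun s hs => dip_of_ge hℓ hs
  have h1 := pos_of_eq_one_of_le hs hw1 (h := h - zInt (dip A ℓ) ℓ) (by linarith)
  have h2 := pos_of_eq_one_of_le hs hw1 (h := h - ε - zInt (dip A ℓ) ℓ) (by linarith)
  rw [add_sub_cancel] at h1 h2
  rw [h1, h2]
  have : (⟨xInt (dip A ℓ) ℓ + (h - zInt (dip A ℓ) ℓ), 1⟩ -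
      ⟨xInt (dip A ℓ) ℓ + (h - ε - zInt (dip A ℓ) ℓ), 1⟩ : ℂ) = ⟨ε, 0⟩ := by
    apply Complex.ext <;> simp
  rw [this]
  exact hasAngle_of_pos hε k

/-- The bump is less than 1, so y stays positive and x increases. Velocities and chords thus remain
in the right half plane and cannot turn. -/
theorem isMove_shallow (hA1 : A ≤ 1) : IsMove (dip A ℓ) ℓ
    (ℓ * (A * (∫ u in (0 : ℝ)..1, dipBump u) - A ^ 2 * ∫ u in (0 : ℝ)..1, dipBump u ^ 2)) 0 := by
  have hpos : ∀ s, 0 < dip A ℓ s := fun s => by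
    have := dipBump_lt_one (s / ℓ)
    have := dipBump_nonneg (s / ℓ)
    rw [dip]
    nlinarith
  have hs : IsStrand (dip A ℓ) := isStrand_dip hA hℓ (hpos _).ne'
  have hx : StrictMono (xInt (dip A ℓ)) := strictMono_of_deriv_pos fun s => by
    rw [(hasDerivAt_xInt hs.continuous s).deriv]
    exact hpos s
  have hre : ∀ ε > 0, ∀ h, 0 < (pos (dip A ℓ) h - pos (dip A ℓ) (h - ε)).re := by
    intro ε hε h
    simp only [pos, Complex.sub_re, sub_pos]
    exact hx (hs.strictMono_level (by linarith))
  have hpi := Real.pi_pos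
  refine ⟨hs, hℓ, fun s h => dip_of_le hℓ h, fun s h => dip_of_ge hℓ h,
    fun s h => dip_lt_one hA hℓ h, xInt_sub_zInt_dip hℓ, ?_, 1, one_pos, fun ε hε => ?_⟩
  · refine HasLift.of_re_nonneg hs.continuous_tangent.continuousOn 0
      (fun t _ => hs.tangent_ne_zero t) (fun t _ => (hpos t).le) ?_ ?_ ?_ ?_
    · rw [tangent, deriv_dip_of_notMem hA hℓ (by simp), dip_of_le hℓ le_rfl]
      simpa using hasAngle_of_pos one_pos 0
    · rw [tangent, deriv_dip_of_notMem hA hℓ (by simp), dip_of_ge hℓ le_rfl]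
      simpa using hasAngle_of_pos one_pos 0
    · constructor <;> simp <;> linarith
    · constructor <;> simp <;> linarith
  · refine HasLift.of_re_nonneg (hs.continuous_chord ε).continuousOn 0 (fun t _ e => ?_)
      (fun t _ => (hre ε hε.1 t).le) (chord_start hℓ hε.1 hs)
      (chord_end hℓ hε.1 hs (by linarith [hε.2]) _) ?_ ?_
    · have := hre ε hε.1 t
      rw [e] at this
      simp at this
    · constructor <;> simp <;> linarith
    · constructor <;> simp <;> linarith

/-- At the bottom the velocity points in the direction -x. It gets there through the lower half
plane, from angle 0 to -π, and continues through the upper one to -2π. Short chords do the same,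
except that those across the bottom need an argument of their own. -/
theorem isMove_deep (hdeep : dip A ℓ (ℓ / 2) < 0) : IsMove (dip A ℓ) ℓ
    (ℓ * (A * (∫ u in (0 : ℝ)..1, dipBump u) - A ^ 2 * ∫ u in (0 : ℝ)..1, dipBump u ^ 2)) 1 := by
  have hs : IsStrand (dip A ℓ) := isStrand_dip hA hℓ hdeep.ne
  have hpi := Real.pi_pos
  refine ⟨hs, hℓ, fun s h => dip_of_le hℓ h, fun s h => dip_of_ge hℓ h,
    fun s h => dip_lt_one hA hℓ h, xInt_sub_zInt_dip hℓ, ?_, ?_⟩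
  · have hmid : HasAngle (tangent (dip A ℓ) (ℓ / 2)) (-Real.pi) := by
      rw [tangent, deriv_dip_half hA hℓ]
      have := hasAngle_of_neg hdeep (-1)
      push_cast at this
      convert this using 1
      ring
    refine HasLift.trans (β := ℓ / 2) (θ₁ := -Real.pi) ?_ ?_ (by linarith) (by linarith)
    · refine HasLift.of_im_nonpos hs.continuous_tangent.continuousOn 0
        (fun t _ => hs.tangent_ne_zero t) (fun t ht => deriv_dip_nonpos hA hℓ ht.2) ?_ hmid ?_ ?_
      · rw [tangent, deriv_dip_of_notMem hA hℓ (by simp), dip_of_le hℓ le_rfl]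
        simpa using hasAngle_of_pos one_pos 0
      · constructor <;> simp; linarith
      · constructor <;> simp; linarith
    · refine HasLift.of_im_nonneg hs.continuous_tangent.continuousOn (-1)
        (fun t _ => hs.tangent_ne_zero t) (fun t ht => deriv_dip_nonneg hA hℓ ht.1) hmid ?_ ?_ ?_
      · rw [tangent, deriv_dip_of_notMem hA hℓ (by simp), dip_of_ge hℓ le_rfl]
        exact hasAngle_of_pos one_pos (-1)
      · constructor <;> push_cast <;> linarith
      · constructor <;> push_cast <;> linarith
  · set w := dip A ℓ with hw
    set m := zInt w (ℓ / 2) with hm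
    have hlm : level w m = ℓ / 2 := by rw [hs.level_eq_iff]
    have hm0 : 0 < m := by
      rw [hm, ← zInt_zero w]
      exact hs.strictMono_zInt (by linarith)
    have hmT : m < zInt w ℓ := hs.strictMono_zInt (by linarith)
    have hnear : ∀ᶠ h in 𝓝 m, w (level w h) < 0 := by
      have : ContinuousAt (fun h => w (level w h)) m :=
        (hs.continuous.comp hs.continuous_level).continuousAt
      exact this.eventually (gt_mem_nhds (by beta_reduce; rwa [hlm]))
    -- Within δ of the height of the bottom y is negative, so x decreases. For ε < δ the chords
    -- across the bottom therefore lie in the left half plane, where the lifts of the descending and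
    -- of the ascending half are joined.
    obtain ⟨δ, hδ, hδ'⟩ := Metric.eventually_nhds_iff.1 hnear
    refine ⟨min δ 1, lt_min hδ one_pos, fun ε hε => ?_⟩
    have hε0 := hε.1
    have hεδ : ε < δ := hε.2.trans_le (min_le_left _ _)
    have hε1 : ε < 1 := hε.2.trans_le (min_le_right _ _)
    have hlt : ∀ h, level w (h - ε) < level w h := fun h => hs.strictMono_level (by linarith)
    have him : ∀ h, (pos w h - pos w (h - ε)).im = w (level w h) - w (level w (h - ε)) :=
      fun h => by simp [pos]
    have hreg1 : ∀ h ∈ Icc 0 m, (pos w h - pos w (h - ε)).im ≤ 0 ∧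
        pos w h - pos w (h - ε) ≠ 0 := by
      intro h hh
      rcases hh.1.eq_or_lt with rfl | h0
      · have h1 : pos w 0 - pos w (0 - ε) = ⟨ε, 0⟩ := by
          rw [pos_of_nonpos hs (fun s hs => dip_of_le hℓ hs) le_rfl,
            pos_of_nonpos hs (fun s hs => dip_of_le hℓ hs) (by linarith)]
          apply Complex.ext <;> simp
        rw [h1]
        exact ⟨le_rfl, fun e => hε0.ne' (congrArg Complex.re e)⟩
      · have := dip_lt_of_lt_half hA hℓ (hlt h)
          (by rwa [hs.lt_level_iff, zInt_zero]) (by rw [hs.level_le_iff]; exact hh.2)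
        have h2 : (pos w h - pos w (h - ε)).im < 0 := by rw [him]; linarith
        refine ⟨h2.le, fun e => ?_⟩
        rw [e] at h2
        simp at h2
    have hreg2 : ∀ h ∈ Icc m (m + ε), (pos w h - pos w (h - ε)).re < 0 := by
      intro h hh
      have hanti : StrictAntiOn (xInt w) (Icc (level w (h - ε)) (level w h)) := by
        refine strictAntiOn_of_deriv_neg (convex_Icc _ _)
          (contDiff_xInt hs.smooth).continuous.continuousOn fun s hs' => ?_
        rw [interior_Icc] at hs'
        rw [(hasDerivAt_xInt hs.continuous s).deriv, ← hs.level_zInt s]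
        refine hδ' ?_
        have h1 := hs.level_lt_iff.1 hs'.1
        have h2 := hs.lt_level_iff.1 hs'.2
        rw [Real.dist_eq, abs_lt]
        constructor <;> linarith [hh.1, hh.2]
      have := hanti ⟨le_rfl, (hlt h).le⟩ ⟨(hlt h).le, le_rfl⟩ (hlt h)
      simp only [pos, Complex.sub_re]
      linarith
    have hreg3 : ∀ h ∈ Icc (m + ε) (zInt w ℓ + 1), 0 ≤ (pos w h - pos w (h - ε)).im ∧
        pos w h - pos w (h - ε) ≠ 0 := by
      intro h hh
      rcases lt_or_ge (h - ε) (zInt w ℓ) with h0 | h0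
      · have := dip_lt_of_half_lt hA hℓ (hlt h)
          (by rw [hs.le_level_iff]; linarith [hh.1]) (by rwa [hs.level_lt_iff])
        have h2 : 0 < (pos w h - pos w (h - ε)).im := by rw [him]; linarith
        refine ⟨h2.le, fun e => ?_⟩
        rw [e] at h2
        simp at h2
      · have h1 := chord_end hℓ hε0 hs h0 0
        refine ⟨?_, h1.ne_zero⟩
        obtain ⟨r, -, -, h2⟩ := h1.re_eq
        rw [h2]
        simp
    have hmI : m ∈ Icc 0 m := ⟨hm0.le, le_rfl⟩
    have hmI' : m ∈ Icc m (m + ε) := ⟨le_rfl, by linarith⟩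
    have hmI2 : m + ε ∈ Icc m (m + ε) := ⟨by linarith, le_rfl⟩
    have hmI3 : m + ε ∈ Icc (m + ε) (zInt w ℓ + 1) := ⟨le_rfl, by linarith⟩
    obtain ⟨θ₁, hθ₁, hang₁⟩ := exists_hasAngle_third (hreg1 m hmI).2 (hreg2 m hmI').le
      (hreg1 m hmI).1
    obtain ⟨θ₂, hθ₂, hang₂⟩ := exists_hasAngle_second (hreg3 _ hmI3).2 (hreg2 _ hmI2).le
      (hreg3 _ hmI3).1
    have hc := (hs.continuous_chord ε)
    have lift1 : HasLift (fun h => pos w h - pos w (h - ε)) 0 m 0 θ₁ :=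
      HasLift.of_im_nonpos hc.continuousOn 0 (fun t ht => (hreg1 t ht).2)
        (fun t ht => (hreg1 t ht).1) (chord_start hℓ hε0 hs) hang₁
        (by constructor <;> simp; linarith)
        (by constructor <;> simp <;> linarith [hθ₁.1, hθ₁.2])
    have lift2 : HasLift (fun h => pos w h - pos w (h - ε)) m (m + ε) θ₁ θ₂ :=
      HasLift.of_re_nonpos hc.continuousOn (-1)
        (fun t ht e => by
          have := hreg2 t ht
          rw [e] at this
          simp at this)
        (fun t ht => (hreg2 t ht).le) hang₁ hang₂
        (by constructor <;> push_cast <;> linarith [hθ₁.1, hθ₁.2])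
        (by constructor <;> push_cast <;> linarith [hθ₂.1, hθ₂.2])
    have lift3 : HasLift (fun h => pos w h - pos w (h - ε)) (m + ε) (zInt w ℓ + 1) θ₂
        (2 * Real.pi * (-1 : ℤ)) :=
      HasLift.of_im_nonneg hc.continuousOn (-1) (fun t ht => (hreg3 t ht).2)
        (fun t ht => (hreg3 t ht).1) hang₂ (chord_end hℓ hε0 hs (by linarith) _)
        (by constructor <;> push_cast <;> linarith [hθ₂.1, hθ₂.2])
        (by constructor <;> push_cast <;> linarith)
    exact (lift1.trans lift2 hm0.le (by linarith)).trans lift3 (by linarith) (by linarith)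

end Dip

theorem integral_dipBump_sq_pos : 0 < ∫ u in (0 : ℝ)..1, dipBump u ^ 2 :=
  intervalIntegral.intervalIntegral_pos_of_pos_on
    ((contDiff_dipBump.continuous.pow 2).intervalIntegrable _ _)
    (fun _ hu => pow_pos (dipBump_pos hu) 2) one_pos

theorem integral_dipBump_sq_lt : ∫ u in (0 : ℝ)..1, dipBump u ^ 2 < ∫ u in (0 : ℝ)..1, dipBump u := by
  have hc := contDiff_dipBump.continuous
  have hc2 : Continuous fun u => dipBump u ^ 2 := hc.pow 2
  rw [← sub_pos, ← intervalIntegral.integral_sub (hc.intervalIntegrable _ _)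
    (hc2.intervalIntegrable _ _)]
  refine intervalIntegral.intervalIntegral_pos_of_pos_on
    ((hc.sub hc2).intervalIntegrable _ _) (fun u hu => ?_) one_pos
  have := dipBump_pos hu
  have := dipBump_lt_one u
  nlinarith

/-- A strand can move to the right without turning. -/
theorem exists_isMove_right {c : ℝ} (hc : 0 < c) : ∃ w ℓ, IsMove w ℓ c 0 := by
  have h1 := integral_dipBump_sq_lt
  set b₁ := ∫ u in (0 : ℝ)..1, dipBump u
  set b₂ := ∫ u in (0 : ℝ)..1, dipBump u ^ 2
  -- The shift is proportional to the length of the dip, so any positive lane change is reached by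
  -- the choice of ℓ.
  have h2 : 0 < c / (b₁ - b₂) := div_pos hc (by linarith)
  refine ⟨dip 1 (c / (b₁ - b₂)), c / (b₁ - b₂), ?_⟩
  convert isMove_shallow one_pos h2 le_rfl using 1
  have h3 : b₁ - b₂ ≠ 0 := by linarith
  rw [one_pow, one_mul, one_mul]
  exact (div_mul_cancel₀ c h3).symm

/-- A strand can move to the left with one full turn. -/
theorem exists_isMove_left {c : ℝ} (hc : c < 0) : ∃ w ℓ, IsMove w ℓ c 1 := by
  have h1 := integral_dipBump_sq_pos
  set b₁ := ∫ u in (0 : ℝ)..1, dipBump u with hb₁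
  set b₂ := ∫ u in (0 : ℝ)..1, dipBump u ^ 2 with hb₂
  have hp : 0 < dipBump (1 / 2) := dipBump_pos ⟨by norm_num, by norm_num⟩
  -- The bound b₁/b₂ makes the shift negative, and the other bound makes the dip reach below 0. The
  -- length then adjusts the shift to c.
  obtain ⟨A, hA1⟩ := exists_gt (max (max 0 (b₁ / b₂)) (1 / dipBump (1 / 2)))
  rw [max_lt_iff, max_lt_iff, div_lt_iff₀ h1, div_lt_iff₀ hp] at hA1
  obtain ⟨⟨hA, hA2⟩, hA3⟩ := hA1
  have h3 : A * b₁ - A ^ 2 * b₂ < 0 := by nlinarith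
  have h4 : 0 < c / (A * b₁ - A ^ 2 * b₂) := div_pos_of_neg_of_neg hc h3
  refine ⟨dip A (c / (A * b₁ - A ^ 2 * b₂)), c / (A * b₁ - A ^ 2 * b₂), ?_⟩
  convert isMove_deep hA h4 ?_ using 1
  · exact (div_mul_cancel₀ c h3.ne).symm
  · rw [dip, div_right_comm, div_self h4.ne']
    linarith

/-! ### Fans of strands at a vertex -/

/-- An increasing strand, straight from the parameter `1` on, with `fan 0 = 3 / 4`. -/
noncomputable def fan (s : ℝ) : ℝ := 1 - Real.exp 1 / 4 * expNegInvGlue (1 - s)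

theorem contDiff_fan : ContDiff ℝ ∞ fan :=
  contDiff_const.sub (contDiff_const.mul (expNegInvGlue.contDiff.comp
    (contDiff_const.sub contDiff_id)))

theorem fan_of_ge {s : ℝ} (hs : 1 ≤ s) : fan s = 1 := by
  rw [fan, expNegInvGlue.zero_of_nonpos (by linarith), mul_zero, sub_zero]

/-- As e < 3, the amplitude e/4 is less than 3/4. The bound 1/4 is the one required in
`IsStrand.away`. -/
theorem fan_gt (s : ℝ) : 1 / 4 < fan s := by
  have h1 := expNegInvGlue_lt_one (1 - s)
  have h2 := Real.exp_one_lt_d9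
  have h3 := Real.exp_pos 1
  have h4 := expNegInvGlue.nonneg (1 - s)
  rw [fan]
  nlinarith

theorem fan_pos (s : ℝ) : 0 < fan s := by linarith [fan_gt s]

theorem hasDerivAt_fan {s : ℝ} (hs : s < 1) :
    HasDerivAt fan (Real.exp 1 / 4 * (expNegInvGlue (1 - s) * ((1 - s) ^ 2)⁻¹)) s := by
  have h1 : HasDerivAt (fun s : ℝ => 1 - s) (-1) s := (hasDerivAt_id s).const_sub 1
  have h2 := (hasDerivAt_expNegInvGlue (s := 1 - s) (by linarith)).comp s h1
  have h3 : HasDerivAt fan _ s := (h2.const_mul (Real.exp 1 / 4)).const_sub 1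
  refine h3.congr_deriv ?_
  ring

theorem strictMonoOn_fan : StrictMonoOn fan (Iic 1) := by
  refine strictMonoOn_of_deriv_pos (convex_Iic _) contDiff_fan.continuous.continuousOn
    fun s hs => ?_
  rw [interior_Iic] at hs
  have hs' : 0 < 1 - s := by linarith [mem_Iio.1 hs]
  rw [(hasDerivAt_fan hs).deriv]
  exact mul_pos (by positivity) (mul_pos (expNegInvGlue.pos_of_pos hs') (by positivity))

theorem fan_lt_fan {s t : ℝ} (hs : s < 1) (hst : s < t) : fan s < fan t := by
  rcases le_total t 1 with h | h
  · exact strictMonoOn_fan (mem_Iic.2 hs.le) (mem_Iic.2 h) hst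
  · rw [fan_of_ge h, ← fan_of_ge le_rfl]
    exact strictMonoOn_fan (mem_Iic.2 hs.le) (mem_Iic.2 le_rfl) hs

theorem fan_zero : fan 0 = 3 / 4 := by
  have h2 : expNegInvGlue 1 = Real.exp (-1) := by norm_num [expNegInvGlue]
  have h3 : Real.exp 1 * Real.exp (-1) = 1 := by rw [← Real.exp_add]; simp
  rw [fan, sub_zero, h2]
  linarith

theorem deriv_fan_zero : deriv fan 0 = 1 / 4 := by
  have h2 : expNegInvGlue 1 = Real.exp (-1) := by norm_num [expNegInvGlue]
  have h3 : Real.exp 1 * Real.exp (-1) = 1 := by rw [← Real.exp_add]; simp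
  rw [(hasDerivAt_fan one_pos).deriv, sub_zero, h2]
  norm_num
  linarith

/-- The strand `fan`, shrunk by the factor `a`. -/
noncomputable def fanAt (a s : ℝ) : ℝ := fan (a * s)

/-- The lane that is reached by `fan`. -/
noncomputable def fanLane : ℝ := xInt fan 1 - zInt fan 1

theorem fanLane_pos : 0 < fanLane := by
  have hc := contDiff_fan.continuous
  have hc2 : Continuous fun u => fan u ^ 2 := hc.pow 2
  rw [fanLane, xInt, zInt, ← intervalIntegral.integral_sub (hc.intervalIntegrable _ _)
    (hc2.intervalIntegrable _ _)]
  refine intervalIntegral.intervalIntegral_pos_of_pos_on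
    ((hc.sub hc2).intervalIntegrable _ _) (fun u hu => ?_) one_pos
  have h1 := fan_pos u
  have h2 := fan_lt_fan hu.2 hu.2
  rw [fan_of_ge le_rfl] at h2
  nlinarith

theorem fanAt_zero (a : ℝ) : fanAt a 0 = 3 / 4 := by rw [fanAt, mul_zero, fan_zero]

theorem fanAt_pos (a s : ℝ) : 0 < fanAt a s := fan_pos _

theorem fanAt_one : fanAt 1 = fan := by
  ext s
  rw [fanAt, one_mul]

theorem contDiff_fanAt (a : ℝ) : ContDiff ℝ ∞ (fanAt a) :=
  contDiff_fan.comp (contDiff_const.mul contDiff_id)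

theorem deriv_fanAt_zero (a : ℝ) : deriv (fanAt a) 0 = a / 4 := by
  have h1 : HasDerivAt (fun s : ℝ => a * s) a 0 := by
    simpa using (hasDerivAt_id (0 : ℝ)).const_mul a
  have h2 : HasDerivAt fan (1 / 4) (a * 0) := by
    rw [mul_zero, ← deriv_fan_zero]
    exact (contDiff_fan.differentiable (by simp) 0).hasDerivAt
  have h3 : HasDerivAt (fanAt a) _ 0 := h2.comp 0 h1
  rw [h3.deriv]
  ring

theorem isStrand_fanAt (a : ℝ) : IsStrand (fanAt a) :=
  ⟨contDiff_fanAt a, fun s h => absurd h (fanAt_pos a s).ne', 0, fun _ _ => (fan_gt _).le⟩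

theorem isStrand_fan : IsStrand fan := fanAt_one ▸ isStrand_fanAt 1

theorem strictMono_re_pos_fanAt (a : ℝ) : StrictMono fun h => (pos (fanAt a) h).re := by
  have hx : StrictMono (xInt (fanAt a)) := strictMono_of_deriv_pos fun s => by
    rw [(hasDerivAt_xInt (isStrand_fanAt a).continuous s).deriv]
    exact fanAt_pos a s
  exact hx.comp (isStrand_fanAt a).strictMono_level

theorem pos_fanAt_zero (a : ℝ) : pos (fanAt a) 0 = ⟨0, 3 / 4⟩ := by
  rw [pos, (isStrand_fanAt a).level_zero, xInt_zero, fanAt_zero]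

section FanAt

variable {a b : ℝ} (ha : 0 < a)
include ha

theorem fanAt_of_ge {s : ℝ} (hs : 1 / a ≤ s) : fanAt a s = 1 :=
  fan_of_ge (by rwa [div_le_iff₀' ha] at hs)

/-- Rescaling the parameter by a shrinks x and z by this factor and keeps y. Hence all strands of a
fan are compared through `fan` at the rescaled heights a h. -/
theorem xInt_fanAt (s : ℝ) : xInt (fanAt a) s = xInt fan (a * s) / a := by
  have := intervalIntegral.integral_comp_mul_left (a := 0) (b := s) fan ha.ne'
  simp only [mul_zero, smul_eq_mul] at this
  rw [xInt, xInt, div_eq_inv_mul, ← this]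
  rfl

theorem zInt_fanAt (s : ℝ) : zInt (fanAt a) s = zInt fan (a * s) / a := by
  have := intervalIntegral.integral_comp_mul_left (a := 0) (b := s) (fun s => fan s ^ 2) ha.ne'
  simp only [mul_zero, smul_eq_mul] at this
  rw [zInt, zInt, div_eq_inv_mul, ← this]
  rfl

theorem level_fanAt (h : ℝ) : level (fanAt a) h = level fan (a * h) / a := by
  rw [(isStrand_fanAt a).level_eq_iff, zInt_fanAt ha, mul_div_cancel₀ _ ha.ne',
    isStrand_fan.zInt_level, mul_div_cancel_left₀ _ ha.ne']

theorem im_pos_fanAt (h : ℝ) : (pos (fanAt a) h).im = fan (level fan (a * h)) := by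
  simp only [pos, level_fanAt ha, fanAt, mul_div_cancel₀ _ ha.ne']

theorem pos_fanAt_of_ge {h : ℝ} (hh : zInt fan 1 ≤ a * h) :
    pos (fanAt a) h = ⟨fanLane / a + h, 1⟩ := by
  have h1 := pos_of_eq_one_of_le (isStrand_fanAt a) (fun s hs => fanAt_of_ge ha hs)
    (h := h - zInt (fanAt a) (1 / a))
  rw [zInt_fanAt ha, xInt_fanAt ha, mul_one_div_cancel ha.ne', add_sub_cancel] at h1
  rw [h1 (by rw [sub_nonneg, div_le_iff₀ ha]; linarith), fanLane]
  apply Complex.ext <;> simp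
  ring

/-- At larger heights the strands of a fan are higher, until they are straight. -/
theorem im_pos_fanAt_lt (hb : 0 < b) {h k : ℝ} (hlt : a * h < b * k) :
    (pos (fanAt a) h).im < (pos (fanAt b) k).im ∨
      pos (fanAt a) h = ⟨fanLane / a + h, 1⟩ ∧ pos (fanAt b) k = ⟨fanLane / b + k, 1⟩ := by
  have hs := isStrand_fan
  rcases lt_or_ge (a * h) (zInt fan 1) with h1 | h1
  · left
    rw [im_pos_fanAt ha, im_pos_fanAt hb]
    exact fan_lt_fan (by rwa [hs.level_lt_iff]) (hs.strictMono_level hlt)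
  · exact Or.inr ⟨pos_fanAt_of_ge ha h1, pos_fanAt_of_ge hb (h1.trans hlt.le)⟩

theorem hasDerivAt_re_pos_fanAt (h : ℝ) :
    HasDerivAt (fun h => (pos (fanAt a) h).re) (fan (level fan (a * h)))⁻¹ h := by
  have hs := isStrand_fanAt a
  have h1 := (hasDerivAt_xInt hs.continuous _).comp h
    (hs.hasDerivAt_level (h := h) (fanAt_pos a _).ne')
  refine (h1 : HasDerivAt (fun h => (pos (fanAt a) h).re) _ h).congr_deriv ?_
  have h2 : fanAt a (level (fanAt a) h) = fan (level fan (a * h)) := im_pos_fanAt ha h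
  rw [h2]
  have := (fan_pos (level fan (a * h))).ne'
  field_simp

/-- The steeper strands of a fan stay to the left of the less steep ones. -/
theorem re_pos_fanAt_lt (hab : a < b) {h : ℝ} (hh : 0 < h) :
    (pos (fanAt b) h).re < (pos (fanAt a) h).re := by
  have hb : 0 < b := ha.trans hab
  have hs := isStrand_fan
  have hd : ∀ h, HasDerivAt (fun h => (pos (fanAt a) h).re - (pos (fanAt b) h).re) _ h := fun h =>
    (hasDerivAt_re_pos_fanAt ha h).sub (hasDerivAt_re_pos_fanAt hb h)
  have hc : Continuous fun h => (pos (fanAt a) h).re - (pos (fanAt b) h).re :=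
    continuous_iff_continuousAt.2 fun h => (hd h).continuousAt
  have h01 : 0 < zInt fan 1 := by
    rw [← zInt_zero fan]
    exact hs.strictMono_zInt one_pos
  -- As a function of the height, x has derivative 1/y, and the steeper strand has the larger y. The
  -- comparison is strict until the strand `a` becomes straight, and weak afterwards.
  set r := min h (zInt fan 1 / a) with hr
  have hr0 : 0 < r := lt_min hh (div_pos h01 ha)
  have h1 : StrictMonoOn (fun h => (pos (fanAt a) h).re - (pos (fanAt b) h).re) (Icc 0 r) := by
    refine strictMonoOn_of_deriv_pos (convex_Icc _ _) hc.continuousOn fun k hk => ?_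
    rw [interior_Icc] at hk
    rw [(hd k).deriv, sub_pos]
    refine inv_strictAnti₀ (fan_pos _) (fan_lt_fan ?_ (hs.strictMono_level ?_))
    · rw [hs.level_lt_iff, ← lt_div_iff₀' ha]
      exact hk.2.trans_le (min_le_right _ _)
    · exact mul_lt_mul_of_pos_right hab hk.1
  have h2 : MonotoneOn (fun h => (pos (fanAt a) h).re - (pos (fanAt b) h).re) (Ici 0) := by
    refine monotoneOn_of_deriv_nonneg (convex_Ici _) hc.continuousOn
      (fun k _ => (hd k).differentiableAt.differentiableWithinAt) fun k hk => ?_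
    rw [interior_Ici] at hk
    rw [(hd k).deriv, sub_nonneg]
    refine inv_anti₀ (fan_pos _) ?_
    have := im_pos_fanAt_lt ha hb (mul_lt_mul_of_pos_right hab (mem_Ioi.1 hk))
    rw [im_pos_fanAt ha, im_pos_fanAt hb] at this
    rcases this with h3 | ⟨h3, h4⟩
    · exact h3.le
    · have h3' := congrArg Complex.im h3
      have h4' := congrArg Complex.im h4
      rw [im_pos_fanAt ha] at h3'
      rw [im_pos_fanAt hb] at h4'
      rw [h3', h4']
  have h3 := h1 ⟨le_rfl, hr0.le⟩ ⟨hr0.le, le_rfl⟩ hr0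
  have h4 := h2 (mem_Ici.2 hr0.le) (mem_Ici.2 hh.le) (min_le_left _ _)
  simp only [pos_fanAt_zero] at h3 h4
  linarith

end FanAt

/-- The strand `fanAt a` of length `E`, passed through in the other direction. -/
noncomputable def fanBack (a E s : ℝ) : ℝ := fanAt a (E - s)

theorem isStrand_fanBack (a E : ℝ) : IsStrand (fanBack a E) :=
  ⟨(contDiff_fanAt a).comp (contDiff_const.sub contDiff_id),
    fun _ h => absurd h (fanAt_pos a _).ne', 0, fun _ _ => (fan_gt _).le⟩

theorem fanBack_end (a E : ℝ) : fanBack a E E = 3 / 4 := by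
  rw [fanBack, sub_self, fanAt_zero]

theorem deriv_fanBack_end (a E : ℝ) : deriv (fanBack a E) E = -(a / 4) := by
  have h1 : HasDerivAt (fun s : ℝ => E - s) (-1) E := (hasDerivAt_id E).const_sub E
  have h2 : HasDerivAt (fanAt a) (a / 4) (E - E) := by
    rw [sub_self, ← deriv_fanAt_zero]
    exact ((contDiff_fanAt a).differentiable (by simp) 0).hasDerivAt
  have h3 : HasDerivAt (fanBack a E) _ E := h2.comp E h1
  rw [h3.deriv]
  ring

theorem xInt_comp_const_sub {w : ℝ → ℝ} (hw : Continuous w) (E s : ℝ) :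
    xInt (fun s => w (E - s)) s = xInt w E - xInt w (E - s) := by
  rw [xInt_sub_eq hw, xInt, intervalIntegral.integral_comp_sub_left, sub_zero]

theorem zInt_fanBack (a E s : ℝ) :
    zInt (fanBack a E) s = zInt (fanAt a) E - zInt (fanAt a) (E - s) :=
  xInt_comp_const_sub (w := fun s => fanAt a s ^ 2) ((isStrand_fanAt a).continuous.pow 2) E s

/-- The equation dz = y dx is invariant under (x, z) ↦ (-x, -z), so reversing the parameter reflects
x and z and keeps y. -/
theorem pos_fanBack (a E h : ℝ) :
    pos (fanBack a E) (zInt (fanAt a) E - h) =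
      ⟨xInt (fanAt a) E - (pos (fanAt a) h).re, (pos (fanAt a) h).im⟩ := by
  have hs := isStrand_fanAt a
  have h1 : level (fanBack a E) (zInt (fanAt a) E - h) = E - level (fanAt a) h := by
    rw [(isStrand_fanBack a E).level_eq_iff, zInt_fanBack, sub_sub_cancel, hs.zInt_level]
  have h2 : xInt (fanBack a E) (E - level (fanAt a) h) = _ := xInt_comp_const_sub hs.continuous _ _
  rw [pos, h1, h2, fanBack, sub_sub_cancel, pos]

theorem fanBack_of_nonpos {a E s : ℝ} (ha : 0 < a) (hE : 1 / a ≤ E) (hs : s ≤ 0) :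
    fanBack a E s = 1 :=
  fanAt_of_ge ha (by linarith)

/-! ### Concatenation of lifts, and half turns between points of the real axis -/

namespace HasLift

variable {P Q R : ℝ → ℂ} {α β T θ₀ θ₁ θ₂ : ℝ}

theorem append (hP : HasLift P α β θ₀ θ₁) (hQ : HasLift Q 0 T θ₁ θ₂) (hαβ : α ≤ β) (hT : 0 ≤ T)
    (h1 : ∀ t ∈ Icc α β, P t = R t) (h2 : ∀ t ∈ Icc 0 T, Q t = R (β + t)) :
    HasLift R α (β + T) θ₀ θ₂ := by
  have hQ' := hQ.comp_sub β
  rw [add_zero] at hQ'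
  refine (hP.congr h1).trans (hQ'.congr fun t ht => ?_) hαβ (by linarith)
  rw [h2 _ ⟨by linarith [ht.1], by linarith [ht.2]⟩, add_sub_cancel]

theorem of_const {v : ℂ} {θ : ℝ} (hv : HasAngle v θ) : HasLift (fun _ => v) α β θ θ :=
  ⟨fun _ => θ, continuousOn_const, rfl, rfl, fun _ _ => hv⟩

end HasLift

/-- The parity of a number of half turns records on which side of the origin a real displacement
lies. -/
theorem HasAngle.even_iff {a : ℝ} {M : ℤ} (h : HasAngle ⟨a, 0⟩ (Real.pi * M)) :
    Even M ↔ 0 < a := by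
  obtain ⟨r, hr, h1, -⟩ := h.re_eq
  simp only at h1
  rcases Int.even_or_odd' M with ⟨n, hn | hn⟩
  · have h2 : Real.cos (Real.pi * M) = 1 := by
      rw [hn]
      push_cast
      rw [show Real.pi * (2 * (n : ℝ)) = n * (2 * Real.pi) by ring, Real.cos_int_mul_two_pi]
    rw [h1, h2, mul_one]
    exact ⟨fun _ => hr, fun _ => hn ▸ even_two_mul n⟩
  · have h2 : Real.cos (Real.pi * M) = -1 := by
      rw [hn]
      push_cast
      rw [show Real.pi * (2 * (n : ℝ) + 1) = n * (2 * Real.pi) + Real.pi by ring,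
        Real.cos_add_pi, Real.cos_int_mul_two_pi]
    rw [h1, h2]
    refine ⟨fun he => ?_, fun he => by linarith⟩
    exact absurd he (Int.not_even_iff_odd.2 ⟨n, hn⟩)

/-- The sign of the crossing of the origin, from `a` to `b`. -/
noncomputable def crossSign (a b : ℝ) : ℤ :=
  if a < 0 ∧ 0 < b then 1 else if 0 < a ∧ b < 0 then -1 else 0

theorem crossSign_neg (a b : ℝ) : crossSign (-a) (-b) = -crossSign a b := by
  unfold crossSign
  simp only [Left.neg_neg_iff, Left.neg_pos_iff]
  split_ifs <;> first | rfl | (exfalso; linarith [‹_ ∧ _›.1])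

theorem crossSign_congr {a b a' b' : ℝ} (ha : 0 < a ↔ 0 < a') (hb : 0 < b ↔ 0 < b')
    (ha' : a < 0 ↔ a' < 0) (hb' : b < 0 ↔ b' < 0) : crossSign a b = crossSign a' b' := by
  unfold crossSign
  simp only [ha, hb, ha', hb']

/-- A path in the lower half plane from a point of the real axis to another one. -/
theorem HasLift.of_lower {P : ℝ → ℂ} {α β a b : ℝ} (hP : ContinuousOn P (Icc α β))
    (h0 : ∀ t ∈ Icc α β, P t ≠ 0) (him : ∀ t ∈ Icc α β, (P t).im ≤ 0) (hα : P α = ⟨a, 0⟩)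
    (hβ : P β = ⟨b, 0⟩) (hb : b ≠ 0) {M : ℤ} (hM : HasAngle ⟨a, 0⟩ (Real.pi * M)) :
    HasLift P α β (Real.pi * M) (Real.pi * (M + crossSign a b : ℤ)) := by
  have hpi := Real.pi_pos
  have ha : a ≠ 0 := fun e => hM.ne_zero (by rw [e]; rfl)
  have hα' : HasAngle (P α) (Real.pi * M) := hα ▸ hM
  rcases Int.even_or_odd' M with ⟨n, hn | hn⟩
  · have ha : 0 < a := hM.even_iff.1 (hn ▸ even_two_mul n)
    rcases hb.lt_or_gt with hb | hb
    · have hc : crossSign a b = -1 := by simp [crossSign, ha, hb, not_lt.2 ha.le]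
      have hang := hasAngle_of_neg hb (n - 1)
      rw [hc, hn]
      rw [hn] at hα'
      push_cast at hα' hang ⊢
      refine HasLift.of_im_nonpos hP n h0 him hα' ?_ ⟨by linarith, by linarith⟩
        ⟨by linarith, by linarith⟩
      rw [hβ]
      convert hang using 1
      ring
    · have hc : crossSign a b = 0 := by simp [crossSign, not_lt.2 ha.le, not_lt.2 hb.le]
      have hang := hasAngle_of_pos hb n
      rw [hc, hn]
      rw [hn] at hα'
      push_cast at hα' hang ⊢
      refine HasLift.of_im_nonpos hP n h0 him hα' ?_ ⟨by linarith, by linarith⟩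
        ⟨by linarith, by linarith⟩
      rw [hβ]
      convert hang using 1
      ring
  · have ha : a < 0 := lt_of_le_of_ne (not_lt.1 fun h =>
      absurd (hM.even_iff.2 h) (Int.not_even_iff_odd.2 ⟨n, hn⟩)) ha
    rcases hb.lt_or_gt with hb | hb
    · have hc : crossSign a b = 0 := by simp [crossSign, not_lt.2 ha.le, not_lt.2 hb.le]
      have hang := hasAngle_of_neg hb n
      rw [hc, hn]
      rw [hn] at hα'
      push_cast at hα' hang ⊢
      refine HasLift.of_im_nonpos hP (n + 1) h0 him hα' ?_
        ⟨by push_cast; linarith, by push_cast; linarith⟩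
        ⟨by push_cast; linarith, by push_cast; linarith⟩
      rw [hβ]
      convert hang using 1
      ring
    · have hc : crossSign a b = 1 := by simp [crossSign, ha, hb]
      have hang := hasAngle_of_pos hb (n + 1)
      rw [hc, hn]
      rw [hn] at hα'
      push_cast at hα' hang ⊢
      refine HasLift.of_im_nonpos hP (n + 1) h0 him hα' ?_
        ⟨by push_cast; linarith, by push_cast; linarith⟩
        ⟨by push_cast; linarith, by push_cast; linarith⟩
      rw [hβ]
      convert hang using 1
      ring

/-- A path in the upper half plane from a point of the real axis to another one. -/
theorem HasLift.of_upper {P : ℝ → ℂ} {α β a b : ℝ} (hP : ContinuousOn P (Icc α β))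
    (h0 : ∀ t ∈ Icc α β, P t ≠ 0) (him : ∀ t ∈ Icc α β, 0 ≤ (P t).im) (hα : P α = ⟨a, 0⟩)
    (hβ : P β = ⟨b, 0⟩) (hb : b ≠ 0) {M : ℤ} (hM : HasAngle ⟨a, 0⟩ (Real.pi * M)) :
    HasLift P α β (Real.pi * M) (Real.pi * (M - crossSign a b : ℤ)) := by
  have hpi := Real.pi_pos
  have ha : a ≠ 0 := fun e => hM.ne_zero (by rw [e]; rfl)
  have hα' : HasAngle (P α) (Real.pi * M) := hα ▸ hM
  rcases Int.even_or_odd' M with ⟨n, hn | hn⟩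
  · have ha : 0 < a := hM.even_iff.1 (hn ▸ even_two_mul n)
    rcases hb.lt_or_gt with hb | hb
    · have hc : crossSign a b = -1 := by simp [crossSign, ha, hb, not_lt.2 ha.le]
      have hang := hasAngle_of_neg hb (n)
      rw [hc, hn]
      rw [hn] at hα'
      push_cast at hα' hang ⊢
      refine HasLift.of_im_nonneg hP n h0 him hα' ?_ ⟨by linarith, by linarith⟩
        ⟨by linarith, by linarith⟩
      rw [hβ]
      convert hang using 1
      ring
    · have hc : crossSign a b = 0 := by simp [crossSign, not_lt.2 ha.le, not_lt.2 hb.le]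
      have hang := hasAngle_of_pos hb n
      rw [hc, hn]
      rw [hn] at hα'
      push_cast at hα' hang ⊢
      refine HasLift.of_im_nonneg hP n h0 him hα' ?_ ⟨by linarith, by linarith⟩
        ⟨by linarith, by linarith⟩
      rw [hβ]
      convert hang using 1
      ring
  · have ha : a < 0 := lt_of_le_of_ne (not_lt.1 fun h =>
      absurd (hM.even_iff.2 h) (Int.not_even_iff_odd.2 ⟨n, hn⟩)) ha
    rcases hb.lt_or_gt with hb | hb
    · have hc : crossSign a b = 0 := by simp [crossSign, not_lt.2 ha.le, not_lt.2 hb.le]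
      have hang := hasAngle_of_neg hb n
      rw [hc, hn]
      rw [hn] at hα'
      push_cast at hα' hang ⊢
      refine HasLift.of_im_nonneg hP n h0 him hα' ?_
        ⟨by linarith, by linarith⟩
        ⟨by linarith, by linarith⟩
      rw [hβ]
      convert hang using 1
      ring
    · have hc : crossSign a b = 1 := by simp [crossSign, ha, hb]
      have hang := hasAngle_of_pos hb n
      rw [hc, hn]
      rw [hn] at hα'
      push_cast at hα' hang ⊢
      refine HasLift.of_im_nonneg hP n h0 him hα' ?_
        ⟨by linarith, by linarith⟩
        ⟨by linarith, by linarith⟩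
      rw [hβ]
      convert hang using 1
      ring

/-- The push-off adds ε to the differences of lanes. For small ε this does not affect the order of
the strands. -/
theorem eventually_pos_iff {r : ℝ} (hr : r ≠ 0) :
    ∀ᶠ ε in 𝓝[>] (0 : ℝ), (0 < r + ε ↔ 0 < r) ∧ (r + ε < 0 ↔ r < 0) ∧ r + ε ≠ 0 := by
  filter_upwards [Ioo_mem_nhdsGT (abs_pos.2 hr)] with ε hε
  have h1 := hε.1
  have h2 := hε.2
  rcases hr.lt_or_gt with h | h
  · rw [abs_of_neg h] at h2
    exact ⟨⟨fun _ => by linarith, fun _ => by linarith⟩, ⟨fun _ => h, fun _ => by linarith⟩,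
      by linarith⟩
  · exact ⟨⟨fun _ => h, fun _ => by linarith⟩, ⟨fun _ => by linarith, fun _ => by linarith⟩,
      by linarith⟩

theorem deriv_zero_of_eq_one {w : ℝ → ℝ} (hw : IsStrand w) (h1 : ∀ s ≤ 0, w s = 1) :
    deriv w 0 = 0 := by
  have h2 : HasDerivWithinAt w 0 (Iic 0) 0 :=
    (hasDerivWithinAt_const (0 : ℝ) (Iic 0) (1 : ℝ)).congr h1 (h1 0 le_rfl)
  exact (uniqueDiffWithinAt_Iic 0).eq_deriv _ (hw.differentiable 0).hasDerivAt.hasDerivWithinAt h2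

theorem hasLift_tangent_prolong {y w : ℝ → ℝ} {S L θ₀ θ₁ θ₂ : ℝ} (hy : IsStrand y) (hS : 0 ≤ S)
    (hyS : ∀ s, S - 1 ≤ s → y s = 1) (hw : IsStrand w) (hw0 : ∀ s ≤ 0, w s = 1) (hL : 0 ≤ L)
    (h1 : HasLift (tangent y) 0 S θ₀ θ₁) (h2 : HasLift (tangent w) 0 L θ₁ θ₂) :
    HasLift (tangent (prolong y S w)) 0 (S + L) θ₀ θ₂ := by
  have hd : ∀ s, deriv (prolong y S w) s = deriv y s + deriv w (s - S) := by
    intro s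
    have hws : HasDerivAt (fun s => w (s - S)) (deriv w (s - S)) s := by
      simpa using (hw.differentiable (s - S)).hasDerivAt.comp_sub_const s S
    exact (((hy.differentiable s).hasDerivAt.add hws).sub_const 1).deriv
  have hw0' : ∀ s ≤ 0, deriv w s = 0 := by
    intro s hs
    rcases hs.eq_or_lt with rfl | hlt
    · exact deriv_zero_of_eq_one hw hw0
    · have : w =ᶠ[𝓝 s] fun _ => 1 := by
        filter_upwards [gt_mem_nhds hlt] with t ht using hw0 t ht.le
      rw [this.deriv_eq, deriv_const]
  have hy0 : ∀ s, S ≤ s → deriv y s = 0 := by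
    intro s hs
    have : y =ᶠ[𝓝 s] fun _ => 1 := by
      filter_upwards [lt_mem_nhds (show S - 1 < s by linarith)] with t ht using hyS t ht.le
    rw [this.deriv_eq, deriv_const]
  refine h1.append h2 hS hL (fun s hs => ?_) fun s hs => ?_
  · rw [tangent, tangent, hd, hw0' _ (by linarith [hs.2]), prolong_of_le hw0 hs.2, add_zero]
  · rw [tangent, tangent, hd, hy0 _ (by linarith [hs.1]),
      prolong_of_ge (fun s hs => hyS s (by linarith)) (by linarith [hs.1]), add_sub_cancel_left,
      zero_add]

/-! ### Towers: three ascending strands which start at a vertex -/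

/-- The slope at the vertex of the strand with index `i`. -/
noncomputable def fanSlope (i : Fin 3) : ℝ := 3 - (i : ℕ)

theorem one_le_fanSlope (i : Fin 3) : 1 ≤ fanSlope i := by
  fin_cases i <;> norm_num [fanSlope]

theorem fanSlope_lt {i j : Fin 3} (hij : i < j) : fanSlope j < fanSlope i := by
  have : ((i : ℕ) : ℝ) < (j : ℕ) := by exact_mod_cast hij
  rw [fanSlope, fanSlope]
  linarith

/-- The number of half turns of the displacements between three strands, where the `k`-th strand
makes `-N k` turns and the `k`-th and the `l`-th strand make `m k l` half turns around each
other. -/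
def winding (N : Fin 3 → ℤ) (m : Fin 3 → Fin 3 → ℤ) (k l : Fin 3) : ℤ :=
  if k = l then -2 * N k else m k l + if k < l then 1 else 0

/-- Three ascending strands, of lengths `S i`, which start at a common vertex and end at the height
`H` as parallel straight lines in the lanes `q i`. -/
structure IsTower (y : Fin 3 → ℝ → ℝ) (S : Fin 3 → ℝ) (H : ℝ) (q : Fin 3 → ℝ) (N : Fin 3 → ℤ)
    (m : Fin 3 → Fin 3 → ℤ) : Prop where
  strand : ∀ i, IsStrand (y i)
  one_lt_length : ∀ i, 1 < S i
  straight : ∀ i s, S i - 1 ≤ s → y i s = 1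
  height : ∀ i, zInt (y i) (S i) = H
  lane : ∀ i, xInt (y i) (S i) = q i + H
  injective : Function.Injective q
  start : ∀ i, ∀ s ≤ 1, y i s = fanAt (fanSlope i) s
  disjoint : ∀ i j, i ≠ j → ∀ h ∈ Ioc 0 H, pos (y i) h ≠ pos (y j) h
  turn : ∀ i, HasLift (tangent (y i)) 0 (S i) (tangent (y i) 0).arg (2 * Real.pi * (-N i : ℤ))
  chord : ∀ᶠ ε in 𝓝[>] 0, ∃ A : Fin 3 → ℝ, ∀ k l,
    HasLift (gap y ε k l) ε H (A k) (Real.pi * winding N m k l)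

namespace IsTower

variable {y W : Fin 3 → ℝ → ℝ} {S L : Fin 3 → ℝ} {H T : ℝ} {q c : Fin 3 → ℝ} {N N' : Fin 3 → ℤ}
  {m m' : Fin 3 → Fin 3 → ℤ} (hy : IsTower y S H q N m)
include hy

theorem height_pos : 0 < H := by
  rw [← hy.height 0, ← zInt_zero (y 0)]
  exact (hy.strand 0).strictMono_zInt (by linarith [hy.one_lt_length 0])

theorem tangent_zero (i : Fin 3) : tangent (y i) 0 = ⟨3 / 4, fanSlope i / 4⟩ := by
  have h : y i =ᶠ[𝓝 0] fanAt (fanSlope i) := by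
    filter_upwards [gt_mem_nhds one_pos] with s hs using hy.start i s hs.le
  rw [tangent, h.deriv_eq, deriv_fanAt_zero, h.eq_of_nhds, fanAt_zero]

theorem pos_end (i : Fin 3) {h : ℝ} (hh : -1 ≤ h) : pos (y i) (H + h) = ⟨q i + H + h, 1⟩ := by
  have hs := hy.strand i
  have h1 := zInt_of_eq_one_of_le hs.continuous (hy.straight i) (s := S i) (by linarith)
  have h2 := xInt_of_eq_one_of_le hs.continuous (hy.straight i) (s := S i) (by linarith)
  rw [hy.height] at h1
  rw [hy.lane] at h2
  have h3 := pos_of_eq_one_of_le hs (hy.straight i) (h := 1 + h) (by linarith)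
  rw [show zInt (y i) (S i - 1) + (1 + h) = H + h by linarith,
    show xInt (y i) (S i - 1) + (1 + h) = q i + H + h by linarith] at h3
  exact h3

/-- On top of a tower the strands are straight and y = 1, so the gap is the real number q k - q l +
ε, the end of the lift in `chord`. -/
theorem hasAngle_winding : ∀ᶠ ε in 𝓝[>] (0 : ℝ), ∀ k l,
    HasAngle ⟨q k - q l + ε, 0⟩ (Real.pi * winding N m k l) := by
  filter_upwards [hy.chord, Ioo_mem_nhdsGT (lt_min hy.height_pos one_pos)] with ε ⟨A, hA⟩ hε k l
  rw [mem_Ioo, lt_min_iff] at hε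
  have := (hA k l).hasAngle_right hε.2.1.le
  convert this using 1
  have h1 := hy.pos_end k (h := 0) (by linarith)
  rw [add_zero] at h1
  rw [gap, h1, show H - ε = H + -ε by ring, hy.pos_end l (by linarith [hε.2.2])]
  apply Complex.ext <;> simp
  ring

variable (hW : ∀ i, IsStrand (W i)) (hW0 : ∀ i, ∀ s ≤ 0, W i s = 1)
include hW hW0

theorem pos_prolong (i : Fin 3) {h : ℝ} (hh : -1 ≤ h) :
    pos (prolong (y i) (S i) (W i)) (H + h) = ((q i + H : ℝ) : ℂ) + pos (W i) h := by
  rw [← hy.height i, pos_prolong_add' (hy.strand i) (hW i) (hW0 i) (hy.one_lt_length i).le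
    (hy.straight i) hh, hy.lane, hy.height]

theorem pos_prolong_of_le (i : Fin 3) {h : ℝ} (hh : h ≤ H) :
    pos (prolong (y i) (S i) (W i)) h = pos (y i) h :=
  _root_.pos_prolong_of_le (hy.strand i) (by linarith [hy.one_lt_length i])
    (fun s hs => hy.straight i s (by linarith)) (hW i) (hW0 i) (by rwa [hy.height])

theorem hasLift_gap_prolong {ε : ℝ} {k l : Fin 3} {θ₀ θ₁ θ₂ : ℝ} (hε : ε ∈ Ioc 0 1) (hεH : ε ≤ H)
    (hT : 0 ≤ T) (h1 : HasLift (gap y ε k l) ε H θ₀ θ₁)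
    (h2 : HasLift (fun h => ((q k - q l : ℝ) : ℂ) + gap W ε k l h) 0 T θ₁ θ₂) :
    HasLift (gap (fun i => prolong (y i) (S i) (W i)) ε k l) ε (H + T) θ₀ θ₂ := by
  refine h1.append h2 hεH hT (fun h hh => ?_) fun h hh => ?_
  · rw [gap, gap, hy.pos_prolong_of_le hW hW0 k hh.2,
      hy.pos_prolong_of_le hW hW0 l (by linarith [hh.2, hε.1])]
  · rw [gap, gap, hy.pos_prolong hW hW0 k (by linarith [hh.1]),
      add_sub_assoc H, hy.pos_prolong hW hW0 l (by linarith [hh.1, hε.2])]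
    push_cast
    ring

theorem disjoint_prolong (hdis : ∀ i j, i ≠ j → ∀ h ∈ Ioc 0 T,
      ((q i - q j : ℝ) : ℂ) + (pos (W i) h - pos (W j) h) ≠ 0) :
    ∀ i j, i ≠ j → ∀ h ∈ Ioc 0 (H + T), pos (prolong (y i) (S i) (W i)) h ≠
      pos (prolong (y j) (S j) (W j)) h := by
  intro i j hij h hh
  rcases le_or_gt h H with h1 | h1
  · rw [hy.pos_prolong_of_le hW hW0 i h1, hy.pos_prolong_of_le hW hW0 j h1]
    exact hy.disjoint i j hij h ⟨hh.1, h1⟩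
  · obtain ⟨r, rfl⟩ : ∃ r, h = H + r := ⟨h - H, by ring⟩
    rw [hy.pos_prolong hW hW0 i (by linarith), hy.pos_prolong hW hW0 j (by linarith)]
    refine fun e => hdis i j hij r ⟨by linarith, by linarith [hh.2]⟩ ?_
    push_cast at e ⊢
    linear_combination e

theorem zInt_prolong (hL : ∀ i, 0 ≤ L i) (hz : ∀ i, zInt (W i) (L i) = T) (i : Fin 3) :
    zInt (prolong (y i) (S i) (W i)) (S i + L i) = H + T := by
  rw [(_root_.zInt_prolong (hy.strand i) (by linarith [hy.one_lt_length i])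
    (fun s hs => hy.straight i s (by linarith)) (hW i) (hW0 i)).2 _ (hL i), hy.height, hz]

theorem xInt_prolong (hL : ∀ i, 0 ≤ L i) (i : Fin 3) :
    xInt (prolong (y i) (S i) (W i)) (S i + L i) = q i + H + xInt (W i) (L i) := by
  rw [(_root_.xInt_prolong (hy.strand i) (by linarith [hy.one_lt_length i])
    (fun s hs => hy.straight i s (by linarith)) (hW i) (hW0 i)).2 _ (hL i), hy.lane]

omit hW in
theorem tangent_prolong_zero (i : Fin 3) :
    tangent (prolong (y i) (S i) (W i)) 0 = tangent (y i) 0 := by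
  have := hy.one_lt_length i
  rw [tangent, tangent, prolong_of_le (hW0 i) (by linarith),
    deriv_prolong_of_lt (hW0 i) (by linarith)]

theorem turn_prolong {θ₂ : ℝ} (i : Fin 3) (hL : 0 ≤ L i)
    (h : HasLift (tangent (W i)) 0 (L i) (2 * Real.pi * (-N i : ℤ)) θ₂) :
    HasLift (tangent (prolong (y i) (S i) (W i))) 0 (S i + L i) (tangent (y i) 0).arg θ₂ :=
  hasLift_tangent_prolong (hy.strand i) (by linarith [hy.one_lt_length i]) (hy.straight i) (hW i)
    (hW0 i) hL (hy.turn i) h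

/-- A tower can be prolonged. -/
theorem extend (hL : ∀ i, 1 ≤ L i) (hW1 : ∀ i s, L i - 1 ≤ s → W i s = 1)
    (hz : ∀ i, zInt (W i) (L i) = T) (hx : ∀ i, xInt (W i) (L i) = c i + T)
    (hinj : Function.Injective fun i => q i + c i)
    (hdis : ∀ i j, i ≠ j → ∀ h ∈ Ioc 0 T,
      ((q i - q j : ℝ) : ℂ) + (pos (W i) h - pos (W j) h) ≠ 0)
    (hturn : ∀ i, HasLift (tangent (W i)) 0 (L i) (2 * Real.pi * (-N i : ℤ))
      (2 * Real.pi * (-N' i : ℤ)))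
    (hchord : ∀ᶠ ε in 𝓝[>] (0 : ℝ), ∀ k l,
      HasLift (fun h => ((q k - q l : ℝ) : ℂ) + gap W ε k l h) 0 T (Real.pi * winding N m k l)
        (Real.pi * winding N' m' k l)) :
    IsTower (fun i => prolong (y i) (S i) (W i)) (fun i => S i + L i) (H + T)
      (fun i => q i + c i) N' m' where
  strand i := isStrand_prolong (hy.strand i) (fun s hs => hy.straight i s (by linarith)) (hW i)
    (hW0 i)
  one_lt_length i := by linarith [hL i, hy.one_lt_length i]
  straight i s hs := by
    rw [prolong_of_ge (fun s hs => hy.straight i s (by linarith)) (by linarith [hL i])]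
    exact hW1 i _ (by linarith)
  height := hy.zInt_prolong hW hW0 (fun i => by linarith [hL i]) hz
  lane i := by
    rw [hy.xInt_prolong hW hW0 (fun i => by linarith [hL i]), hx]
    ring
  injective := hinj
  start i s hs := by
    rw [prolong_of_le (hW0 i) (by linarith [hy.one_lt_length i])]
    exact hy.start i s hs
  disjoint := hy.disjoint_prolong hW hW0 hdis
  turn i := by
    rw [hy.tangent_prolong_zero hW0]
    exact hy.turn_prolong hW hW0 i (by linarith [hL i]) (hturn i)
  chord := by
    have hT : 0 ≤ T := by
      rw [← hz 0, ← zInt_zero (W 0)]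
      exact (hW 0).strictMono_zInt.monotone (by linarith [hL 0])
    filter_upwards [hy.chord, hchord, Ioo_mem_nhdsGT (lt_min hy.height_pos one_pos)]
      with ε ⟨A, hA⟩ hε' hε
    rw [mem_Ioo, lt_min_iff] at hε
    exact ⟨A, fun k l => hy.hasLift_gap_prolong hW hW0 ⟨hε.1, hε.2.2.le⟩ hε.2.1.le hT (hA k l)
      (hε' k l)⟩

end IsTower

/-! ### The initial fan -/

theorem fan_le_one (s : ℝ) : fan s ≤ 1 := by
  have := mul_nonneg (Real.exp_pos 1).le (expNegInvGlue.nonneg (1 - s))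
  rw [fan]
  linarith

theorem zInt_fan_one_le : zInt fan 1 ≤ 1 := by
  have hc : Continuous fun u => fan u ^ 2 := contDiff_fan.continuous.pow 2
  have : ∫ u in (0 : ℝ)..1, fan u ^ 2 ≤ ∫ _ in (0 : ℝ)..1, (1 : ℝ) :=
    intervalIntegral.integral_mono_on zero_le_one (hc.intervalIntegrable _ _)
      (by simp) fun u _ => pow_le_one₀ (fan_pos u).le (fan_le_one u)
  simpa [zInt] using this

theorem tangent_fanAt_of_gt {a s : ℝ} (ha : 0 < a) (hs : 1 / a < s) :
    tangent (fanAt a) s = ⟨1, 0⟩ := by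
  have : fanAt a =ᶠ[𝓝 s] fun _ => 1 := by
    filter_upwards [lt_mem_nhds hs] with t ht using fanAt_of_ge ha ht.le
  rw [tangent, this.deriv_eq, deriv_const, this.eq_of_nhds]

theorem fanSlope_pos (i : Fin 3) : 0 < fanSlope i := zero_lt_one.trans_le (one_le_fanSlope i)

theorem fanLane_div_lt {i j : Fin 3} (hij : i < j) : fanLane / fanSlope i < fanLane / fanSlope j :=
  div_lt_div_of_pos_left fanLane_pos (fanSlope_pos j) (fanSlope_lt hij)

theorem pos_fanSlope (i : Fin 3) {h : ℝ} (hh : 1 ≤ h) :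
    pos (fanAt (fanSlope i)) h = ⟨fanLane / fanSlope i + h, 1⟩ :=
  pos_fanAt_of_ge (fanSlope_pos i) (by nlinarith [zInt_fan_one_le, one_le_fanSlope i])

/-- Three strands which leave a vertex in different directions. -/
theorem exists_isTower_fan : ∃ y S H q, StrictMono q ∧
    IsTower y S H q (fun _ => 0) fun _ _ => 0 := by
  have hpi := Real.pi_pos
  have hs := fun i => isStrand_fanAt (fanSlope i)
  have hp := fanSlope_pos
  -- The strands are straight from the parameter 1 on. The height 3 leaves more than the unit of
  -- straight strand that a tower needs.
  have hS : ∀ i, 2 < level (fanAt (fanSlope i)) 3 := fun i => by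
    have h1 : 1 / fanSlope i ≤ 1 := by
      rw [div_le_one (hp i)]
      exact one_le_fanSlope i
    have h2 := zInt_of_eq_one_of_le (hs i).continuous (fun s => fanAt_of_ge (hp i))
      (s := 2) (by linarith)
    rw [(hs i).lt_level_iff, h2, zInt_fanAt (hp i), mul_one_div_cancel (hp i).ne']
    have := div_le_div_of_nonneg_right zInt_fan_one_le (hp i).le
    linarith
  have hle : ∀ i, 1 / fanSlope i ≤ 1 := fun i => by
    rw [div_le_one (hp i)]
    exact one_le_fanSlope i
  have hmono : StrictMono fun i => fanLane / fanSlope i := fun i j hij => fanLane_div_lt hij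
  have hlane : ∀ i, xInt (fanAt (fanSlope i)) (level (fanAt (fanSlope i)) 3) =
      fanLane / fanSlope i + 3 := fun i => by
    have := congrArg Complex.re (pos_fanSlope i (h := 3) (by norm_num))
    exact this
  refine ⟨fun i => fanAt (fanSlope i), fun i => level (fanAt (fanSlope i)) 3, 3,
    fun i => fanLane / fanSlope i, hmono, hs, fun i => by linarith [hS i],
    fun i s h => fanAt_of_ge (hp i) (by linarith [hS i, hle i]), fun i => (hs i).zInt_level 3,
    hlane, hmono.injective, fun i s _ => rfl, fun i j hij h hh => ?_, fun i => ?_, ?_⟩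
  · wlog hlt : i < j generalizing i j
    · exact (this j i hij.symm (lt_of_le_of_ne (not_lt.1 hlt) hij.symm)).symm
    · exact fun e => (re_pos_fanAt_lt (hp j) (fanSlope_lt hlt) hh.1).ne (congrArg Complex.re e)
  · refine HasLift.of_re_nonneg (hs i).continuous_tangent.continuousOn 0
      (fun s _ => (hs i).tangent_ne_zero s) (fun s _ => (fanAt_pos _ s).le)
      (hasAngle_arg ((hs i).tangent_ne_zero 0)) ?_ ?_ ?_
    · rw [tangent_fanAt_of_gt (hp i) (by linarith [hS i, hle i])]
      exact hasAngle_of_pos one_pos _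
    · have := abs_le.1 (Complex.abs_arg_le_pi_div_two_iff.2
        (show 0 ≤ (tangent (fanAt (fanSlope i)) 0).re from (fanAt_pos _ _).le))
      constructor <;> push_cast <;> linarith [this.1, this.2]
    · constructor <;> simp <;> linarith
  · have hev : ∀ᶠ ε in 𝓝[>] (0 : ℝ), ∀ k l : Fin 3, k ≠ l →
        (fanLane / fanSlope k - fanLane / fanSlope l) + ε ≠ 0 ∧
        ((fanLane / fanSlope k - fanLane / fanSlope l) + ε < 0 ↔
          fanLane / fanSlope k - fanLane / fanSlope l < 0) := by
      refine eventually_all.2 fun k => eventually_all.2 fun l => ?_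
      by_cases hkl : k = l
      · exact Eventually.of_forall fun _ h => absurd hkl h
      · filter_upwards [eventually_pos_iff (sub_ne_zero.2 fun e => hkl (hmono.injective e))]
          with ε hε _ using ⟨hε.2.2, hε.2.1⟩
    filter_upwards [hev, Ioo_mem_nhdsGT one_pos] with ε hε hε1
    have hc := fun k l => (IsTheta.continuous_gap hs ε k l).continuousOn (s := Icc ε 3)
    have hstart : ∀ k l, gap (fun i => fanAt (fanSlope i)) ε k l ε =
        gap (fun i => fanAt (fanSlope i)) ε k k ε := fun k l => by
      simp only [gap, sub_self, pos_fanAt_zero]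
    have hend : ∀ k l, gap (fun i => fanAt (fanSlope i)) ε k l 3 =
        ⟨(fanLane / fanSlope k - fanLane / fanSlope l) + ε, 0⟩ := fun k l => by
      rw [gap, pos_fanSlope k (by norm_num), pos_fanSlope l (by linarith [hε1.2])]
      apply Complex.ext <;> simp
      ring
    -- If k ≥ l, strand k is not to the left of strand l, and pushing l up shifts the gap further to
    -- the right: the gap stays in the right half plane and makes no half turn.
    have hre : ∀ k l, ¬ k < l → ∀ h, ε ≤ h →
        0 < (gap (fun i => fanAt (fanSlope i)) ε k l h).re := fun k l hkl h hh => by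
      have h1 := strictMono_re_pos_fanAt (fanSlope l) (show h - ε < h by linarith [hε1.1])
      have h2 : (pos (fanAt (fanSlope l)) h).re ≤ (pos (fanAt (fanSlope k)) h).re := by
        rcases (not_lt.1 hkl).eq_or_lt with rfl | hlt
        · exact le_rfl
        · exact (re_pos_fanAt_lt (hp k) (fanSlope_lt hlt) (hε1.1.trans_le hh)).le
      rw [gap, Complex.sub_re]
      linarith
    -- If k < l, strand k is the steeper one, has the larger y and ends to the left. The gap passes
    -- through the upper half plane to the negative axis; this half turn is the summand 1 in
    -- `winding`.
    have him : ∀ k l, k < l → ∀ h, ε ≤ h →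
        0 ≤ (gap (fun i => fanAt (fanSlope i)) ε k l h).im ∧
          gap (fun i => fanAt (fanSlope i)) ε k l h ≠ 0 := fun k l hkl h hh => by
      have hmul : fanSlope l * (h - ε) < fanSlope k * h := by
        have := fanSlope_lt hkl
        nlinarith [hp l, hp k, hε1.1, mul_pos (hp l) hε1.1]
      rcases im_pos_fanAt_lt (hp l) (hp k) hmul with h1 | ⟨h1, h2⟩
      · have h2 : 0 < (gap (fun i => fanAt (fanSlope i)) ε k l h).im := by
          rw [gap, Complex.sub_im]
          linarith
        refine ⟨h2.le, fun e => ?_⟩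
        rw [e] at h2
        exact lt_irrefl _ h2
      · rw [gap, h1, h2]
        refine ⟨by simp, fun e => (hε k l hkl.ne).1 ?_⟩
        have := congrArg Complex.re e
        simp at this
        linarith
    refine ⟨fun k => (gap (fun i => fanAt (fanSlope i)) ε k k ε).arg, fun k l => ?_⟩
    have hne : gap (fun i => fanAt (fanSlope i)) ε k k ε ≠ 0 := fun e => by
      have := hre k k (lt_irrefl k) ε le_rfl
      rw [e] at this
      exact lt_irrefl _ this
    by_cases hkl : k < l
    · have hw : winding (fun _ => 0) (fun _ _ => 0) k l = 1 := by simp [winding, hkl, hkl.ne]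
      rw [hw]
      refine HasLift.of_im_nonneg (hc k l) 0 (fun h hh => (him k l hkl h hh.1).2)
        (fun h hh => (him k l hkl h hh.1).1) ?_ ?_ ?_ ?_
      · rw [hstart]
        exact hasAngle_arg hne
      · rw [hend]
        have := hasAngle_of_neg ((hε k l hkl.ne).2.2 (by linarith [fanLane_div_lt hkl])) 0
        simpa using this
      · have h1 := him k l hkl ε le_rfl
        rw [hstart] at h1
        have h2 := Complex.arg_nonneg_iff.2 h1.1
        have h3 := Complex.arg_le_pi (gap (fun i => fanAt (fanSlope i)) ε k k ε)
        constructor <;> push_cast <;> linarith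
      · constructor <;> push_cast <;> linarith
    · have hw : winding (fun _ => 0) (fun _ _ => 0) k l = 0 := by simp [winding, hkl]
      rw [hw]
      refine HasLift.of_re_nonneg (hc k l) 0 (fun h hh e => ?_)
        (fun h hh => (hre k l hkl h hh.1).le) ?_ ?_ ?_ ?_
      · have := hre k l hkl h hh.1
        rw [e] at this
        exact lt_irrefl _ this
      · rw [hstart]
        exact hasAngle_arg hne
      · have h1 := hre k l hkl 3 (by linarith [hε1.2])
        rw [hend] at h1 ⊢
        simpa using hasAngle_of_pos h1 0
      · have := abs_le.1 (Complex.abs_arg_le_pi_div_two_iff.2 (hre k k (lt_irrefl k) ε le_rfl).le)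
        constructor <;> push_cast <;> linarith [this.1, this.2]
      · constructor <;> push_cast <;> linarith

/-! ### Moving one of the strands of a tower -/

namespace IsMove

variable {w : ℝ → ℝ} {ℓ c : ℝ} {n : ℤ} (hw : IsMove w ℓ c n)
include hw

theorem zInt_pos : 0 < zInt w ℓ := by
  rw [← zInt_zero w]
  exact hw.strand.strictMono_zInt hw.length_pos

theorem pos_after {h : ℝ} (hh : zInt w ℓ ≤ h) : pos w h = ⟨h + c, 1⟩ := by
  have := pos_of_eq_one_of_le hw.strand hw.after (h := h - zInt w ℓ) (by linarith)
  rw [add_sub_cancel] at this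
  rw [this, ← hw.shift]
  apply Complex.ext <;> simp
  ring

theorem im_pos_cases (h : ℝ) : (pos w h).im < 1 ∨ pos w h = ⟨h, 1⟩ ∨ pos w h = ⟨h + c, 1⟩ := by
  rcases le_or_gt h 0 with h0 | h0
  · exact Or.inr (Or.inl (pos_of_nonpos hw.strand hw.before h0))
  · rcases le_or_gt (zInt w ℓ) h with h1 | h1
    · exact Or.inr (Or.inr (hw.pos_after h1))
    · refine Or.inl (hw.lt_one _ ⟨?_, ?_⟩)
      · rwa [hw.strand.lt_level_iff, zInt_zero]
      · rwa [hw.strand.level_lt_iff]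

theorem im_pos_le (h : ℝ) : (pos w h).im ≤ 1 := by
  rcases hw.im_pos_cases h with h1 | h1 | h1
  · exact h1.le
  · rw [h1]
  · rw [h1]

/-- Wherever it is not straight, the moving strand has y < 1 and misses a strand with y = 1. So only
the initial and the final lane have to be avoided. The offset η is 0 for disjointness and ±ε for the
gaps. -/
theorem add_pos_sub_ne_zero {a η h : ℝ} (h0 : a + η ≠ 0) (h1 : a + c + η ≠ 0) :
    ((a : ℝ) : ℂ) + (pos w h - ⟨h - η, 1⟩) ≠ 0 := by
  intro e
  have hre := congrArg Complex.re e
  have him := congrArg Complex.im e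
  simp at hre him
  rcases hw.im_pos_cases h with h2 | h2 | h2
  · linarith
  · rw [h2] at hre
    exact h0 (by linarith)
  · rw [h2] at hre
    exact h1 (by linarith)

end IsMove

/-- Only strand i dips; the others continue straight with y = 1. The displacement from another
strand to i stays in the lower half plane and makes as many half turns as `crossSign` says. The
opposite displacement stays in the upper half plane; there both the sign of the turn and the sides
are reversed, so the number of half turns is the same. The gap of strand i with itself is its chord
and turns with the move. -/
theorem IsTower.move {y : Fin 3 → ℝ → ℝ} {S : Fin 3 → ℝ} {H : ℝ} {q : Fin 3 → ℝ} {N : Fin 3 → ℤ}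
    {m : Fin 3 → Fin 3 → ℤ} (hy : IsTower y S H q N m) (i : Fin 3) {w : ℝ → ℝ} {ℓ c : ℝ} {n : ℤ}
    (hw : IsMove w ℓ c n) (hq : ∀ j, j ≠ i → q i + c ≠ q j) : ∃ y' S' H',
    IsTower y' S' H' (fun j => q j + if j = i then c else 0)
      (fun j => N j + if j = i then n else 0)
      (fun k l => m k l + (if k = i then crossSign (q i - q l) (q i + c - q l) else 0) +
        if l = i then crossSign (q i - q k) (q i + c - q k) else 0) := by
  set T := zInt w ℓ with hT
  have hT0 := hw.zInt_pos
  have hℓ := hw.length_pos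
  set W : Fin 3 → ℝ → ℝ := fun j => if j = i then w else fun _ => 1 with hWdef
  have hWi : W i = w := by simp [hWdef]
  have hWj : ∀ j, j ≠ i → W j = fun _ => 1 := fun j hj => by simp [hWdef, hj]
  have hW : ∀ j, IsStrand (W j) := fun j => by
    by_cases hj : j = i
    · rw [hj, hWi]; exact hw.strand
    · rw [hWj j hj]; exact isStrand_one
  have hW0 : ∀ j, ∀ s ≤ 0, W j s = 1 := fun j s hs => by
    by_cases hj : j = i
    · rw [hj, hWi]; exact hw.before s hs
    · rw [hWj j hj]
  have hinj : Function.Injective fun j => q j + if j = i then c else 0 := by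
    intro j k hjk
    simp only at hjk
    by_cases hj : j = i <;> by_cases hk : k = i
    · rw [hj, hk]
    · rw [if_pos hj, if_neg hk, hj, add_zero] at hjk
      exact absurd hjk (hq k hk)
    · rw [if_pos hk, if_neg hj, hk, add_zero] at hjk
      exact absurd hjk.symm (hq j hj)
    · rw [if_neg hj, if_neg hk, add_zero, add_zero] at hjk
      exact hy.injective hjk
  have hqi : ∀ j, j ≠ i → q i - q j ≠ 0 := fun j hj =>
    sub_ne_zero.2 fun e => hj (hy.injective e.symm)
  have hqi' : ∀ j, j ≠ i → q i + c - q j ≠ 0 := fun j hj => sub_ne_zero.2 (hq j hj)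
  -- The extra unit of height provides the straight last unit which `IsTower.straight` demands.
  refine ⟨_, _, _, hy.extend (W := W) (L := fun j => if j = i then ℓ + 1 else T + 1) (T := T + 1)
    (c := fun j => if j = i then c else 0) hW hW0 (fun j => ?_) (fun j s hs => ?_) (fun j => ?_)
    (fun j => ?_) hinj (fun j k hjk h hh => ?_) (fun j => ?_) ?_⟩
  · split_ifs <;> linarith
  · by_cases hj : j = i
    · rw [if_pos hj] at hs
      rw [hj, hWi]
      exact hw.after s (by linarith)
    · rw [hWj j hj]
  · by_cases hj : j = i
    · rw [if_pos hj, hj, hWi, zInt_of_eq_one_of_le hw.strand.continuous hw.after (by linarith)]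
      ring
    · rw [if_neg hj, hWj j hj]
      simp [zInt]
  · by_cases hj : j = i
    · rw [if_pos hj, if_pos hj, hj, hWi,
        xInt_of_eq_one_of_le hw.strand.continuous hw.after (by linarith), ← hw.shift]
      ring
    · rw [if_neg hj, if_neg hj, hWj j hj]
      simp [xInt]
  · by_cases hj : j = i
    · have hk : k ≠ i := fun e => hjk (hj.trans e.symm)
      rw [hj, hWi, hWj k hk, pos_one]
      have := hw.add_pos_sub_ne_zero (a := q i - q k) (η := 0) (h := h)
        (by simpa using hqi k hk) (by
          have := hqi' k hk
          rwa [add_zero, show q i - q k + c = q i + c - q k by ring])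
      rwa [sub_zero] at this
    · by_cases hk : k = i
      · rw [hk, hWi, hWj j hj, pos_one]
        have := hw.add_pos_sub_ne_zero (a := q i - q j) (η := 0) (h := h)
          (by simpa using hqi j hj) (by
            have := hqi' j hj
            rwa [add_zero, show q i - q j + c = q i + c - q j by ring])
        rw [sub_zero] at this
        refine fun e => this ?_
        push_cast at e ⊢
        linear_combination -e
      · rw [hWj j hj, hWj k hk, sub_self, add_zero]
        exact_mod_cast sub_ne_zero.2 fun e => hjk (hy.injective e)
  · by_cases hj : j = i
    · rw [if_pos hj, if_pos hj, hj, hWi]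
      have h1 := hw.turn.add_int_mul_two_pi (-N i)
      have h2 : HasLift (fun _ => (⟨1, 0⟩ : ℂ)) 0 1 (2 * Real.pi * (-(N i + n) : ℤ))
          (2 * Real.pi * (-(N i + n) : ℤ)) := HasLift.of_const (hasAngle_of_pos one_pos _)
      rw [zero_add, ← mul_add, ← Int.cast_add, show -n + -N i = -(N i + n) by ring] at h1
      refine h1.append h2 hℓ.le zero_le_one (fun _ _ => rfl) fun s hs => ?_
      -- At s = 0 the strand is known to be straight only to the right, so the derivative is
      -- computed one-sidedly.
      have h3 := (hw.strand.differentiable (ℓ + s)).hasDerivAt.hasDerivWithinAt (s := Ici (ℓ + s))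
      have h4 : HasDerivWithinAt w 0 (Ici (ℓ + s)) (ℓ + s) :=
        (hasDerivWithinAt_const (ℓ + s) (Ici (ℓ + s)) (1 : ℝ)).congr
          (fun t ht => hw.after t (by linarith [mem_Ici.1 ht, hs.1]))
          (hw.after _ (by linarith [hs.1]))
      rw [tangent, hw.after _ (by linarith [hs.1]), (uniqueDiffWithinAt_Ici _).eq_deriv _ h3 h4]
    · rw [if_neg hj, if_neg hj, hWj j hj, add_zero]
      have h2 : tangent (fun _ => (1 : ℝ)) = fun _ => ⟨1, 0⟩ := by
        ext s
        simp [tangent]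
      rw [h2]
      exact HasLift.of_const (hasAngle_of_pos one_pos _)
  · obtain ⟨ε₀, hε₀, hchord⟩ := hw.chord
    have hev : ∀ᶠ ε in 𝓝[>] (0 : ℝ), ∀ j, j ≠ i →
        ((0 < q i - q j + ε ↔ 0 < q i - q j) ∧ (q i - q j + ε < 0 ↔ q i - q j < 0) ∧
          q i - q j + ε ≠ 0) ∧
        ((0 < q i + c - q j + ε ↔ 0 < q i + c - q j) ∧
          (q i + c - q j + ε < 0 ↔ q i + c - q j < 0) ∧ q i + c - q j + ε ≠ 0) ∧
        ((0 < -(q i - q j) + ε ↔ 0 < -(q i - q j)) ∧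
          (-(q i - q j) + ε < 0 ↔ -(q i - q j) < 0) ∧ -(q i - q j) + ε ≠ 0) ∧
        ((0 < -(q i + c - q j) + ε ↔ 0 < -(q i + c - q j)) ∧
          (-(q i + c - q j) + ε < 0 ↔ -(q i + c - q j) < 0) ∧ -(q i + c - q j) + ε ≠ 0) := by
      refine eventually_all.2 fun j => ?_
      by_cases hj : j = i
      · exact Eventually.of_forall fun _ h => absurd hj h
      · filter_upwards [eventually_pos_iff (hqi j hj), eventually_pos_iff (hqi' j hj),
          eventually_pos_iff (neg_ne_zero.2 (hqi j hj)),
          eventually_pos_iff (neg_ne_zero.2 (hqi' j hj))] with ε h1 h2 h3 h4 _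
          using ⟨h1, h2, h3, h4⟩
    filter_upwards [hev, Ioo_mem_nhdsGT (lt_min hε₀ one_pos), hy.hasAngle_winding]
      with ε hε hε1 hang k l
    rw [mem_Ioo, lt_min_iff] at hε1
    obtain ⟨hε0, hεε, hε1⟩ := hε1
    have hcont : ContinuousOn (fun h => ((q k - q l : ℝ) : ℂ) + gap W ε k l h) (Icc 0 (T + 1)) :=
      (continuous_const.add (IsTheta.continuous_gap hW ε k l)).continuousOn
    by_cases hk : k = i
    · by_cases hl : l = i
      · obtain rfl : k = l := hk.trans hl.symm
        subst hk
        have h1 := (hchord ε ⟨hε0, hεε⟩).add_int_mul_two_pi (-N k)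
        have h2 : winding N m k k = 2 * -N k := by simp [winding]
        rw [h2]
        convert h1 using 1
        · ext h
          simp [gap, hWi]
        · push_cast
          ring
        · simp [winding]
          ring
      · have h2 := hε l hl
        have hw1 : winding (fun j => N j + if j = i then n else 0)
            (fun k l => m k l + (if k = i then crossSign (q i - q l) (q i + c - q l) else 0) +
              if l = i then crossSign (q i - q k) (q i + c - q k) else 0) k l =
            winding N m k l + crossSign (q i - q l) (q i + c - q l) := by
          have : k ≠ l := fun e => hl (e ▸ hk)
          simp [winding, hk, hl, hk ▸ this]
          ring
        rw [hw1]
        have hg : ∀ h, ((q k - q l : ℝ) : ℂ) + gap W ε k l h =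
            ((q i - q l : ℝ) : ℂ) + (pos w h - ⟨h - ε, 1⟩) := fun h => by
          rw [gap, hk, hWi, hWj l hl, pos_one]
        simp only [hg] at hcont ⊢
        have hang' := hang k l
        rw [show q k - q l = q i - q l by rw [hk]] at hang'
        rw [crossSign_congr h2.1.1.symm h2.2.1.1.symm h2.1.2.1.symm h2.2.1.2.1.symm]
        refine HasLift.of_lower hcont (fun h _ => hw.add_pos_sub_ne_zero h2.1.2.2 ?_)
          (fun h _ => ?_) ?_ ?_ h2.2.1.2.2 hang'
        · rw [show q i - q l + c + ε = q i + c - q l + ε by ring]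
          exact h2.2.1.2.2
        · simpa using hw.im_pos_le h
        · rw [pos_of_nonpos hw.strand hw.before le_rfl]
          apply Complex.ext <;> simp
        · rw [hw.pos_after (by linarith)]
          apply Complex.ext <;> simp
          ring
    · by_cases hl : l = i
      · have h2 := hε k hk
        have hw1 : winding (fun j => N j + if j = i then n else 0)
            (fun k l => m k l + (if k = i then crossSign (q i - q l) (q i + c - q l) else 0) +
              if l = i then crossSign (q i - q k) (q i + c - q k) else 0) k l =
            winding N m k l - crossSign (-(q i - q k)) (-(q i + c - q k)) := by
          have : k ≠ l := fun e => hk (e.trans hl)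
          rw [crossSign_neg]
          simp [winding, hk, hl]
          ring
        rw [hw1]
        have hg : ∀ h, ((q k - q l : ℝ) : ℂ) + gap W ε k l h =
            -(((q i - q k : ℝ) : ℂ) + (pos w (h - ε) - ⟨h - ε - -ε, 1⟩)) := fun h => by
          rw [gap, hl, hWi, hWj k hk, pos_one, sub_neg_eq_add, sub_add_cancel]
          push_cast
          ring
        simp only [hg] at hcont ⊢
        have hang' := hang k l
        rw [show q k - q l = -(q i - q k) by rw [hl]; ring] at hang'
        rw [crossSign_congr h2.2.2.1.1.symm h2.2.2.2.1.symm h2.2.2.1.2.1.symm h2.2.2.2.2.1.symm]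
        refine HasLift.of_upper hcont
          (fun h _ => neg_ne_zero.2 (hw.add_pos_sub_ne_zero (fun e => h2.2.2.1.2.2 ?_)
            fun e => h2.2.2.2.2.2 ?_)) (fun h _ => ?_) ?_ ?_ h2.2.2.2.2.2 hang'
        · linarith
        · linarith
        · simpa using hw.im_pos_le (h - ε)
        · rw [pos_of_nonpos hw.strand hw.before (by linarith)]
          apply Complex.ext <;> simp
          ring
        · rw [hw.pos_after (by linarith)]
          apply Complex.ext <;> simp
          ring
      · have hw1 : winding (fun j => N j + if j = i then n else 0)
            (fun k l => m k l + (if k = i then crossSign (q i - q l) (q i + c - q l) else 0) +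
              if l = i then crossSign (q i - q k) (q i + c - q k) else 0) k l =
            winding N m k l := by
          simp [winding, hk, hl]
        rw [hw1]
        have hg : ∀ h, ((q k - q l : ℝ) : ℂ) + gap W ε k l h = ⟨q k - q l + ε, 0⟩ := fun h => by
          rw [gap, hWj k hk, hWj l hl, pos_one, pos_one]
          apply Complex.ext <;> simp
        simp only [hg]
        exact HasLift.of_const (hang k l)

/-! ### Closing a tower up to a θ-graph -/

theorem arg_mk_eq_arctan {r : ℝ} (hr : 0 < r) (t : ℝ) :
    (⟨r, t⟩ : ℂ).arg = Real.arctan (t / r) := by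
  have hc := Real.cos_arctan_pos (t / r)
  have h1 := Real.neg_pi_div_two_lt_arctan (t / r)
  have h2 := Real.arctan_lt_pi_div_two (t / r)
  have h3 := Real.tan_mul_cos hc.ne'
  rw [Real.tan_arctan] at h3
  refine HasAngle.arg_eq (hasAngle_iff.2 ⟨r / Real.cos (Real.arctan (t / r)), div_pos hr hc, ?_, ?_⟩)
    (by linarith [Real.pi_pos]) (by linarith [Real.pi_pos])
  · rw [div_mul_cancel₀ _ hc.ne']
  · rw [← h3]
    field_simp

theorem arg_mk_lt_arg_mk {r t t' : ℝ} (hr : 0 < r) (h : t < t') :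
    (⟨r, t⟩ : ℂ).arg < (⟨r, t'⟩ : ℂ).arg := by
  rw [arg_mk_eq_arctan hr, arg_mk_eq_arctan hr]
  exact Real.arctan_strictMono (div_lt_div_of_pos_right h hr)

theorem arg_mk_mem {r : ℝ} (hr : 0 < r) (t : ℝ) :
    (⟨r, t⟩ : ℂ).arg ∈ Ioo (-(Real.pi / 2)) (Real.pi / 2) := by
  rw [arg_mk_eq_arctan hr]
  exact Real.arctan_mem_Ioo _

/-- Near a the strands form the initial fan. At equal heights a steeper strand lies further to the
left, and along each strand x increases with the height. At equal x the steeper one is therefore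
higher, and the slopes decrease with the index. -/
theorem IsTheta.isStandardNearVertices {y : Fin 3 → ℝ → ℝ} {E : Fin 3 → ℝ} {H : ℝ}
    (hT : IsTheta y E H) (hfan : ∀ i, ∀ s ≤ 1, y i s = fanAt (fanSlope i) s) :
    hT.graph.IsStandardNearVertices where
  right_of_a i := by
    have : deriv (hT.graph.edge i) 0 = _ := (hT.hasDerivAt_edge i 0).deriv
    rw [this]
    simpa using mul_pos (hT.length_pos i) (hT.start_pos i)
  left_of_b i := by
    have : deriv (hT.graph.edge i) 1 = _ := (hT.hasDerivAt_edge i 1).deriv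
    rw [this]
    simpa using mul_pos (hT.length_pos i) (hT.finish_pos i)
  order_at_a := by
    have hsum : 0 < ∑ k, E k := Finset.sum_pos (fun k _ => hT.length_pos k) Finset.univ_nonempty
    have hle : ∀ k, E k ≤ ∑ k, E k := fun k =>
      Finset.single_le_sum (f := E) (fun k _ => (hT.length_pos k).le) (Finset.mem_univ k)
    have hpar : ∀ k, ∀ s ∈ Ioo 0 (∑ k, E k)⁻¹, E k * s ∈ Ioc 0 1 := fun k s hs => by
      refine ⟨mul_pos (hT.length_pos k) hs.1, ?_⟩
      have h1 := mul_le_mul_of_nonneg_right (hle k) hs.1.le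
      have h2 := mul_lt_mul_of_pos_left hs.2 hsum
      rw [mul_inv_cancel₀ hsum.ne'] at h2
      linarith
    have hx : ∀ k, ∀ s ∈ Ioc (0 : ℝ) 1, xInt (y k) s = xInt (fanAt (fanSlope k)) s ∧
        zInt (y k) s = zInt (fanAt (fanSlope k)) s := fun k s hs => by
      have h1 : ∀ u ∈ uIcc 0 s, y k u = fanAt (fanSlope k) u := fun u hu => by
        rw [uIcc_of_le hs.1.le] at hu
        exact hfan k u (hu.2.trans hs.2)
      exact ⟨intervalIntegral.integral_congr h1,
        intervalIntegral.integral_congr fun u hu => by simp only [h1 u hu]⟩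
    -- For these parameters each E k s is at most 1, within the part where the edge agrees with its
    -- fan.
    refine ⟨(∑ k, E k)⁻¹, inv_pos.2 hsum, fun i j hij s hs t ht hst => ?_⟩
    have hsi := hpar i s hs
    have htj := hpar j t ht
    simp only [hT.graph_edge, spacePoint, Matrix.cons_val_zero, Matrix.cons_val] at hst ⊢
    rw [(hx i _ hsi).1, (hx j _ htj).1] at hst
    rw [(hx i _ hsi).2, (hx j _ htj).2]
    have hpi := (isStrand_fanAt (fanSlope i)).pos_zInt (E i * s)
    have hpj := (isStrand_fanAt (fanSlope j)).pos_zInt (E j * t)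
    have hj0 : 0 < zInt (fanAt (fanSlope j)) (E j * t) := by
      rw [← zInt_zero (fanAt (fanSlope j))]
      exact (isStrand_fanAt _).strictMono_zInt htj.1
    by_contra hlt
    have h1 := (strictMono_re_pos_fanAt (fanSlope i)).monotone (not_lt.1 hlt)
    have h2 := re_pos_fanAt_lt (fanSlope_pos j) (fanSlope_lt hij) hj0
    simp only [hpi, hpj] at h1 h2
    linarith

/-- Reversed fans of suitable slopes join the lanes at b. During the closing, each gap with q k < q
l makes up for an odd number of half turns, so that all the gaps into the same strand l end at a
common angle modulo full turns. Of the two gaps between i and j exactly one gains the half turn of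
the first fan and exactly one that of the last; this is the -1 in the Thurston–Bennequin number. -/
theorem IsTower.exists_graph {y : Fin 3 → ℝ → ℝ} {S : Fin 3 → ℝ} {H : ℝ} {q : Fin 3 → ℝ}
    {N : Fin 3 → ℤ} {m : Fin 3 → Fin 3 → ℤ} (hy : IsTower y S H q N m)
    (hm : ∀ k l, m k l = m l k) :
    ∃ G : LegendrianThetaGraph, G.IsStandardNearVertices ∧ ∀ i j, i < j →
      IsUnknot (G.cycleSet i j) ∧ G.HasTB i j (-1 - N i - N j - m i j) ∧
        G.HasRot i j (N j - N i - if q j < q i then 1 else 0) := by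
  have hpi := Real.pi_pos
  obtain ⟨qb, hqb⟩ : ∃ qb, ∀ i, q i < qb := by
    obtain ⟨M, hM⟩ := (finite_range q).bddAbove
    exact ⟨M + 1, fun i => by linarith [hM (mem_range_self i)]⟩
  -- With this slope the reversed fan shifts the lane of strand i by `fanLane / a i` = qb - q i, so
  -- all strands arrive at the same point. Strands further to the right are steeper.
  set a : Fin 3 → ℝ := fun i => fanLane / (qb - q i) with ha
  have ha0 : ∀ i, 0 < a i := fun i => div_pos fanLane_pos (by linarith [hqb i])
  have hlane : ∀ i, fanLane / a i = qb - q i := fun i => by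
    rw [ha, div_div_cancel₀ fanLane_pos.ne']
  have halt : ∀ {i j}, q i < q j → a i < a j := fun {i j} h =>
    div_lt_div_of_pos_left fanLane_pos (by linarith [hqb j]) (by linarith)
  have hainj : ∀ i j, i ≠ j → a i ≠ a j := fun i j hij => by
    rcases lt_or_gt_of_ne (fun e => hij (hy.injective e)) with h | h
    · exact (halt h).ne
    · exact (halt h).ne'
  -- The height T is at least 1 / a i for all i, which suffices for each fan to become straight.
  set T : ℝ := ∑ i, 1 / a i with hT
  have hle : ∀ i, 1 / a i ≤ T := fun i =>
    Finset.single_le_sum (f := fun i => 1 / a i) (fun k _ => (one_div_pos.2 (ha0 k)).le)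
      (Finset.mem_univ i)
  have hT0 : 0 < T := (one_div_pos.2 (ha0 0)).trans_le (hle 0)
  have hst := fun i => isStrand_fanAt (a i)
  set E : Fin 3 → ℝ := fun i => level (fanAt (a i)) T with hE
  have hzE : ∀ i, zInt (fanAt (a i)) (E i) = T := fun i => (hst i).zInt_level T
  have hEge : ∀ i, 1 / a i ≤ E i := fun i => by
    rw [hE, (hst i).le_level_iff, zInt_fanAt (ha0 i), mul_one_div_cancel (ha0 i).ne']
    exact (div_le_div_of_nonneg_right zInt_fan_one_le (ha0 i).le).trans (hle i)
  have hE0 : ∀ i, 0 < E i := fun i => (one_div_pos.2 (ha0 i)).trans_le (hEge i)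
  have hxE : ∀ i, xInt (fanAt (a i)) (E i) = qb - q i + T := fun i => by
    have h1 : 1 ≤ a i * T := by rw [← div_le_iff₀' (ha0 i)]; exact hle i
    have := congrArg Complex.re (pos_fanAt_of_ge (ha0 i) (h := T) (zInt_fan_one_le.trans h1))
    rw [hlane] at this
    exact this
  set W : Fin 3 → ℝ → ℝ := fun i => fanBack (a i) (E i) with hWdef
  have hW : ∀ i, IsStrand (W i) := fun i => isStrand_fanBack _ _
  have hW0 : ∀ i, ∀ s ≤ 0, W i s = 1 := fun i s hs => fanBack_of_nonpos (ha0 i) (hEge i) hs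
  have hzW : ∀ i, zInt (W i) (E i) = T := fun i => by
    rw [hWdef, zInt_fanBack, hzE, sub_self, zInt_zero, sub_zero]
  have hxW : ∀ i, xInt (W i) (E i) = qb - q i + T := fun i => by
    have : xInt (W i) (E i) = _ := xInt_comp_const_sub (hst i).continuous (E i) (E i)
    rw [this, hxE, sub_self, xInt_zero, sub_zero]
  have hpW : ∀ i k, pos (W i) (T - k) =
      ⟨qb - q i + T - (pos (fanAt (a i)) k).re, (pos (fanAt (a i)) k).im⟩ := fun i k => by
    have := pos_fanBack (a i) (E i) k
    rwa [hzE, hxE] at this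
  have hS := hy.one_lt_length
  have hySi : ∀ i s, S i ≤ s → y i s = 1 := fun i s hs => hy.straight i s (by linarith)
  have hval : ∀ i, prolong (y i) (S i) (W i) (S i + E i) = 3 / 4 := fun i => by
    rw [prolong_of_ge (hySi i) (by linarith [hE0 i]), add_sub_cancel_left]
    exact fanBack_end _ _
  have hder : ∀ i, deriv (prolong (y i) (S i) (W i)) (S i + E i) = -(a i / 4) := fun i => by
    rw [deriv_prolong_of_gt (hySi i) (by linarith [hE0 i]), add_sub_cancel_left]
    exact deriv_fanBack_end _ _
  have hfan : ∀ i, ∀ s ≤ 1, prolong (y i) (S i) (W i) s = fanAt (fanSlope i) s := fun i s hs => by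
    rw [prolong_of_le (hW0 i) (by linarith [hS i])]
    exact hy.start i s hs
  have htan : ∀ i, tangent (prolong (y i) (S i) (W i)) 0 = ⟨3 / 4, fanSlope i / 4⟩ := fun i => by
    rw [hy.tangent_prolong_zero hW0, hy.tangent_zero]
  have hslope : ∀ i j : Fin 3, i ≠ j → fanSlope i ≠ fanSlope j := fun i j hij => by
    rcases lt_or_gt_of_ne hij with h | h
    · exact (fanSlope_lt h).ne'
    · exact (fanSlope_lt h).ne
  have hΘ : IsTheta (fun i => prolong (y i) (S i) (W i)) (fun i => S i + E i) (H + T) :=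
    { strand := fun i => isStrand_prolong (hy.strand i) (hySi i) (hW i) (hW0 i)
      length_pos := fun i => by linarith [hS i, hE0 i]
      height := hy.zInt_prolong hW hW0 (fun i => (hE0 i).le) hzW
      start := fun i j => by
        rw [hfan i 0 zero_le_one, hfan j 0 zero_le_one, fanAt_zero, fanAt_zero]
      finish_x := fun i j => by
        rw [hy.xInt_prolong hW hW0 (fun i => (hE0 i).le) i,
          hy.xInt_prolong hW hW0 (fun i => (hE0 i).le) j, hxW, hxW]
        ring
      finish_y := fun i j => by rw [hval, hval]
      start_pos := fun i => by
        rw [hfan i 0 zero_le_one]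
        exact fanAt_pos _ _
      finish_pos := fun i => by
        rw [hval]
        norm_num
      start_slope := fun i j hij e => by
        have h1 := congrArg Complex.im (htan i)
        have h2 := congrArg Complex.im (htan j)
        simp only [tangent] at h1 h2
        exact hslope i j hij (by linarith)
      finish_slope := fun i j hij e => by
        rw [hder, hder] at e
        exact hainj i j hij (by linarith)
      disjoint := fun i j hij h hh => by
        refine hy.disjoint_prolong hW hW0 (T := h - H) (fun i j hij r hr => ?_) i j hij h
          ⟨hh.1, by linarith⟩
        wlog hlt : q i < q j generalizing i j
        · have := this j i hij.symm (lt_of_le_of_ne (not_lt.1 hlt)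
            fun e => hij (hy.injective e.symm))
          refine fun e => this ?_
          push_cast at e ⊢
          linear_combination -e
        intro e
        have hr' : r = T - (T - r) := by ring
        rw [hr', hpW, hpW] at e
        have := congrArg Complex.re e
        simp at this
        have := re_pos_fanAt_lt (ha0 i) (halt hlt) (h := T - r) (by linarith [hr.2, hh.2])
        linarith }
  have hgap : ∀ ε k l h, ((q k - q l : ℝ) : ℂ) + gap W ε k l h =
      ⟨(pos (fanAt (a l)) (T - h + ε)).re - (pos (fanAt (a k)) (T - h)).re,
        (pos (fanAt (a k)) (T - h)).im - (pos (fanAt (a l)) (T - h + ε)).im⟩ := fun ε k l h => by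
    have h1 := hpW k (T - h)
    have h2 := hpW l (T - h + ε)
    rw [sub_sub_cancel] at h1
    rw [show T - (T - h + ε) = h - ε by ring] at h2
    rw [gap, h1, h2]
    apply Complex.ext <;> simp
    ring
  refine ⟨hΘ.graph, hΘ.isStandardNearVertices hfan, fun i j hij =>
    ⟨hΘ.isUnknot hij.ne, ?_, ?_⟩⟩
  · have hev : ∀ᶠ ε in 𝓝[>] (0 : ℝ), ∀ k l : Fin 3, k ≠ l →
        q k - q l + ε ≠ 0 ∧ (0 < q k - q l + ε ↔ 0 < q k - q l) := by
      refine eventually_all.2 fun k => eventually_all.2 fun l => ?_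
      by_cases hkl : k = l
      · exact Eventually.of_forall fun _ h => absurd hkl h
      · filter_upwards [eventually_pos_iff (sub_ne_zero.2 fun e => hkl (hy.injective e))]
          with ε hε _ using ⟨hε.2.2, hε.1⟩
    -- The parity of the winding says on which side of l the strand k is; the half turn added for q
    -- k < q l makes it even.
    have hparity : ∀ k l, ∃ n : ℤ, winding N m k l + (if q k < q l then 1 else 0) = 2 * n := by
      intro k l
      obtain ⟨ε, ⟨hε1, hε2⟩, hε3⟩ := ((hev.and hy.hasAngle_winding).and self_mem_nhdsWithin).exists
      have h1 := (hε2 k l).even_iff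
      have h2 : 0 < q k - q l + ε ↔ ¬ q k < q l := by
        by_cases hkl : k = l
        · rw [hkl]
          simpa using hε3
        · rw [(hε1 k l hkl).2, sub_pos, not_lt]
          exact ⟨fun h => h.le, fun h => lt_of_le_of_ne h fun e => hkl (hy.injective e.symm)⟩
      rw [h2] at h1
      by_cases h : q k < q l
      · rw [if_pos h]
        obtain ⟨n, hn⟩ := Int.not_even_iff_odd.1 fun he => h1.1 he h
        exact ⟨n + 1, by rw [hn]; ring⟩
      · rw [if_neg h]
        obtain ⟨n, hn⟩ := h1.2 h
        exact ⟨n, by rw [hn]; ring⟩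
    choose n hn using hparity
    have hwind : ∀ᶠ ε in 𝓝[>] (0 : ℝ), ∃ A B : Fin 3 → ℝ, ∀ k l,
        HasLift (gap (fun i => prolong (y i) (S i) (W i)) ε k l) ε (H + T) (A k)
          (B l + 2 * Real.pi * n k l) := by
      filter_upwards [hev, hy.hasAngle_winding, hy.chord,
        Ioo_mem_nhdsGT (lt_min hy.height_pos one_pos)] with ε hε hang ⟨A, hA⟩ hε1
      rw [mem_Ioo, lt_min_iff] at hε1
      obtain ⟨hε0, hεH, hε1⟩ := hε1
      -- The gap ends as the vector to b from the point of strand l that lies ε below b. It points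
      -- to the right and downwards, so its principal argument lies in (-π/2, 0) and depends on l
      -- only.
      refine ⟨A, fun l => (⟨(pos (fanAt (a l)) ε).re, 3 / 4 - (pos (fanAt (a l)) ε).im⟩ : ℂ).arg,
        fun k l => hy.hasLift_gap_prolong hW hW0 ⟨hε0, hε1.le⟩ hεH.le hT0.le (hA k l) ?_⟩
      have hX : 0 < (pos (fanAt (a l)) ε).re := by
        have := strictMono_re_pos_fanAt (a l) hε0
        simpa [pos_fanAt_zero] using this
      have hY : 3 / 4 - (pos (fanAt (a l)) ε).im < 0 := by
        rcases im_pos_fanAt_lt (ha0 l) (ha0 l) (mul_lt_mul_of_pos_left hε0 (ha0 l)) with h | h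
        · rw [pos_fanAt_zero] at h
          linarith
        · rw [pos_fanAt_zero] at h
          have := congrArg Complex.im h.1
          norm_num at this
      have hB1 := arg_mk_mem hX (3 / 4 - (pos (fanAt (a l)) ε).im)
      have hB2 := Complex.arg_neg_iff.2
        (show (⟨(pos (fanAt (a l)) ε).re, 3 / 4 - (pos (fanAt (a l)) ε).im⟩ : ℂ).im < 0 from hY)
      have hcont : ContinuousOn (fun h => ((q k - q l : ℝ) : ℂ) + gap W ε k l h) (Icc 0 T) :=
        (continuous_const.add (IsTheta.continuous_gap hW ε k l)).continuousOn
      have hstart : HasAngle (((q k - q l : ℝ) : ℂ) + gap W ε k l 0)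
          (Real.pi * winding N m k l) := by
        convert hang k l using 1
        rw [gap, pos_of_nonpos (hW k) (hW0 k) le_rfl,
          pos_of_nonpos (hW l) (hW0 l) (by linarith)]
        apply Complex.ext <;> simp
      have hend : HasAngle (((q k - q l : ℝ) : ℂ) + gap W ε k l T)
          ((⟨(pos (fanAt (a l)) ε).re, 3 / 4 - (pos (fanAt (a l)) ε).im⟩ : ℂ).arg +
            2 * Real.pi * n k l) := by
        rw [hgap, sub_self, zero_add, pos_fanAt_zero, sub_zero]
        have hne : (⟨(pos (fanAt (a l)) ε).re, 3 / 4 - (pos (fanAt (a l)) ε).im⟩ : ℂ) ≠ 0 :=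
          fun e => hX.ne' (congrArg Complex.re e)
        exact (hasAngle_arg hne).add_int_mul_two_pi _
      have hnkl := hn k l
      -- If k is to the left of l, the gap starts on the negative axis, and since the pushed-up
      -- steeper strand l has the larger y it stays in the lower half plane. Otherwise it starts on
      -- the positive axis and stays in the right half plane.
      by_cases hlt : q k < q l
      · rw [if_pos hlt] at hnkl
        have hnkl' : Real.pi * winding N m k l = 2 * Real.pi * n k l - Real.pi := by
          have : ((winding N m k l : ℤ) : ℝ) + 1 = 2 * n k l := by exact_mod_cast hnkl
          linear_combination Real.pi * this
        rw [hnkl'] at hstart ⊢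
        have hmul : ∀ h ∈ Icc 0 T, a k * (T - h) < a l * (T - h + ε) := fun h hh => by
          have h1 := mul_le_mul_of_nonneg_right (halt hlt).le (show 0 ≤ T - h by linarith [hh.2])
          have h2 := mul_pos (ha0 l) hε0
          linarith
        refine HasLift.of_im_nonpos hcont (n k l) (fun h hh => ?_) (fun h hh => ?_) hstart hend
          ⟨le_rfl, by linarith⟩ ⟨by linarith [hB1.1], by linarith⟩
        · rw [hgap]
          intro e
          have hre := congrArg Complex.re e
          have him := congrArg Complex.im e
          simp only [Complex.zero_re, Complex.zero_im] at hre him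
          rcases im_pos_fanAt_lt (ha0 k) (ha0 l) (hmul h hh) with h1 | ⟨h1, h2⟩
          · linarith
          · rw [h1, h2, hlane, hlane] at hre
            simp only at hre
            exact (hε k l fun e => by rw [e] at hlt; exact lt_irrefl _ hlt).1 (by linarith)
        · rw [hgap]
          rcases im_pos_fanAt_lt (ha0 k) (ha0 l) (hmul h hh) with h1 | ⟨h1, h2⟩
          · simp only
            linarith
          · rw [h1, h2]
            simp
      · rw [if_neg hlt] at hnkl
        have hnkl' : Real.pi * winding N m k l = 2 * Real.pi * n k l := by
          have : ((winding N m k l : ℤ) : ℝ) + 0 = 2 * n k l := by exact_mod_cast hnkl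
          linear_combination Real.pi * this
        rw [hnkl'] at hstart ⊢
        have hre : ∀ h ∈ Icc 0 T, 0 < (((q k - q l : ℝ) : ℂ) + gap W ε k l h).re := by
          intro h hh
          rw [hgap]
          have h1 := strictMono_re_pos_fanAt (a l) (show T - h < T - h + ε by linarith)
          have h2 : (pos (fanAt (a k)) (T - h)).re ≤ (pos (fanAt (a l)) (T - h)).re := by
            rcases (not_lt.1 hlt).eq_or_lt with e | hlt'
            · rw [hy.injective e]
            · rcases hh.2.eq_or_lt with rfl | hh'
              · rw [sub_self, pos_fanAt_zero, pos_fanAt_zero]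
              · exact (re_pos_fanAt_lt (ha0 l) (halt hlt') (by linarith)).le
          simp only at h1 ⊢
          linarith
        refine HasLift.of_re_nonneg hcont (n k l) (fun h hh e => ?_) (fun h hh => (hre h hh).le)
          hstart hend ⟨by linarith, by linarith⟩ ⟨by linarith [hB1.1], by linarith [hB1.2]⟩
        have := hre h hh
        rw [e] at this
        exact lt_irrefl _ this
    obtain ⟨ε₀, hε₀, hsub⟩ := mem_nhdsGT_iff_exists_Ioo_subset.1 hwind
    convert hΘ.hasTB i j hε₀ n fun ε hε => hsub hε using 1
    have h1 := hn i i
    have h2 := hn j j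
    have h3 := hn i j
    have h4 := hn j i
    have h5 := hm i j
    have h6 : (if q i < q j then (1 : ℤ) else 0) + (if q j < q i then 1 else 0) = 1 := by
      rcases lt_or_gt_of_ne (fun e => hij.ne (hy.injective e)) with h | h
      · simp [h, h.le]
      · simp [h, h.le]
    simp only [winding, lt_irrefl, hij, hij.ne, hij.ne', if_true, if_false, hij.le, not_lt.2] at *
    omega
  · have hlift : ∀ k, HasLift (tangent (prolong (y k) (S k) (W k))) 0 (S k + E k)
        (tangent (y k) 0).arg
        ((⟨3 / 4, -(a k / 4)⟩ : ℂ).arg + 2 * Real.pi * (-N k : ℤ)) := fun k => by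
      refine hy.turn_prolong hW hW0 k (hE0 k).le ?_
      have hmem := arg_mk_mem (show (0 : ℝ) < 3 / 4 by norm_num) (-(a k / 4))
      refine HasLift.of_re_nonneg (hW k).continuous_tangent.continuousOn (-N k)
        (fun s _ => (hW k).tangent_ne_zero s) (fun s _ => (fanAt_pos _ _).le) ?_ ?_
        ⟨by linarith, by linarith⟩ ⟨by linarith [hmem.1], by linarith [hmem.2]⟩
      · rw [tangent, deriv_zero_of_eq_one (hW k) (hW0 k), hW0 k 0 le_rfl]
        exact hasAngle_of_pos one_pos _
      · have : tangent (W k) (E k) = ⟨3 / 4, -(a k / 4)⟩ := by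
          rw [tangent]
          exact congrArg₂ Complex.mk (fanBack_end _ _) (deriv_fanBack_end _ _)
        rw [this]
        refine (hasAngle_arg fun e => ?_).add_int_mul_two_pi _
        have := congrArg Complex.re e
        norm_num at this
    have hthree : (0 : ℝ) < 3 / 4 := by norm_num
    -- At a the exterior angle is negative, because i < j leaves a more steeply. At b its sign
    -- depends on which strand arrives more steeply, that is, on the order of the lanes; the
    -- correction by 1 brings it into (-π, π).
    refine hΘ.hasRot i j hlift _ (N j - N i - if q j < q i then 1 else 0) ?_ ?_
    · have h1 := arg_mk_mem hthree (-(a i / 4))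
      have h2 := arg_mk_mem hthree (-(a j / 4))
      rcases lt_or_gt_of_ne (fun e => hij.ne (hy.injective e)) with h | h
      · rw [if_neg (not_lt.2 h.le)]
        have h3 := arg_mk_lt_arg_mk hthree (show -(a j / 4) < -(a i / 4) by linarith [halt h])
        push_cast
        rw [abs_lt]
        constructor <;> linarith [h1.1, h1.2, h2.1, h2.2]
      · rw [if_pos h]
        have h3 := arg_mk_lt_arg_mk hthree (show -(a i / 4) < -(a j / 4) by linarith [halt h])
        push_cast
        rw [abs_lt]
        constructor <;> linarith [h1.1, h1.2, h2.1, h2.2]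
    · rw [hy.tangent_zero, hy.tangent_zero]
      have h1 := arg_mk_mem hthree (fanSlope i / 4)
      have h2 := arg_mk_mem hthree (fanSlope j / 4)
      have h3 := arg_mk_lt_arg_mk hthree (show fanSlope j / 4 < fanSlope i / 4 by
        linarith [fanSlope_lt hij])
      rw [abs_lt]
      constructor <;> linarith [h1.1, h1.2, h2.1, h2.2]

/-! ### Realizing the invariants -/

/-- There is a tower whose lanes are, from left to right, `q a`, `q b` and `q c`. The θ-graph into
which it can be closed up has cycles with Thurston–Bennequin numbers `-1 - t i j` and rotation
numbers `R i j`. -/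
def IsRealized (a b c : Fin 3) (t R : Fin 3 → Fin 3 → ℤ) : Prop :=
  ∃ y S H q N m, IsTower y S H q N m ∧ (∀ k l, m k l = m l k) ∧ q a < q b ∧ q b < q c ∧
    ∀ k l, k ≠ l → t k l = m k l + N k + N l ∧ R k l = N l - N k - if q l < q k then 1 else 0

namespace IsRealized

variable {a b c : Fin 3} {t R : Fin 3 → Fin 3 → ℤ}

theorem base : IsRealized 0 1 2 (fun _ _ => 0) fun k l => if l < k then -1 else 0 := by
  obtain ⟨y, S, H, q, hq, hy⟩ := exists_isTower_fan
  refine ⟨y, S, H, q, _, _, hy, fun _ _ => rfl, hq (by decide), hq (by decide), fun k l _ => ?_⟩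
  simp only [hq.lt_iff_lt]
  split_ifs <;> simp

theorem eq_or (h : IsRealized a b c t R) (k : Fin 3) : k = a ∨ k = b ∨ k = c := by
  obtain ⟨y, S, H, q, N, m, -, -, hab, hbc, -⟩ := h
  have h1 : a ≠ b := fun e => by rw [e] at hab; exact lt_irrefl _ hab
  have h2 : b ≠ c := fun e => by rw [e] at hbc; exact lt_irrefl _ hbc
  have h3 : a ≠ c := fun e => by rw [e] at hab; exact lt_irrefl _ (hab.trans hbc)
  clear hab hbc
  revert a b c k
  decide

/-- The last strand turns around and becomes the first one. -/
theorem rotate (h : IsRealized a b c t R) : IsRealized c a b t R := by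
  have hor := h.eq_or
  obtain ⟨y, S, H, q, N, m, hy, hm, hab, hbc, hval⟩ := h
  have hac : a ≠ c := fun e => by rw [e] at hab; exact lt_irrefl _ (hab.trans hbc)
  have hbc' : b ≠ c := fun e => by rw [e] at hbc; exact lt_irrefl _ hbc
  -- The new lane is one unit to the left of all others. The deep dip adds 1 to N c and the two
  -- overtakings subtract 1 from m, so t is unchanged; in R the change of N c is absorbed by the
  -- reversed comparison of lanes.
  have hc : q a - 1 - q c < 0 := by linarith
  obtain ⟨w, ℓ, hw⟩ := exists_isMove_left hc
  have hlt : ∀ k, k ≠ c → q a ≤ q k ∧ q k < q c := fun k hk => by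
    rcases hor k with rfl | rfl | rfl
    · exact ⟨le_rfl, hab.trans hbc⟩
    · exact ⟨hab.le, hbc⟩
    · exact absurd rfl hk
  obtain ⟨y', S', H', hy'⟩ := hy.move c hw fun k hk => by linarith [(hlt k hk).1]
  have hcross : ∀ k, k ≠ c → crossSign (q c - q k) (q c + (q a - 1 - q c) - q k) = -1 :=
    fun k hk => by
      have := hlt k hk
      rw [crossSign, if_neg (fun h => by linarith [h.1]), if_pos ⟨by linarith, by linarith⟩]
  refine ⟨y', S', H', _, _, _, hy', fun k l => ?_, ?_, ?_, fun k l hkl => ?_⟩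
  · rw [hm k l]
    ring
  · simp only [if_neg hac, if_pos]
    linarith
  · simpa only [if_neg hac, if_neg hbc', add_zero] using hab
  · obtain ⟨h1, h2⟩ := hval k l hkl
    rw [h1, h2]
    by_cases hk : k = c
    · have hl : l ≠ c := fun e => hkl (hk.trans e.symm)
      have := hlt l hl
      simp only [hk, if_true, if_neg hl, hcross l hl, add_zero]
      rw [if_pos this.2, if_neg (by linarith)]
      constructor <;> ring
    · by_cases hl : l = c
      · have := hlt k hk
        simp only [hl, if_true, if_neg hk, hcross k hk, add_zero]
        rw [if_neg (by linarith), if_pos (by linarith)]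
        constructor <;> ring
      · simp only [if_neg hk, if_neg hl, add_zero]
        simp

/-- The first strand overtakes the second one. -/
theorem swap (h : IsRealized a b c t R) : IsRealized b a c
    (fun k l => t k l + if k = a ∧ l = b ∨ k = b ∧ l = a then 1 else 0)
    (fun k l => R k l - (if k = a ∧ l = b then 1 else 0) + if k = b ∧ l = a then 1 else 0) := by
  have hor := h.eq_or
  obtain ⟨y, S, H, q, N, m, hy, hm, hab, hbc, hval⟩ := h
  have hab' : a ≠ b := fun e => by rw [e] at hab; exact lt_irrefl _ hab
  have hac : a ≠ c := fun e => by rw [e] at hab; exact lt_irrefl _ (hab.trans hbc)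
  have hbc' : b ≠ c := fun e => by rw [e] at hbc; exact lt_irrefl _ hbc
  -- The target lane is midway between b and c, so that only b is overtaken.
  have hc : 0 < (q b + q c) / 2 - q a := by linarith
  obtain ⟨w, ℓ, hw⟩ := exists_isMove_right hc
  obtain ⟨y', S', H', hy'⟩ := hy.move a hw fun k hk => by
    rcases hor k with rfl | rfl | rfl
    · exact absurd rfl hk
    · linarith
    · linarith
  have hcrossb : crossSign (q a - q b) (q a + ((q b + q c) / 2 - q a) - q b) = 1 := by
    rw [crossSign, if_pos ⟨by linarith, by linarith⟩]
  have hcrossc : crossSign (q a - q c) (q a + ((q b + q c) / 2 - q a) - q c) = 0 := by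
    rw [crossSign, if_neg (fun h => by linarith [h.2]), if_neg (fun h => by linarith [h.1])]
  refine ⟨y', S', H', _, _, _, hy', fun k l => ?_, ?_, ?_, fun k l hkl => ?_⟩
  · rw [hm k l]
    ring
  · simp only [if_neg hab'.symm, if_pos]
    linarith
  · simp only [if_neg hac.symm, if_pos]
    linarith
  · obtain ⟨h1, h2⟩ := hval k l hkl
    have h3 : q b < (q b + q c) / 2 := by linarith
    have h4 : (q b + q c) / 2 < q c := by linarith
    have h5 := hab.trans hbc
    rw [add_sub_cancel] at hcrossb hcrossc
    generalize (q b + q c) / 2 = p at *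
    simp only [h1, h2]
    clear h1 h2 hy hy' hval hw
    rcases hor k with rfl | rfl | rfl <;> rcases hor l with rfl | rfl | rfl <;>
      try exact absurd rfl hkl
    all_goals
      simp [hab', hab'.symm, hac.symm, hbc'.symm, hcrossb, hcrossc, hab, hbc, h3, h4,
        h5, hab.not_gt, hbc.not_gt, h3.not_gt, h4.not_gt, h5.not_gt] <;> ring

end IsRealized

/-! ### The combinatorics of overtakings -/

/-- There is a tower as in `IsRealized` with the given values at the three pairs of strands. -/
def Achieves (a b c : Fin 3) (t₀₁ t₀₂ t₁₂ u v w : ℤ) : Prop :=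
  ∃ t R, IsRealized a b c t R ∧ t 0 1 = t₀₁ ∧ t 0 2 = t₀₂ ∧ t 1 2 = t₁₂ ∧
    R 0 1 = u ∧ R 0 2 = v ∧ R 1 2 = w

namespace Achieves

variable {t₀₁ t₀₂ t₁₂ u v w : ℤ}

/-- Rotations are free, so any two cyclically adjacent strands can be exchanged. In this lemma and
the next two an overtaking leads from the cyclic order 0, 1, 2 to the order 0, 2, 1 and lowers u - v
+ w by 1. -/
theorem pos₀₁ (h : Achieves 0 1 2 t₀₁ t₀₂ t₁₂ u v w) :
    Achieves 0 2 1 (t₀₁ + 1) t₀₂ t₁₂ (u - 1) v w := by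
  obtain ⟨t, R, h, rfl, rfl, rfl, rfl, rfl, rfl⟩ := h
  exact ⟨_, _, h.swap.rotate.rotate, by simp⟩

theorem pos₁₂ (h : Achieves 0 1 2 t₀₁ t₀₂ t₁₂ u v w) :
    Achieves 0 2 1 t₀₁ t₀₂ (t₁₂ + 1) u v (w - 1) := by
  obtain ⟨t, R, h, rfl, rfl, rfl, rfl, rfl, rfl⟩ := h
  exact ⟨_, _, h.rotate.rotate.swap.rotate, by simp⟩

theorem pos₀₂ (h : Achieves 0 1 2 t₀₁ t₀₂ t₁₂ u v w) :
    Achieves 0 2 1 t₀₁ (t₀₂ + 1) t₁₂ u (v + 1) w := by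
  obtain ⟨t, R, h, rfl, rfl, rfl, rfl, rfl, rfl⟩ := h
  exact ⟨_, _, h.rotate.swap, by simp⟩

/-- The overtakings which lead back: each raises one t by 1 and u - v + w by 1. -/
theorem neg₀₁ (h : Achieves 0 2 1 t₀₁ t₀₂ t₁₂ u v w) :
    Achieves 0 1 2 (t₀₁ + 1) t₀₂ t₁₂ (u + 1) v w := by
  obtain ⟨t, R, h, rfl, rfl, rfl, rfl, rfl, rfl⟩ := h
  exact ⟨_, _, h.rotate.swap, by simp⟩

theorem neg₁₂ (h : Achieves 0 2 1 t₀₁ t₀₂ t₁₂ u v w) :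
    Achieves 0 1 2 t₀₁ t₀₂ (t₁₂ + 1) u v (w + 1) := by
  obtain ⟨t, R, h, rfl, rfl, rfl, rfl, rfl, rfl⟩ := h
  exact ⟨_, _, h.rotate.rotate.swap.rotate, by simp⟩

theorem neg₀₂ (h : Achieves 0 2 1 t₀₁ t₀₂ t₁₂ u v w) :
    Achieves 0 1 2 t₀₁ (t₀₂ + 1) t₁₂ u (v - 1) w := by
  obtain ⟨t, R, h, rfl, rfl, rfl, rfl, rfl, rfl⟩ := h
  exact ⟨_, _, h.swap.rotate.rotate, by simp⟩

end Achieves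

/-- Induction on the number of overtakings: the last one is undone. Its direction is prescribed by
the cyclic order, so what has to be found is a pair whose rotation number may be changed in this
direction without violating the bound. -/
theorem achieves (n : ℕ) : ∀ t₀₁ t₀₂ t₁₂ u v w : ℤ, t₀₁ + t₀₂ + t₁₂ = n → |u| ≤ t₀₁ → |v| ≤ t₀₂ →
    |w| ≤ t₁₂ → Even (t₀₁ - u) → Even (t₀₂ - v) → Even (t₁₂ - w) →
    (u - v + w = 0 → Achieves 0 1 2 t₀₁ t₀₂ t₁₂ u v w) ∧
      (u - v + w = -1 → Achieves 0 2 1 t₀₁ t₀₂ t₁₂ u v w) := by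
  induction n with
  | zero =>
    intro t₀₁ t₀₂ t₁₂ u v w hsum hu hv hw _ _ _
    rw [abs_le] at hu hv hw
    obtain rfl : t₀₁ = 0 := by omega
    obtain rfl : t₀₂ = 0 := by omega
    obtain rfl : t₁₂ = 0 := by omega
    obtain rfl : u = 0 := by omega
    obtain rfl : v = 0 := by omega
    obtain rfl : w = 0 := by omega
    exact ⟨fun _ => ⟨_, _, IsRealized.base, by simp⟩, fun h => by omega⟩
  | succ n ih =>
    intro t₀₁ t₀₂ t₁₂ u v w hsum hu hv hw ⟨k₀₁, e₀₁⟩ ⟨k₀₂, e₀₂⟩ ⟨k₁₂, e₁₂⟩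
    simp only [abs_le, even_iff_exists_add_self] at hu hv hw ih
    push_cast at hsum
    refine ⟨fun hrot => ?_, fun hrot => ?_⟩
    · by_cases h₀₁ : 1 ≤ u ∨ -u ≤ t₀₁ - 2
      · have := (ih (t₀₁ - 1) t₀₂ t₁₂ (u - 1) v w (by omega) (by omega) hv hw ⟨k₀₁, by omega⟩
          ⟨k₀₂, by omega⟩ ⟨k₁₂, by omega⟩).2 (by omega)
        simpa using this.neg₀₁
      · by_cases h₁₂ : 1 ≤ w ∨ -w ≤ t₁₂ - 2
        · have := (ih t₀₁ t₀₂ (t₁₂ - 1) u v (w - 1) (by omega) hu hv (by omega) ⟨k₀₁, by omega⟩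
            ⟨k₀₂, by omega⟩ ⟨k₁₂, by omega⟩).2 (by omega)
          simpa using this.neg₁₂
        -- By parity u = -t₀₁ and w = -t₁₂ are now minimal, so v = u + w ≤ 0. If v < 0, then |v + 1|
        -- = |v| - 1. If v = 0, then t₀₁ = t₁₂ = 0 and t₀₂ is even and positive, hence at least 2.
        · have := (ih t₀₁ (t₀₂ - 1) t₁₂ u (v + 1) w (by omega) hu (by omega) hw ⟨k₀₁, by omega⟩
            ⟨k₀₂ - 1, by omega⟩ ⟨k₁₂, by omega⟩).2 (by omega)
          simpa using this.neg₀₂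
    · by_cases h₀₁ : u ≤ -1 ∨ u ≤ t₀₁ - 2
      · have := (ih (t₀₁ - 1) t₀₂ t₁₂ (u + 1) v w (by omega) (by omega) hv hw ⟨k₀₁ - 1, by omega⟩
          ⟨k₀₂, by omega⟩ ⟨k₁₂, by omega⟩).1 (by omega)
        simpa using this.pos₀₁
      · by_cases h₁₂ : w ≤ -1 ∨ w ≤ t₁₂ - 2
        · have := (ih t₀₁ t₀₂ (t₁₂ - 1) u v (w + 1) (by omega) hu hv (by omega) ⟨k₀₁, by omega⟩
            ⟨k₀₂, by omega⟩ ⟨k₁₂ - 1, by omega⟩).1 (by omega)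
          simpa using this.pos₁₂
        -- Here u = t₀₁ and w = t₁₂ are maximal, so v = u + w + 1 ≥ 1 and |v - 1| = |v| - 1.
        · have := (ih t₀₁ (t₀₂ - 1) t₁₂ u (v - 1) w (by omega) hu (by omega) hw ⟨k₀₁, by omega⟩
            ⟨k₀₂, by omega⟩ ⟨k₁₂, by omega⟩).1 (by omega)
          simpa using this.pos₀₂

theorem Achieves.exists_graph {a b c : Fin 3} {t₀₁ t₀₂ t₁₂ u v w : ℤ}
    (h : Achieves a b c t₀₁ t₀₂ t₁₂ u v w) :
    ∃ G : LegendrianThetaGraph, G.IsStandardNearVertices ∧ ∀ k,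
      IsUnknot (G.cycleSet (outEdge k) (backEdge k)) ∧
      G.HasTB (outEdge k) (backEdge k) (-1 - (![t₀₁, t₀₂, t₁₂] : Fin 3 → ℤ) k) ∧
      G.HasRot (outEdge k) (backEdge k) ((![u, v, w] : Fin 3 → ℤ) k) := by
  obtain ⟨t, R, ⟨y, S, H, q, N, m, hy, hm, -, -, hval⟩, rfl, rfl, rfl, rfl, rfl, rfl⟩ := h
  obtain ⟨G, hG, hG'⟩ := hy.exists_graph hm
  refine ⟨G, hG, ?_⟩
  have key : ∀ i j : Fin 3, i < j → IsUnknot (G.cycleSet i j) ∧ G.HasTB i j (-1 - t i j) ∧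
      G.HasRot i j (R i j) := fun i j hij => by
    obtain ⟨h1, h2⟩ := hval i j hij.ne
    obtain ⟨h3, h4, h5⟩ := hG' i j hij
    refine ⟨h3, ?_, h2 ▸ h5⟩
    convert h4 using 1
    rw [h1]
    ring
  intro k
  fin_cases k
  · exact key 0 1 (by decide)
  · exact key 0 2 (by decide)
  · exact key 1 2 (by decide)

/-- In terms of t = -1 - tb the hypotheses say that |rot| ≤ t and that t and rot have the same
parity, as `achieves` requires; the two values of the alternating sum select the cyclic order. -/
theorem mainTheorem1 (tb rot : Fin 3 → ℤ)
    (hparity : ∀ k, ¬ (Even (tb k) ↔ Even (rot k)))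
    (hbound : ∀ k, tb k + |rot k| ≤ -1)
    (hR : rot 0 - rot 1 + rot 2 = 0 ∨ rot 0 - rot 1 + rot 2 = -1) :
    ∃ G : LegendrianThetaGraph, G.IsStandardNearVertices ∧
      ∀ k, IsUnknot (G.cycleSet (outEdge k) (backEdge k)) ∧
        G.HasTB (outEdge k) (backEdge k) (tb k) ∧
        G.HasRot (outEdge k) (backEdge k) (rot k) := by
  have hle : ∀ k, |rot k| ≤ -1 - tb k := fun k => by linarith [hbound k]
  have heven : ∀ k, Even (-1 - tb k - rot k) := fun k => by
    have h := hparity k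
    rw [Int.even_iff, Int.even_iff] at h
    rw [Int.even_iff]
    omega
  have hnn : ∀ k, 0 ≤ -1 - tb k := fun k => (abs_nonneg _).trans (hle k)
  obtain ⟨n, hn⟩ : ∃ n : ℕ, (-1 - tb 0) + (-1 - tb 1) + (-1 - tb 2) = n :=
    ⟨_, (Int.toNat_of_nonneg (by linarith [hnn 0, hnn 1, hnn 2])).symm⟩
  have h := achieves n _ _ _ _ _ _ hn (hle 0) (hle 1) (hle 2) (heven 0) (heven 1) (heven 2)
  obtain ⟨G, hG, hG'⟩ := hR.elim (fun e => (h.1 e).exists_graph) fun e => (h.2 e).exists_graph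
  refine ⟨G, hG, fun k => ?_⟩
  have := hG' k
  fin_cases k <;> simpa using this
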